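/- **Theorem (homotopy excision).** Let $p$ be a prime and let $\mathbf{k}$ be a perfect field of characteristic $p$. Let $\mathsf{sLie}^r$ be the category of simplicial restricted Lie algebras over $\mathbf{k}$, i.e. simplicial objects in the category of Lie algebras $L$ over $\mathbf{k}$ equipped with a $p$-operation $\xi\colon L\to L$. For $L_\bullet\in\mathsf{sLie}^r$ let $\pi_i(L_\bullet)$, $i\ge 0$, be the homotopy groups of the underlying simplicial vector space, that is, the homology of the normalized chain complex $(NL)_n=\bigcap_{j=1}^n\ker(d_j)$ with differential $d_0$. Weak equivalences are the morphisms inducing isomorphisms on all $\pi_i$, cofibrations are the morphisms with the left lifting property with respect to all degreewise surjective weak equivalences, and $\mathrm{Ho}(\mathsf{sLie}^r)$ is the localization at the weak equivalences. Call $L_\bullet$ connected if $\pi_0(L_\bullet)=0$; call a morphism of $\mathsf{sLie}^r$ or of $\mathrm{Ho}(\mathsf{sLie}^r)$ $n$-connected if it induces an isomorphism on $\pi_i$ for $i<n$ and a surjection on $\pi_n$. For a morphism $f\colon L'_\bullet\to L_\bullet$ let $\mathrm{fib}(f)=L'_\bullet\times_{L_\bullet}PL_\bullet$ be its homotopy fiber,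 where $PL_\bullet\to L_\bullet$ is the simplicial path object, given by $(PL)_n=\{y\in L_{n+1} : \text{the vertex } 0 \text{ of } y \text{ is } 0\}$ with projection $d_0$, and let $\Omega L_\bullet=\mathrm{fib}(0\to L_\bullet)$. A homotopy cofiber $\mathrm{cofib}(f)$ is the pushout $B_\bullet\sqcup_{A_\bullet}0$ for a commutative square $$\begin{array}{ccc}A_\bullet&\xrightarrow{\ j\ }&B_\bullet\\ \downarrow&&\downarrow\\ L'_\bullet&\xrightarrow{\ f\ }&L_\bullet\end{array}$$ whose vertical maps are weak equivalences, with $A_\bullet$ cofibrant and $j$ a cofibration. The natural map $\mathrm{fib}(f)\to\Omega\,\mathrm{cofib}(f)$ in $\mathrm{Ho}(\mathsf{sLie}^r)$ is the composite of the inverse of the weak equivalence $\mathrm{fib}(j)\to\mathrm{fib}(f)$ with the map $\mathrm{fib}(j)\to\mathrm{fib}(0\to\mathrm{cofib}(f))=\Omega\,\mathrm{cofib}(f)$ induced by $B_\bullet\to\mathrm{cofib}(f)$. Let $n\ge 0$ and let $f\colon L'_\bullet\to L_\bullet$ be an $n$-connected morphism in $\mathsf{sLie}^r$ with $L'_\bullet$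 connected. Then a homotopy cofiber of $f$ exists, and for every homotopy cofiber of $f$ the natural map $$\mathrm{fib}(f)\to\Omega\,\mathrm{cofib}(f)$$ is $(n+1)$-connected. -/

import Mathlib

open CategoryTheory Opposite

universe u

/-! ### Restricted Lie algebras -/

/-- `adCoeff x y m j` is the coefficient of `t ^ j` in the formal expression
`ad (t x + y) ^ m (x)`, where `ad a (b) = ⁅b, a⁆`. -/
def adCoeff {L : Type*} [LieRing L] (x y : L) : ℕ → ℕ → L
  | 0, 0 => x
  | 0, _ + 1 => 0
  | m + 1, 0 => ⁅adCoeff x y m 0, y⁆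
  | m + 1, j + 1 => ⁅adCoeff x y m (j + 1), y⁆ + ⁅adCoeff x y m j, x⁆

/-- `adCoeff` really computes the coefficients of `ad (t x + y) ^ m (x)` in `k[t] ⊗ L`. -/
theorem iterate_ad_eq_sum_adCoeff {k L : Type*} [Field k] [LieRing L] [LieAlgebra k L]
    (x y : L) (m : ℕ) :
    (fun z : TensorProduct k (Polynomial k) L =>
        ⁅z, (Polynomial.X : Polynomial k) ⊗ₜ[k] x + (1 : Polynomial k) ⊗ₜ[k] y⁆)^[m]
        ((1 : Polynomial k) ⊗ₜ[k] x) =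
      ∑ j ∈ Finset.range (m + 1),
        ((Polynomial.X : Polynomial k) ^ j) ⊗ₜ[k] (adCoeff x y m j) := by
  have key : ∀ m j, m < j → adCoeff x y m j = 0 := by
    intro m
    induction m with
    | zero => intro j hj; cases j with
      | zero => omega
      | succ j => rfl
    | succ m ih => intro j hj; cases j with
      | zero => omega
      | succ j => simp [adCoeff, ih (j + 1) (by omega), ih j (by omega)]
  induction m with
  | zero => simp [adCoeff]
  | succ m ih =>
    rw [Function.iterate_succ_apply', ih]
    have h1 : ∀ z w : TensorProduct k (Polynomial k) L, ∀ v, ⁅z, w + v⁆ = ⁅z, w⁆ + ⁅z, v⁆ :=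
      fun z w v => lie_add z w v
    have h2 : ∀ (f : ℕ → TensorProduct k (Polynomial k) L)
        (w : TensorProduct k (Polynomial k) L) (n : ℕ),
        ⁅∑ j ∈ Finset.range n, f j, w⁆ = ∑ j ∈ Finset.range n, ⁅f j, w⁆ :=
      fun f w n => sum_lie (L := TensorProduct k (Polynomial k) L)
        (M := TensorProduct k (Polynomial k) L) _ _ _
    conv_rhs => rw [Finset.sum_range_succ']
    simp only [h1, h2, LieAlgebra.ExtendScalars.bracket_tmul, ← pow_succ, mul_one, adCoeff,
      TensorProduct.tmul_add, Finset.sum_add_distrib]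
    rw [Finset.sum_range_succ (fun j => ((Polynomial.X : Polynomial k) ^ (j + 1)) ⊗ₜ[k]
      ⁅adCoeff x y m (j + 1), y⁆), key m (m + 1) (by omega),
      Finset.sum_range_succ' (fun j => ((Polynomial.X : Polynomial k) ^ j) ⊗ₜ[k]
      ⁅adCoeff x y m j, y⁆)]
    simp only [zero_lie, TensorProduct.tmul_zero, add_zero]
    abel

/-- A `p`-operation `ξ` on a Lie algebra `L` over `k`, making `L` a restricted Lie algebra. -/
class RestrictedLieAlgebra (p : ℕ) (k L : Type*) [Field k] [LieRing L] [LieAlgebra k L] where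
  /-- The `p`-operation. -/
  xi : L → L
  xi_smul : ∀ (a : k) (x : L), xi (a • x) = a ^ p • xi x
  lie_xi : ∀ x y : L, ⁅y, xi x⁆ = (fun z => ⁅z, x⁆)^[p] y
  xi_add : ∀ x y : L, xi (x + y) =
    xi x + xi y + ∑ i ∈ Finset.Icc 1 (p - 1), (i : k)⁻¹ • adCoeff x y (p - 1) (i - 1)

/-- The category `rLie` of restricted Lie algebras over `k`: objects. -/
structure RLie (p : ℕ) (k : Type u) [Field k] where
  carrier : Type u
  [lieRing : LieRing carrier]
  [lieAlgebra : LieAlgebra k carrier]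
  [restricted : RestrictedLieAlgebra p k carrier]

namespace RLie

variable {p : ℕ} {k : Type u} [Field k]

attribute [instance] lieRing lieAlgebra restricted

instance : CoeSort (RLie p k) (Type u) := ⟨RLie.carrier⟩

/-- The `p`-operation of a restricted Lie algebra. -/
def xi {L : RLie p k} (x : L) : L := RestrictedLieAlgebra.xi p k x

/-- Homomorphisms of restricted Lie algebras. -/
@[ext]
structure Hom (L' L : RLie p k) where
  toLieHom : L' →ₗ⁅k⁆ L
  map_xi : ∀ x : L', toLieHom (xi x) = xi (toLieHom x)

instance : Category (RLie p k) where
  Hom L' L := Hom L' L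
  id L := ⟨LieHom.id, fun _ => rfl⟩
  comp f g := ⟨g.toLieHom.comp f.toLieHom, fun x => by simp [f.map_xi, g.map_xi]⟩

/-- The underlying linear map of a morphism. -/
def lin {L' L : RLie p k} (f : L' ⟶ L) : L' →ₗ[k] L := (Hom.toLieHom f : L' →ₗ[k] L)

theorem lin_id (L : RLie p k) (x : L) : lin (𝟙 L) x = x := rfl

theorem lin_comp {A B C : RLie p k} (f : A ⟶ B) (g : B ⟶ C) (x : A) :
    lin (f ≫ g) x = lin g (lin f x) := rfl

theorem lin_lie {A B : RLie p k} (f : A ⟶ B) (x y : A) : lin f ⁅x, y⁆ = ⁅lin f x, lin f y⁆ :=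
  LieHom.map_lie (Hom.toLieHom f) x y

theorem lin_xi {A B : RLie p k} (f : A ⟶ B) (x : A) : lin f (xi x) = xi (lin f x) :=
  Hom.map_xi f x

theorem hom_ext {A B : RLie p k} {f g : A ⟶ B} (h : ∀ x, lin f x = lin g x) : f = g :=
  Hom.ext (LieHom.ext h)

/-- A linear map respecting the bracket and the `p`-operation is a morphism. -/
def mkHom {A B : RLie p k} (f : A →ₗ[k] B) (h1 : ∀ x y, f ⁅x, y⁆ = ⁅f x, f y⁆)
    (h2 : ∀ x, f (xi x) = xi (f x)) : A ⟶ B :=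
  (⟨{ f with map_lie' := fun {x y} => h1 x y }, h2⟩ : Hom A B)

theorem lin_mkHom {A B : RLie p k} (f : A →ₗ[k] B) (h1 : ∀ x y, f ⁅x, y⁆ = ⁅f x, f y⁆)
    (h2 : ∀ x, f (xi x) = xi (f x)) (x : A) : lin (mkHom f h1 h2) x = f x := rfl

theorem adCoeff_map {A B : RLie p k} (f : A ⟶ B) (x y : A) (m j : ℕ) :
    lin f (adCoeff x y m j) = adCoeff (lin f x) (lin f y) m j := by
  induction m generalizing j with
  | zero => cases j <;> simp [adCoeff]
  | succ m ih => cases j <;> simp [adCoeff, lin_lie, ih]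

theorem adCoeff_fst {A B : Type*} [LieRing A] [LieRing B] (x y : A × B) (m j : ℕ) :
    adCoeff x y m j = (adCoeff x.1 y.1 m j, adCoeff x.2 y.2 m j) := by
  induction m generalizing j with
  | zero => cases j <;> rfl
  | succ m ih => cases j <;> simp [adCoeff, ih]

/-- The product of two restricted Lie algebras, with componentwise structure. -/
instance prodRestricted (A B : RLie p k) : RestrictedLieAlgebra p k (A × B) where
  xi x := (xi x.1, xi x.2)
  xi_smul a x := by
    simp [xi, RestrictedLieAlgebra.xi_smul]
  lie_xi x y := by
    have h : ∀ (m : ℕ) (y : A × B), (fun z => ⁅z, x⁆)^[m] y =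
        ((fun z => ⁅z, x.1⁆)^[m] y.1, (fun z => ⁅z, x.2⁆)^[m] y.2) := by
      intro m
      induction m with
      | zero => intro y; rfl
      | succ m ih => intro y; rw [Function.iterate_succ_apply, ih]; rfl
    rw [h, ← RestrictedLieAlgebra.lie_xi (p := p) (k := k),
      ← RestrictedLieAlgebra.lie_xi (p := p) (k := k)]
    rfl
  xi_add x y := by
    simp [xi, RestrictedLieAlgebra.xi_add, adCoeff_fst, Prod.ext_iff, Prod.fst_sum, Prod.snd_sum]

/-- The product of two restricted Lie algebras. -/
def prod (A B : RLie p k) : RLie p k where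
  carrier := A × B

/-- A restricted Lie subalgebra. -/
structure Sub (L : RLie p k) extends LieSubalgebra k L where
  xi_mem : ∀ x ∈ carrier, xi x ∈ carrier

theorem adCoeff_coe {L : RLie p k} (S : LieSubalgebra k L) (x y : S) (m j : ℕ) :
    ((adCoeff x y m j : S) : L) = adCoeff (x : L) (y : L) m j := by
  induction m generalizing j with
  | zero => cases j <;> simp [adCoeff]
  | succ m ih => cases j <;> simp [adCoeff, ih]

instance subRestricted {L : RLie p k} (S : Sub L) :
    RestrictedLieAlgebra p k S.toLieSubalgebra where
  xi x := ⟨xi x.1, S.xi_mem x.1 x.2⟩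
  xi_smul a x := Subtype.ext (RestrictedLieAlgebra.xi_smul a x.1)
  lie_xi x y := by
    have h : ∀ (m : ℕ) (y : S.toLieSubalgebra), ((((fun z => ⁅z, x⁆)^[m] y) :
        S.toLieSubalgebra) : L) = (fun z => ⁅z, (x : L)⁆)^[m] y := by
      intro m
      induction m with
      | zero => intro y; rfl
      | succ m ih => intro y; rw [Function.iterate_succ_apply, ih]; rfl
    apply Subtype.ext
    rw [h]
    exact RestrictedLieAlgebra.lie_xi x.1 y.1
  xi_add x y := by
    apply Subtype.ext
    simp only [AddMemClass.coe_add, xi, RestrictedLieAlgebra.xi_add]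
    congr 1
    rw [← LieSubalgebra.coe_incl, map_sum]
    simp [adCoeff_coe]

/-- A restricted Lie subalgebra, as a restricted Lie algebra. -/
def Sub.toRLie {L : RLie p k} (S : Sub L) : RLie p k where
  carrier := S.toLieSubalgebra

/-- The zero Lie algebra structure on a point. -/
@[reducible]
def punitLieRing : LieRing PUnit.{u + 1} where
  bracket _ _ := 0
  add_lie _ _ _ := rfl
  lie_add _ _ _ := rfl
  lie_self _ := rfl
  leibniz_lie _ _ _ := rfl

variable (p k) in
/-- The zero restricted Lie algebra. -/
def zero : RLie p k :=
  letI : LieRing PUnit.{u + 1} := punitLieRing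
  letI : LieAlgebra k PUnit.{u + 1} := { lie_smul := fun _ _ _ => rfl }
  letI : RestrictedLieAlgebra p k PUnit.{u + 1} :=
    { xi := fun x => x
      xi_smul := fun _ _ => rfl
      lie_xi := fun _ _ => rfl
      xi_add := fun _ _ => rfl }
  { carrier := PUnit.{u + 1} }

theorem xi_zero {L : RLie p k} : xi (0 : L) = 0 := by
  have h : ∀ m j, adCoeff (0 : L) 0 m j = 0 := by
    intro m
    induction m with
    | zero => intro j; cases j <;> rfl
    | succ m ih => intro j; cases j <;> simp [adCoeff]
  have := RestrictedLieAlgebra.xi_add (p := p) (k := k) (0 : L) 0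
  simpa [h, xi] using this

theorem zero_eq (x : zero p k) : x = 0 := rfl

end RLie

/-! ### Simplicial restricted Lie algebras and their homotopy groups -/

section SimplicialLie

variable {p : ℕ} {k : Type u} [Field k]

/-- The category `sLie^r` of simplicial restricted Lie algebras. -/
abbrev SRLie (p : ℕ) (k : Type u) [Field k] := SimplicialObject (RLie p k)

namespace SRLie

/-- The normalized chain complex `N L` of the underlying simplicial vector space:
`(N L)_n` is the intersection of the kernels of `d_1, …, d_n`; its differential is `d_0`. -/
def normalized (L : SRLie p k) : (n : ℕ) → Submodule k (L.obj (op (.mk n)))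
  | 0 => ⊤
  | m + 1 => ⨅ j : Fin (m + 1), LinearMap.ker (RLie.lin (L.δ j.succ))

/-- The `n`-cycles of `N L`. -/
def cycles (L : SRLie p k) : (n : ℕ) → Submodule k (L.obj (op (.mk n)))
  | 0 => ⊤
  | m + 1 => L.normalized (m + 1) ⊓ LinearMap.ker (RLie.lin (L.δ 0))

open Simplicial

/-- The `n`-boundaries of `N L`. -/
def boundaries (L : SRLie p k) (n : ℕ) : Submodule k (L _⦋n⦌) :=
  (L.normalized (n + 1)).map (RLie.lin (L.δ 0))

/-- The homotopy group `π_n(L) = H_n(N L)`. -/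
abbrev homotopyGroup (L : SRLie p k) (n : ℕ) : Type u :=
  L.cycles n ⧸ (L.boundaries n).submoduleOf (L.cycles n)

theorem lin_δ_naturality {L' L : SRLie p k} (f : L' ⟶ L) {n : ℕ} (j : Fin (n + 2))
    (x : L' _⦋n + 1⦌) :
    RLie.lin (f.app (op ⦋n⦌)) (RLie.lin (L'.δ j) x) =
      RLie.lin (L.δ j) (RLie.lin (f.app (op ⦋n + 1⦌)) x) := by
  rw [← RLie.lin_comp, ← RLie.lin_comp, SimplicialObject.δ_naturality]

theorem mem_normalized_succ {L : SRLie p k} {n : ℕ} {x : L _⦋n + 1⦌} :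
    x ∈ L.normalized (n + 1) ↔ ∀ j : Fin (n + 1), RLie.lin (L.δ j.succ) x = 0 := by
  simp [normalized]

theorem normalized_map {L' L : SRLie p k} (f : L' ⟶ L) {n : ℕ} {x : L' _⦋n⦌}
    (hx : x ∈ L'.normalized n) : RLie.lin (f.app (op ⦋n⦌)) x ∈ L.normalized n := by
  cases n with
  | zero => trivial
  | succ n =>
    rw [mem_normalized_succ] at hx ⊢
    intro j
    rw [← lin_δ_naturality, hx, map_zero]

theorem cycles_map {L' L : SRLie p k} (f : L' ⟶ L) {n : ℕ} {x : L' _⦋n⦌}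
    (hx : x ∈ L'.cycles n) : RLie.lin (f.app (op ⦋n⦌)) x ∈ L.cycles n := by
  cases n with
  | zero => trivial
  | succ n =>
    refine ⟨normalized_map f hx.1, ?_⟩
    have h : RLie.lin (L'.δ 0) x = 0 := hx.2
    change RLie.lin (L.δ 0) _ = 0
    rw [← lin_δ_naturality, h, map_zero]

theorem boundaries_map {L' L : SRLie p k} (f : L' ⟶ L) {n : ℕ} {x : L' _⦋n⦌}
    (hx : x ∈ L'.boundaries n) : RLie.lin (f.app (op ⦋n⦌)) x ∈ L.boundaries n := by
  obtain ⟨y, hy, rfl⟩ := hx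
  exact ⟨_, normalized_map f hy, (lin_δ_naturality f 0 y).symm⟩

/-- The map induced by `f` on `n`-cycles. -/
def cyclesMap {L' L : SRLie p k} (f : L' ⟶ L) (n : ℕ) : L'.cycles n →ₗ[k] L.cycles n :=
  (RLie.lin (f.app (op ⦋n⦌))).restrict fun _ hx => cycles_map f hx

/-- The map `π_n(f)`. -/
def homotopyGroupMap {L' L : SRLie p k} (f : L' ⟶ L) (n : ℕ) :
    L'.homotopyGroup n →ₗ[k] L.homotopyGroup n :=
  Submodule.mapQ _ _ (cyclesMap f n) fun _ hx => boundaries_map f hx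

/-- The functor `π_n`. -/
def homotopyGroupFunctor (p : ℕ) (k : Type u) [Field k] (n : ℕ) : SRLie p k ⥤ ModuleCat.{u} k where
  obj L := ModuleCat.of k (L.homotopyGroup n)
  map f := ModuleCat.ofHom (homotopyGroupMap f n)
  map_id L := by
    ext x
    rfl
  map_comp f g := by
    ext x
    rfl

/-- `L` is connected if `π_0(L) = 0`. -/
def IsConnected (L : SRLie p k) : Prop := Subsingleton (L.homotopyGroup 0)

/-- A morphism is `n`-connected if it induces an isomorphism on `π_i` for `i < n` and a
surjection on `π_n`. -/
def IsNConnected (n : ℕ) {L' L : SRLie p k} (f : L' ⟶ L) : Prop :=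
  (∀ i < n, Function.Bijective (homotopyGroupMap f i)) ∧
    Function.Surjective (homotopyGroupMap f n)

/-! ### Weak equivalences, cofibrations and the homotopy category -/

/-- Weak equivalences: morphisms inducing isomorphisms on all homotopy groups. -/
def weakEquivalences (p : ℕ) (k : Type u) [Field k] : MorphismProperty (SRLie p k) :=
  fun _ _ f => ∀ n, Function.Bijective (homotopyGroupMap f n)

/-- Acyclic fibrations: degreewise surjective weak equivalences. -/
def acyclicFibrations (p : ℕ) (k : Type u) [Field k] : MorphismProperty (SRLie p k) :=
  fun _ _ f => weakEquivalences p k f ∧ ∀ n, Function.Surjective (RLie.lin (f.app (op ⦋n⦌)))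

/-- Cofibrations: morphisms with the left lifting property with respect to all acyclic
fibrations. -/
def cofibrations (p : ℕ) (k : Type u) [Field k] : MorphismProperty (SRLie p k) :=
  (acyclicFibrations p k).llp

/-- The homotopy category `Ho(sLie^r)`. -/
abbrev Ho (p : ℕ) (k : Type u) [Field k] := (weakEquivalences p k).Localization

/-- The localization functor `sLie^r ⥤ Ho(sLie^r)`. -/
abbrev toHo (p : ℕ) (k : Type u) [Field k] : SRLie p k ⥤ Ho p k := (weakEquivalences p k).Q

theorem homotopyGroupFunctor_inverts (n : ℕ) :
    (weakEquivalences p k).IsInvertedBy (homotopyGroupFunctor p k n) := fun _ _ f hf =>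
  (ConcreteCategory.isIso_iff_bijective ((homotopyGroupFunctor p k n).map f)).2 (hf n)

/-- The functor `π_n` on the homotopy category. -/
noncomputable def hoHomotopyGroup (p : ℕ) (k : Type u) [Field k] (n : ℕ) :
    Ho p k ⥤ ModuleCat.{u} k :=
  Localization.Construction.lift (homotopyGroupFunctor p k n) (homotopyGroupFunctor_inverts n)

/-- A morphism of the homotopy category is `n`-connected if it induces an isomorphism on `π_i`
for `i < n` and a surjection on `π_n`. -/
def HoIsNConnected (n : ℕ) {X Y : Ho p k} (φ : X ⟶ Y) : Prop :=
  (∀ i < n, Function.Bijective ((hoHomotopyGroup p k i).map φ)) ∧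
    Function.Surjective ((hoHomotopyGroup p k n).map φ)

theorem hoIsNConnected_toHo_map_iff (n : ℕ) {X Y : SRLie p k} (f : X ⟶ Y) :
    HoIsNConnected n ((toHo p k).map f) ↔ IsNConnected n f := Iff.rfl

/-! ### The zero object -/

variable (p k) in
/-- The zero simplicial restricted Lie algebra. -/
def zero : SRLie p k := (Functor.const _).obj (RLie.zero p k)

/-- The morphism `L ⟶ 0`. -/
def toZero (L : SRLie p k) : L ⟶ zero p k where
  app _ := RLie.mkHom (B := RLie.zero p k) 0 (fun _ _ => rfl) (fun _ => rfl)
  naturality _ _ _ := RLie.hom_ext fun _ => rfl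

/-- The morphism `0 ⟶ L`. -/
def fromZero (L : SRLie p k) : zero p k ⟶ L where
  app _ := RLie.mkHom (A := RLie.zero p k) 0 (fun _ _ => by simp) (fun _ => RLie.xi_zero.symm)
  naturality _ _ θ := RLie.hom_ext fun _ => (map_zero (RLie.lin (L.map θ))).symm

/-! ### Homotopy fibers and loop objects -/

/-- The functor `[n] ↦ [0] * [n] = [n + 1]` adding a new initial vertex `0`. -/
def cone : SimplexCategory ⥤ SimplexCategory where
  obj n := ⦋n.len + 1⦌
  map {m n} θ := SimplexCategory.Hom.mk
    ⟨Fin.cases 0 (fun i => (θ.toOrderHom i).succ), by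
      intro a b hab
      induction a using Fin.cases with
      | zero => exact Fin.zero_le _
      | succ a =>
        induction b using Fin.cases with
        | zero => exact absurd hab (by simp)
        | succ b =>
          exact Fin.succ_le_succ_iff.2 (θ.toOrderHom.monotone (Fin.succ_le_succ_iff.1 hab))⟩
  map_id n := by
    ext i
    induction i using Fin.cases <;> rfl
  map_comp f g := by
    ext i
    induction i using Fin.cases <;> rfl

/-- The inclusion of the base `[n] ⟶ [0] * [n]`, which omits the vertex `0`. -/
def base (n : SimplexCategory) : n ⟶ cone.obj n := SimplexCategory.δ (n := n.len) 0

/-- The inclusion of the vertex `0` in `[0] * [n]`. -/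
def apex (n : SimplexCategory) : ⦋0⦌ ⟶ cone.obj n := SimplexCategory.const _ _ 0

theorem base_naturality {m n : SimplexCategory} (θ : m ⟶ n) :
    base m ≫ cone.map θ = θ ≫ base n := by
  ext i
  rfl

theorem apex_naturality {m n : SimplexCategory} (θ : m ⟶ n) :
    apex m ≫ cone.map θ = apex n := by
  ext i
  rfl

/-- The degree `Δ` part of the homotopy fiber of `f`: pairs `(x, y)` where `x` is a simplex of `L'`
and `y` is a simplex of `L` of one dimension more, with apex `0` and with base `f x`. -/
def fibSub {L' L : SRLie p k} (f : L' ⟶ L) (Δ : SimplexCategoryᵒᵖ) :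
    RLie.Sub (RLie.prod (L'.obj Δ) (L.obj (op (cone.obj Δ.unop)))) where
  carrier := {z | RLie.lin (L.map (base Δ.unop).op) z.2 = RLie.lin (f.app Δ) z.1 ∧
    RLie.lin (L.map (apex Δ.unop).op) z.2 = 0}
  add_mem' {z w} hz hw := by
    refine ⟨?_, ?_⟩
    · change RLie.lin _ (z.2 + w.2) = RLie.lin _ (z.1 + w.1)
      rw [map_add, map_add, hz.1, hw.1]
    · change RLie.lin _ (z.2 + w.2) = 0
      rw [map_add, hz.2, hw.2, add_zero]
  zero_mem' := by
    refine ⟨?_, ?_⟩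
    · change RLie.lin _ 0 = RLie.lin _ 0
      rw [map_zero, map_zero]
    · exact map_zero _
  smul_mem' c z hz := by
    refine ⟨?_, ?_⟩
    · change RLie.lin _ (c • z.2) = RLie.lin _ (c • z.1)
      rw [map_smul, map_smul, hz.1]
    · change RLie.lin _ (c • z.2) = 0
      rw [map_smul, hz.2, smul_zero]
  lie_mem' {z w} hz hw := by
    refine ⟨?_, ?_⟩
    · change RLie.lin _ ⁅z.2, w.2⁆ = RLie.lin _ ⁅z.1, w.1⁆
      rw [RLie.lin_lie, RLie.lin_lie, hz.1, hw.1]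
    · change RLie.lin _ ⁅z.2, w.2⁆ = 0
      rw [RLie.lin_lie, hz.2, zero_lie]
  xi_mem z hz := by
    refine ⟨?_, ?_⟩
    · change RLie.lin _ (RLie.xi z.2) = RLie.lin _ (RLie.xi z.1)
      rw [RLie.lin_xi, RLie.lin_xi, hz.1]
    · change RLie.lin _ (RLie.xi z.2) = 0
      rw [RLie.lin_xi, hz.2, RLie.xi_zero]

theorem lin_map_comp {L : SRLie p k} {a b c : SimplexCategory} (θ : a ⟶ b) (η : b ⟶ c)
    (x : L.obj (op c)) :
    RLie.lin (L.map θ.op) (RLie.lin (L.map η.op) x) = RLie.lin (L.map (θ ≫ η).op) x := by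
  rw [op_comp, L.map_comp, RLie.lin_comp]

theorem lin_naturality {L' L : SRLie p k} (f : L' ⟶ L) {a b : SimplexCategoryᵒᵖ} (θ : a ⟶ b)
    (x : L'.obj a) :
    RLie.lin (f.app b) (RLie.lin (L'.map θ) x) = RLie.lin (L.map θ) (RLie.lin (f.app a) x) := by
  rw [← RLie.lin_comp, ← RLie.lin_comp, f.naturality]

/-- The homotopy fiber `L' ×_L P L` of `f : L' ⟶ L`, where `P L ⟶ L` is the simplicial path object:
`(P L)_n` consists of the `y ∈ L_{n+1}` whose vertex `0` is zero, it maps to `L_n` by `d_0`,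
and it is contractible. -/
def fib {L' L : SRLie p k} (f : L' ⟶ L) : SRLie p k where
  obj Δ := (fibSub f Δ).toRLie
  map {Δ Δ'} θ := RLie.mkHom (A := (fibSub f Δ).toRLie) (B := (fibSub f Δ').toRLie)
    (((RLie.lin (L'.map θ)).prodMap (RLie.lin (L.map (cone.map θ.unop).op))).restrict
      (p := (fibSub f Δ).toSubmodule) (q := (fibSub f Δ').toSubmodule) fun z hz => by
        refine ⟨?_, ?_⟩
        · change RLie.lin _ (RLie.lin _ z.2) = RLie.lin _ (RLie.lin _ z.1)
          rw [lin_map_comp, base_naturality, ← lin_map_comp, hz.1, lin_naturality]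
          rfl
        · change RLie.lin _ (RLie.lin _ z.2) = 0
          rw [lin_map_comp, apex_naturality, hz.2])
    (fun z w => Subtype.ext (Prod.ext (RLie.lin_lie _ _ _) (RLie.lin_lie _ _ _)))
    (fun z => Subtype.ext (Prod.ext (RLie.lin_xi _ _) (RLie.lin_xi _ _)))
  map_id Δ := RLie.hom_ext fun z => Subtype.ext (Prod.ext
    (by
      change RLie.lin (L'.map (𝟙 Δ)) z.1.1 = z.1.1
      rw [L'.map_id, RLie.lin_id])
    (by
      change RLie.lin (L.map (cone.map (𝟙 Δ.unop)).op) z.1.2 = z.1.2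
      rw [cone.map_id, op_id, L.map_id, RLie.lin_id]))
  map_comp θ η := RLie.hom_ext fun z => Subtype.ext (Prod.ext
    (by
      change RLie.lin (L'.map (θ ≫ η)) z.1.1 = RLie.lin (L'.map η) (RLie.lin (L'.map θ) z.1.1)
      rw [L'.map_comp, RLie.lin_comp])
    (by
      change RLie.lin (L.map (cone.map (η.unop ≫ θ.unop)).op) z.1.2 =
        RLie.lin (L.map (cone.map η.unop).op) (RLie.lin (L.map (cone.map θ.unop).op) z.1.2)
      rw [lin_map_comp, cone.map_comp]))

/-- The loop object `Ω L`: the homotopy fiber of `0 ⟶ L`. -/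
def loop (L : SRLie p k) : SRLie p k := fib (fromZero L)

/-- Functoriality of the homotopy fiber with respect to commutative squares. -/
def fibMap {A B L' L : SRLie p k} {j : A ⟶ B} {f : L' ⟶ L} (a : A ⟶ L') (b : B ⟶ L)
    (h : a ≫ f = j ≫ b) : fib j ⟶ fib f where
  app Δ := RLie.mkHom (A := (fibSub j Δ).toRLie) (B := (fibSub f Δ).toRLie)
    (((RLie.lin (a.app Δ)).prodMap (RLie.lin (b.app (op (cone.obj Δ.unop))))).restrict
      (p := (fibSub j Δ).toSubmodule) (q := (fibSub f Δ).toSubmodule) fun z hz => by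
        refine ⟨?_, ?_⟩
        · change RLie.lin _ (RLie.lin _ z.2) = RLie.lin _ (RLie.lin _ z.1)
          rw [← lin_naturality, hz.1, ← RLie.lin_comp, ← RLie.lin_comp]
          exact congrArg (fun g => RLie.lin g z.1) (congrArg (fun g => g.app Δ) h.symm)
        · change RLie.lin _ (RLie.lin _ z.2) = 0
          rw [← lin_naturality, hz.2, map_zero])
    (fun z w => Subtype.ext (Prod.ext (RLie.lin_lie _ _ _) (RLie.lin_lie _ _ _)))
    (fun z => Subtype.ext (Prod.ext (RLie.lin_xi _ _) (RLie.lin_xi _ _)))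
  naturality _ _ θ := RLie.hom_ext fun z => Subtype.ext (Prod.ext
    (lin_naturality a θ z.1.1) (lin_naturality b (cone.map θ.unop).op z.1.2))

/-! ### The homotopy fiber is invariant under weak equivalences -/

theorem homotopyGroupMap_injective_iff {L' L : SRLie p k} (f : L' ⟶ L) (n : ℕ) :
    Function.Injective (homotopyGroupMap f n) ↔ ∀ x ∈ L'.cycles n,
      RLie.lin (f.app (op ⦋n⦌)) x ∈ L.boundaries n → x ∈ L'.boundaries n := by
  rw [injective_iff_map_eq_zero]
  constructor
  · intro h x hx hb
    have := h (Submodule.Quotient.mk ⟨x, hx⟩) ((Submodule.Quotient.mk_eq_zero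
      ((L.boundaries n).submoduleOf (L.cycles n))).2 hb)
    exact (Submodule.Quotient.mk_eq_zero ((L'.boundaries n).submoduleOf (L'.cycles n))).1 this
  · intro h q hq
    obtain ⟨x, rfl⟩ := Submodule.Quotient.mk_surjective _ q
    exact (Submodule.Quotient.mk_eq_zero ((L'.boundaries n).submoduleOf (L'.cycles n))).2
      (h x.1 x.2 ((Submodule.Quotient.mk_eq_zero
        ((L.boundaries n).submoduleOf (L.cycles n))).1 hq))

theorem homotopyGroupMap_surjective_iff {L' L : SRLie p k} (f : L' ⟶ L) (n : ℕ) :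
    Function.Surjective (homotopyGroupMap f n) ↔ ∀ y ∈ L.cycles n, ∃ x ∈ L'.cycles n,
      y - RLie.lin (f.app (op ⦋n⦌)) x ∈ L.boundaries n := by
  constructor
  · intro h y hy
    obtain ⟨q, hq⟩ := h (Submodule.Quotient.mk ⟨y, hy⟩)
    obtain ⟨x, rfl⟩ := Submodule.Quotient.mk_surjective _ q
    exact ⟨x.1, x.2, (Submodule.Quotient.eq ((L.boundaries n).submoduleOf (L.cycles n))).1 hq.symm⟩
  · intro h q
    obtain ⟨y, rfl⟩ := Submodule.Quotient.mk_surjective _ q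
    obtain ⟨x, hx, hb⟩ := h y.1 y.2
    exact ⟨Submodule.Quotient.mk ⟨x, hx⟩, ((Submodule.Quotient.eq ((L.boundaries n).submoduleOf (L.cycles n))).2 hb).symm⟩

theorem cone_map_δ {n : ℕ} (j : Fin (n + 2)) :
    cone.map (SimplexCategory.δ j) = SimplexCategory.δ (n := n + 1) j.succ := by
  ext i
  induction i using Fin.cases with
  | zero => exact congrArg Fin.val (Fin.succ_succAbove_zero j).symm
  | succ i => exact congrArg Fin.val (Fin.succ_succAbove_succ j i).symm

theorem lin_apex_succ {L : SRLie p k} {n : ℕ} (y : L _⦋n + 2⦌) :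
    RLie.lin (L.map (apex ⦋n + 1⦌).op) y =
      RLie.lin (L.map (apex ⦋n⦌).op) (RLie.lin (L.δ 1) y) := by
  have h : apex ⦋n + 1⦌ =
      apex ⦋n⦌ ≫ (show cone.obj ⦋n⦌ ⟶ cone.obj ⦋n + 1⦌ from SimplexCategory.δ (n := n + 1) 1) := by
    ext i
    rfl
  rw [h]
  exact (lin_map_comp _ _ _).symm

theorem apex_zero : apex ⦋0⦌ = SimplexCategory.δ (n := 0) 1 := by
  ext i
  fin_cases i
  rfl

section
variable {L' L : SRLie p k} {f : L' ⟶ L} {n : ℕ}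

/-- The first component of a simplex of the homotopy fiber. -/
def fibFst (z : (fib f) _⦋n⦌) : L' _⦋n⦌ := z.1.1

/-- The second component of a simplex of the homotopy fiber. -/
def fibSnd (z : (fib f) _⦋n⦌) : L _⦋n + 1⦌ := z.1.2

theorem fib_ext {z w : (fib f) _⦋n⦌} (h1 : fibFst z = fibFst w) (h2 : fibSnd z = fibSnd w) :
    z = w := Subtype.ext (Prod.ext h1 h2)

theorem fib_base (z : (fib f) _⦋n⦌) :
    RLie.lin (L.δ 0) (fibSnd z) = RLie.lin (f.app (op ⦋n⦌)) (fibFst z) := z.2.1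

theorem fib_δ_fst (z : (fib f) _⦋n + 1⦌) (j : Fin (n + 2)) :
    fibFst (RLie.lin ((fib f).δ j) z) = RLie.lin (L'.δ j) (fibFst z) := rfl

theorem fib_δ_snd (z : (fib f) _⦋n + 1⦌) (j : Fin (n + 2)) :
    fibSnd (RLie.lin ((fib f).δ j) z) = RLie.lin (L.δ j.succ) (fibSnd z) := by
  change RLie.lin (L.map (cone.map (SimplexCategory.δ j)).op) z.1.2 = _
  rw [cone_map_δ]
  rfl

theorem fib_δ_eq_zero_iff (z : (fib f) _⦋n + 1⦌) (j : Fin (n + 2)) :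
    RLie.lin ((fib f).δ j) z = 0 ↔
      RLie.lin (L'.δ j) (fibFst z) = 0 ∧ RLie.lin (L.δ j.succ) (fibSnd z) = 0 := by
  rw [← fib_δ_snd, ← fib_δ_fst]
  exact ⟨fun h => by rw [h]; exact ⟨rfl, rfl⟩, fun h => fib_ext h.1 h.2⟩

theorem mem_cycles_succ {L : SRLie p k} {x : L _⦋n + 1⦌} :
    x ∈ L.cycles (n + 1) ↔ ∀ j : Fin (n + 2), RLie.lin (L.δ j) x = 0 := by
  rw [Fin.forall_fin_succ, and_comm, ← mem_normalized_succ]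
  rfl

theorem mem_cycles_iff {L : SRLie p k} {x : L _⦋n + 1⦌} :
    x ∈ L.cycles (n + 1) ↔ x ∈ L.normalized (n + 1) ∧ RLie.lin (L.δ 0) x = 0 := Iff.rfl

theorem apex_eq_zero {y : L _⦋n + 1⦌} (hy : y ∈ L.normalized (n + 1)) :
    RLie.lin (L.map (apex ⦋n⦌).op) y = 0 := by
  have h : RLie.lin (L.δ 1) y = 0 := mem_normalized_succ.1 hy 0
  cases n with
  | zero =>
    rw [apex_zero]
    exact h
  | succ n =>
    exact (lin_apex_succ y).trans ((congrArg _ h).trans (map_zero _))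

theorem mem_cycles_fib (z : (fib f) _⦋n⦌) :
    z ∈ (fib f).cycles n ↔ fibFst z ∈ L'.cycles n ∧ fibSnd z ∈ L.normalized (n + 1) := by
  cases n with
  | zero =>
    refine ⟨fun _ => ⟨trivial, ?_⟩, fun _ => trivial⟩
    rw [mem_normalized_succ]
    intro j
    fin_cases j
    have := z.2.2
    change RLie.lin (L.map (apex ⦋0⦌).op) z.1.2 = 0 at this
    rw [apex_zero] at this
    exact this
  | succ n =>
    rw [mem_cycles_succ, mem_cycles_succ, mem_normalized_succ, ← forall_and]
    exact forall_congr' fun j => fib_δ_eq_zero_iff z j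

/-- A simplex of the homotopy fiber from its components. -/
def fibMk (x : L' _⦋n⦌) (y : L _⦋n + 1⦌)
    (h : RLie.lin (L.δ 0) y = RLie.lin (f.app (op ⦋n⦌)) x)
    (h' : RLie.lin (L.map (apex ⦋n⦌).op) y = 0) : (fib f) _⦋n⦌ :=
  ⟨(x, y), h, h'⟩

theorem lin_δ_σ_self (y : L _⦋n + 1⦌) : RLie.lin (L.δ 0) (RLie.lin (L.σ 0) y) = y := by
  rw [← RLie.lin_comp]
  have := L.δ_comp_σ_self (i := (0 : Fin (n + 2)))
  rw [Fin.castSucc_zero] at this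
  rw [this, RLie.lin_id]

theorem lin_δ_σ_succ (y : L _⦋n + 1⦌) : RLie.lin (L.δ 1) (RLie.lin (L.σ 0) y) = y := by
  rw [← RLie.lin_comp]
  have := L.δ_comp_σ_succ (i := (0 : Fin (n + 2)))
  rw [Fin.succ_zero_eq_one] at this
  rw [this, RLie.lin_id]

theorem lin_δ_σ_of_gt (y : L _⦋n + 1⦌) (j : Fin (n + 1)) :
    RLie.lin (L.δ j.succ.succ) (RLie.lin (L.σ 0) y) =
      RLie.lin (L.σ 0) (RLie.lin (L.δ j.succ) y) := by
  rw [← RLie.lin_comp, ← RLie.lin_comp]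
  have := L.δ_comp_σ_of_gt (i := j.succ) (j := (0 : Fin (n + 1))) (by simp)
  rw [Fin.castSucc_zero] at this
  rw [this]

theorem mem_boundaries_fib (z : (fib f) _⦋n⦌) (hz : z ∈ (fib f).cycles n) :
    z ∈ (fib f).boundaries n ↔ ∃ u ∈ L'.normalized (n + 1), RLie.lin (L'.δ 0) u = fibFst z ∧
      fibSnd z - RLie.lin (f.app (op ⦋n + 1⦌)) u ∈ L.boundaries (n + 1) := by
  have hy := ((mem_cycles_fib z).1 hz).2
  rw [mem_normalized_succ] at hy
  constructor
  · rintro ⟨w, hw, hwz⟩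
    have hwz : RLie.lin ((fib f).δ 0) w = z := hwz
    have hw : w ∈ (fib f).normalized (n + 1) := hw
    have hw1 := mem_normalized_succ.1 hw
    have hw' : ∀ j : Fin (n + 1), RLie.lin (L'.δ j.succ) (fibFst w) = 0 ∧
        RLie.lin (L.δ j.succ.succ) (fibSnd w) = 0 :=
      fun j => (fib_δ_eq_zero_iff w j.succ).1 (hw1 j)
    have e1 : RLie.lin (L'.δ 0) (fibFst w) = fibFst z := by rw [← hwz, fib_δ_fst]
    have e2 : RLie.lin (L.δ 1) (fibSnd w) = fibSnd z := by
      rw [← hwz, fib_δ_snd, Fin.succ_zero_eq_one]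
    refine ⟨fibFst w, mem_normalized_succ.2 fun j => (hw' j).1, e1, ?_⟩
    refine ⟨RLie.lin (L.σ 0) (fibSnd z) - fibSnd w, ?_, ?_⟩
    · change RLie.lin (L.σ 0) (fibSnd z) - fibSnd w ∈ L.normalized (n + 1 + 1)
      rw [mem_normalized_succ]
      intro j
      rw [map_sub]
      induction j using Fin.cases with
      | zero =>
        rw [Fin.succ_zero_eq_one, lin_δ_σ_succ, e2, sub_self]
      | succ j => rw [lin_δ_σ_of_gt, hy j, map_zero, (hw' j).2, sub_zero]
    · rw [map_sub, lin_δ_σ_self, fib_base]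
  · rintro ⟨u, hu, hux, w, hw, hwd⟩
    have hw' := mem_normalized_succ.1 hw
    have hv1 : RLie.lin (L.δ 1) (RLie.lin (L.σ 0) (fibSnd z) - w) = fibSnd z := by
      rw [map_sub, lin_δ_σ_succ]
      have := hw' 0
      rw [Fin.succ_zero_eq_one] at this
      rw [this, sub_zero]
    refine ⟨fibMk u (RLie.lin (L.σ 0) (fibSnd z) - w) ?_ ?_, ?_, ?_⟩
    · rw [map_sub, lin_δ_σ_self, hwd, sub_sub_cancel]
    · exact (lin_apex_succ _).trans <| (congrArg _ hv1).trans (apex_eq_zero (mem_normalized_succ.2 hy))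
    · change _ ∈ (fib f).normalized (n + 1)
      rw [mem_normalized_succ]
      intro j
      rw [fib_δ_eq_zero_iff]
      refine ⟨mem_normalized_succ.1 hu j, ?_⟩
      change RLie.lin (L.δ j.succ.succ) (RLie.lin (L.σ 0) (fibSnd z) - w) = 0
      rw [map_sub, lin_δ_σ_of_gt, hy j, map_zero, hw', sub_zero]
    · exact fib_ext hux ((fib_δ_snd _ 0).trans hv1)

end

theorem weakEquivalences_fibMap {A B L' L : SRLie p k} {j : A ⟶ B} {f : L' ⟶ L} (a : A ⟶ L')
    (b : B ⟶ L) (h : a ≫ f = j ≫ b) (ha : weakEquivalences p k a)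
    (hb : weakEquivalences p k b) : weakEquivalences p k (fibMap a b h) := by
  have hc : ∀ (m : ℕ) (x : A _⦋m⦌), RLie.lin (f.app (op ⦋m⦌)) (RLie.lin (a.app (op ⦋m⦌)) x) =
      RLie.lin (b.app (op ⦋m⦌)) (RLie.lin (j.app (op ⦋m⦌)) x) := fun m x => by
    rw [← RLie.lin_comp, ← RLie.lin_comp]
    exact congrArg (fun g => RLie.lin g x) (congrArg (fun g => g.app (op ⦋m⦌)) h)
  intro n
  have ai := fun n => (homotopyGroupMap_injective_iff a n).1 (ha n).1
  have as := fun n => (homotopyGroupMap_surjective_iff a n).1 (ha n).2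
  have bi := fun n => (homotopyGroupMap_injective_iff b n).1 (hb n).1
  have bs := fun n => (homotopyGroupMap_surjective_iff b n).1 (hb n).2
  constructor
  · rw [homotopyGroupMap_injective_iff]
    intro z hz hzb
    obtain ⟨hx, hy⟩ := (mem_cycles_fib z).1 hz
    obtain ⟨u, hu, hux, huy⟩ :=
      (mem_boundaries_fib _ (cycles_map (fibMap a b h) hz)).1 hzb
    change RLie.lin (L'.δ 0) u = RLie.lin (a.app (op ⦋n⦌)) (fibFst z) at hux
    change RLie.lin (b.app (op ⦋n + 1⦌)) (fibSnd z) - _ ∈ _ at huy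
    obtain ⟨u', hu', hd⟩ := ai n _ hx ⟨u, hu, hux⟩
    obtain ⟨w, hw, hwb⟩ := as (n + 1) (u - RLie.lin (a.app (op ⦋n + 1⦌)) u')
      (mem_cycles_iff.2 ⟨sub_mem hu (normalized_map a hu'), by
        rw [map_sub, hux, ← lin_δ_naturality, hd, sub_self]⟩)
    have hu'' : u' + w ∈ A.normalized (n + 1) := add_mem hu' (mem_cycles_iff.1 hw).1
    have hd' : RLie.lin (A.δ 0) (u' + w) = fibFst z := by
      rw [map_add, (mem_cycles_iff.1 hw).2, add_zero, hd]
    refine (mem_boundaries_fib z hz).2 ⟨u' + w, hu'', hd', bi (n + 1) _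
      (mem_cycles_iff.2 ⟨sub_mem hy (normalized_map j hu''), ?_⟩) ?_⟩
    · rw [map_sub, ← lin_δ_naturality, hd', fib_base, sub_self]
    · rw [map_sub, ← hc]
      have := add_mem huy (boundaries_map f hwb)
      convert this using 1
      simp only [map_sub, map_add]
      abel
  · rw [homotopyGroupMap_surjective_iff]
    intro z hz
    obtain ⟨hx, hy⟩ := (mem_cycles_fib z).1 hz
    obtain ⟨x', hx', u, hu, hud⟩ := as n _ hx
    have hud' : RLie.lin (L'.δ 0) u = fibFst z - RLie.lin (a.app (op ⦋n⦌)) x' := hud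
    have hN : fibSnd z - RLie.lin (f.app (op ⦋n + 1⦌)) u ∈ L.normalized (n + 1) :=
      sub_mem hy (normalized_map f hu)
    have hdN : RLie.lin (L.δ 0) (fibSnd z - RLie.lin (f.app (op ⦋n + 1⦌)) u) =
        RLie.lin (b.app (op ⦋n⦌)) (RLie.lin (j.app (op ⦋n⦌)) x') := by
      rw [map_sub, fib_base, ← lin_δ_naturality, hud', map_sub, sub_sub_cancel, hc]
    obtain ⟨y', hy', hyd⟩ := bi n _ (cycles_map j hx') ⟨_, hN, hdN⟩
    have hyd' : RLie.lin (B.δ 0) y' = RLie.lin (j.app (op ⦋n⦌)) x' := hyd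
    obtain ⟨w, hw, hwb⟩ := bs (n + 1)
      (fibSnd z - RLie.lin (f.app (op ⦋n + 1⦌)) u - RLie.lin (b.app (op ⦋n + 1⦌)) y')
      (mem_cycles_iff.2 ⟨sub_mem hN (normalized_map b hy'), by
        rw [map_sub, hdN, ← lin_δ_naturality, hyd', sub_self]⟩)
    have hyw : y' + w ∈ B.normalized (n + 1) := add_mem hy' (mem_cycles_iff.1 hw).1
    have hywd : RLie.lin (B.δ 0) (y' + w) = RLie.lin (j.app (op ⦋n⦌)) x' := by
      rw [map_add, hyd', (mem_cycles_iff.1 hw).2, add_zero]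
    have hz' : fibMk (f := j) x' (y' + w) hywd (apex_eq_zero hyw) ∈ (fib j).cycles n :=
      (mem_cycles_fib _).2 ⟨hx', hyw⟩
    refine ⟨_, hz', (mem_boundaries_fib _ (sub_mem hz (cycles_map _ hz'))).2
      ⟨u, hu, hud', ?_⟩⟩
    change fibSnd z - RLie.lin (b.app (op ⦋n + 1⦌)) (y' + w) - _ ∈ _
    convert hwb using 1
    rw [map_add]
    abel

/-! ### Homotopy cofibers and the natural map -/

/-- A homotopy cofiber of `f : L' ⟶ L`: a replacement of `f`, up to weak equivalence, by a
cofibration `j` between cofibrant objects, together with the pushout of `j` along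
`source ⟶ 0`. -/
structure HomotopyCofiber {L' L : SRLie p k} (f : L' ⟶ L) where
  source : SRLie p k
  target : SRLie p k
  j : source ⟶ target
  a : source ⟶ L'
  b : target ⟶ L
  comm : a ≫ f = j ≫ b
  cofibrant_source : cofibrations p k (fromZero source)
  cofibration_j : cofibrations p k j
  weakEquivalence_a : weakEquivalences p k a
  weakEquivalence_b : weakEquivalences p k b
  cofib : SRLie p k
  proj : target ⟶ cofib
  isPushout : IsPushout j (toZero source) proj (fromZero cofib)

namespace HomotopyCofiber

variable {L' L : SRLie p k} {f : L' ⟶ L} (D : HomotopyCofiber f)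

/-- The weak equivalence `fib(j) ⟶ fib(f)`. -/
def fibToFib : fib D.j ⟶ fib f := fibMap D.a D.b D.comm

/-- The morphism `fib(j) ⟶ Ω cofib(f)` induced on homotopy fibers by the commutative square
from `j` to `0 ⟶ cofib(f)`. -/
def fibToLoop : fib D.j ⟶ loop D.cofib :=
  fibMap (toZero D.source) D.proj D.isPushout.w.symm

/-- The natural map `fib(f) ⟶ Ω cofib(f)` in the homotopy category. -/
noncomputable def naturalMap : (toHo p k).obj (fib f) ⟶ (toHo p k).obj (loop D.cofib) :=
  (Localization.isoOfHom (toHo p k) (weakEquivalences p k) D.fibToFib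
    (weakEquivalences_fibMap D.a D.b D.comm D.weakEquivalence_a D.weakEquivalence_b)).inv ≫
      (toHo p k).map D.fibToLoop

end HomotopyCofiber

end SRLie
end SimplicialLie

/-!
The statement only depends on `f` up to weak equivalence of arrows, so it is enough to find one
good replacement of `f` for which excision can be checked by hand, and to see that any two
replacements have equivalent cofibers.

*The good replacement.* Attaching all possible cells of dimension `d + 1` over the target turns a
`d`-connected morphism into a `d + 1`-connected one (`isNConnected_attachAllDesc`). Iterating
this, `exists_factorization` factors an `n`-connected morphism as a cofibration, bijective in
degrees `≤ n` and a free extension in degree `n + 1`, followed by a weak equivalence. Applied to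
`0 ⟶ L'` and then to the composition with `f`, it replaces `f` by `j : A ⟶ B` with `A₀ = 0`.
Generators are adjoined to restricted Lie algebras by `RLie.adjoin`, the algebra of formal
expressions modulo equality in all models. It also provides the cofiber of `j`.

*Excision for `j`.* Up to the image of `N A`, the kernel of `B ⟶ cofiber j` has to be acyclic in
degrees `≤ n + 1`. Only degree `n + 1` matters, and there `B` is free over `A` on some `v`. The
maps of `B_{n+1}` given by the simplicial operator "collapse the vertices `≤ t` to `0`" on `A` and
by the identity on `v` interpolate between the identity and a map killing the kernel, since the
last operator factors through `A₀ = 0`. They extend to homomorphisms by freeness, and successive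
ones are two faces of a common map to `B_{n+2}`, hence homologous
(`exists_eq_add_δ_zero_of_cofiberProj_eq_zero`). The connectivity of `fib j ⟶ Ω (cofiber j)`
follows by a diagram chase on normalized chains (`isNConnected_fibMap_cofiberProj`).

*Independence of the replacement.* For a weak equivalence `w : Y ⟶ Z`, evaluation of the mapping
path object `Y ×_Z Z^{Δ¹}` at the start of paths is an acyclic fibration
(`acyclicFibrations_pathStart`). Lifting cofibrations against it gives maps between replacements,
up to homotopies compatible with the arrows (`exists_homotopy_lift`). These homotopies descend to
cofibers, so that maps of replacements induce weak equivalences of cofibers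
(`weakEquivalences_cofiber`), and the connectivity passes from `j` to every homotopy cofiber
(`isNConnected_fibToLoop`).
-/

namespace SRLie

open Simplicial

variable {p : ℕ} {k : Type u} [Field k]

/-! ### Simplicial subspaces and normalization -/

/-- A simplicial linear subspace of the simplicial vector space underlying `L`. -/
structure Subspace (L : SRLie p k) where
  mod : ∀ m : ℕ, Submodule k (L _⦋m⦌)
  map_mem : ∀ {m m' : ℕ} (θ : ⦋m'⦌ ⟶ ⦋m⦌) {x : L _⦋m⦌}, x ∈ mod m →
    RLie.lin (L.map θ.op) x ∈ mod m'

namespace Subspace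

variable {L L' : SRLie p k}

theorem δ_mem (J : Subspace L) {m : ℕ} (i : Fin (m + 2)) {x : L _⦋m + 1⦌} (hx : x ∈ J.mod (m + 1)) :
    RLie.lin (L.δ i) x ∈ J.mod m := J.map_mem (SimplexCategory.δ i) hx

theorem σ_mem (J : Subspace L) {m : ℕ} (i : Fin (m + 1)) {x : L _⦋m⦌} (hx : x ∈ J.mod m) :
    RLie.lin (L.σ i) x ∈ J.mod (m + 1) := J.map_mem (SimplexCategory.σ i) hx

variable (L) in
/-- The zero subspace. -/
def bot : Subspace L where
  mod _ := ⊥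
  map_mem θ x hx := by
    rw [Submodule.mem_bot] at hx
    rw [hx, map_zero]
    exact zero_mem _

variable (L) in
/-- The whole space. -/
def top : Subspace L where
  mod _ := ⊤
  map_mem _ _ _ := trivial

/-- The image of a morphism. -/
def range (f : L' ⟶ L) : Subspace L where
  mod m := LinearMap.range (RLie.lin (f.app (op ⦋m⦌)))
  map_mem θ x hx := by
    obtain ⟨y, rfl⟩ := hx
    exact ⟨_, lin_naturality f θ.op y⟩

/-- The kernel of a morphism. -/
def ker (f : L' ⟶ L) : Subspace L' where
  mod m := LinearMap.ker (RLie.lin (f.app (op ⦋m⦌)))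
  map_mem θ x hx := by
    rw [LinearMap.mem_ker] at hx ⊢
    rw [lin_naturality, hx, map_zero]

end Subspace

section

variable {L L' : SRLie p k}

theorem δ_σ_self (m : ℕ) (r : Fin (m + 1)) (x : L _⦋m⦌) :
    RLie.lin (L.δ r.castSucc) (RLie.lin (L.σ r) x) = x := by
  rw [← RLie.lin_comp, L.δ_comp_σ_self, RLie.lin_id]

theorem δ_σ_succ (m : ℕ) (r : Fin (m + 1)) (x : L _⦋m⦌) :
    RLie.lin (L.δ r.succ) (RLie.lin (L.σ r) x) = x := by
  rw [← RLie.lin_comp, L.δ_comp_σ_succ, RLie.lin_id]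

/-- The faces of `s_r x` other than those with index `r`, `r + 1` are degeneracies of faces of `x`,
so they lie in any simplicial subspace containing these. -/
theorem δ_σ_mem (J : Subspace L) {m : ℕ} (r : Fin (m + 2)) (l : Fin (m + 3)) (x : L _⦋m + 1⦌)
    (h1 : l ≠ r.castSucc) (h2 : l ≠ r.succ)
    (hx : ∀ i : Fin (m + 2), RLie.lin (L.δ i) x ∈ J.mod m) :
    RLie.lin (L.δ l) (RLie.lin (L.σ r) x) ∈ J.mod (m + 1) := by
  rw [← RLie.lin_comp]
  rcases lt_or_gt_of_ne h1 with h | h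
  · obtain ⟨l, rfl⟩ := Fin.exists_castSucc_eq.2 (show l ≠ Fin.last _ from
      ne_of_lt (h.trans_le (Fin.le_last _)))
    obtain ⟨r, rfl⟩ := Fin.exists_succ_eq.2 (show r ≠ 0 by
      rintro rfl
      exact absurd h (by simp))
    rw [L.δ_comp_σ_of_le (Fin.le_def.2 (by
      have := Fin.lt_def.1 h
      simp at this ⊢
      omega)), RLie.lin_comp]
    exact J.σ_mem _ (hx _)
  · have h3 : r.succ < l := lt_of_le_of_ne (Fin.le_def.2 (by
      have := Fin.lt_def.1 h
      simp at this ⊢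
      omega)) h2.symm
    rw [L.δ_comp_σ_of_gt' h3, RLie.lin_comp]
    exact J.σ_mem _ (hx _)

/-- A simplex whose faces of positive index lie in a simplicial subspace can be normalized by
subtracting an element of this subspace: subtract `s_{l-1} d_l`, for `l` from the top down. -/
theorem exists_sub_mem_normalized (J : Subspace L) (m : ℕ) (y : L _⦋m + 1⦌)
    (hy : ∀ l : Fin (m + 1), RLie.lin (L.δ l.succ) y ∈ J.mod m) :
    ∃ a ∈ J.mod (m + 1), y - a ∈ L.normalized (m + 1) := by
  -- After `t` steps, the `t` faces of highest index vanish.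
  have key : ∀ t : ℕ, t ≤ m + 1 → ∃ a ∈ J.mod (m + 1), ∀ l : Fin (m + 1), m + 1 ≤ l.val + t →
      RLie.lin (L.δ l.succ) (y - a) = 0 := by
    intro t
    induction t with
    | zero => exact fun _ => ⟨0, zero_mem _, fun l hl => absurd hl (by omega)⟩
    | succ t ih =>
      intro ht
      obtain ⟨a, ha, hal⟩ := ih (by omega)
      let r : Fin (m + 1) := ⟨m - t, by omega⟩
      refine ⟨a + RLie.lin (L.σ r) (RLie.lin (L.δ r.succ) (y - a)), add_mem ha (J.σ_mem _ ?_), ?_⟩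
      · rw [map_sub]
        exact sub_mem (hy _) (J.δ_mem _ ha)
      · intro l hl
        rw [← sub_sub, map_sub]
        rcases eq_or_lt_of_le (show r ≤ l from Fin.le_def.2 (by simp [r]; omega)) with h | h
        · rw [← h, δ_σ_succ, sub_self]
        · have hlz := hal l (by have := Fin.lt_def.1 h; simp [r] at this; omega)
          rw [hlz, zero_sub, neg_eq_zero]
          cases m with
          | zero => exact absurd h (by have := l.2; have := r.2; rw [Fin.lt_def]; omega)
          | succ m =>
            rw [← RLie.lin_comp, L.δ_comp_σ_of_gt' (Fin.succ_lt_succ_iff.2 h), RLie.lin_comp]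
            have hr : r ≠ Fin.last _ := ne_of_lt (h.trans_le (Fin.le_last _))
            obtain ⟨i, hi⟩ := Fin.exists_castSucc_eq.2 hr
            have e := congrArg (fun g => RLie.lin g (y - a))
              (L.δ_comp_δ (i := i.succ) (j := l) (by
                rw [← hi] at h
                exact Fin.castSucc_lt_iff_succ_le.1 h))
            simp only [RLie.lin_comp] at e
            rw [hlz, map_zero, ← Fin.succ_castSucc, hi] at e
            rw [Fin.pred_succ, ← e, map_zero]
  obtain ⟨a, ha, h⟩ := key (m + 1) le_rfl
  exact ⟨a, ha, mem_normalized_succ.2 fun l => h l (by omega)⟩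

/-- A degreewise surjection is surjective on normalized chains. -/
theorem exists_normalized_lift (f : L' ⟶ L)
    (hf : ∀ m, Function.Surjective (RLie.lin (f.app (op ⦋m⦌))))
    {m : ℕ} {z : L _⦋m⦌} (hz : z ∈ L.normalized m) :
    ∃ y ∈ L'.normalized m, RLie.lin (f.app (op ⦋m⦌)) y = z := by
  obtain ⟨y, rfl⟩ := hf m z
  cases m with
  | zero => exact ⟨y, trivial, rfl⟩
  | succ m =>
    obtain ⟨a, ha, hya⟩ := exists_sub_mem_normalized (Subspace.ker f) m y fun l => by
      change RLie.lin (f.app _) _ = 0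
      rw [lin_δ_naturality, mem_normalized_succ.1 hz]
    refine ⟨_, hya, ?_⟩
    have : RLie.lin (f.app _) a = 0 := ha
    rw [map_sub, this, sub_zero]

/-- A simplicial subspace containing all normalized chains is everything. -/
theorem Subspace.eq_top_of_normalized_le (J : Subspace L) (hJ : ∀ m, L.normalized m ≤ J.mod m)
    (m : ℕ) : J.mod m = ⊤ := by
  induction m with
  | zero => exact top_le_iff.1 (hJ 0)
  | succ m ih =>
    refine eq_top_iff.2 fun y _ => ?_
    obtain ⟨a, ha, hya⟩ := exists_sub_mem_normalized J m y fun l => ih ▸ trivial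
    rw [← sub_add_cancel y a]
    exact add_mem (hJ _ hya) ha

/-- Two faces `d_j y`, `d_{j+1} y` of a simplex, all of whose other faces vanish modulo `J`, are
homologous modulo `J`, provided that all faces of these two faces vanish modulo `J`. -/
theorem exists_normalized_δ_sub_mem (J K : Subspace L) (hJK : ∀ m, J.mod m ≤ K.mod m) {m : ℕ}
    (j : Fin (m + 2)) {y : L _⦋m + 2⦌} (hy : y ∈ K.mod (m + 2))
    (hl : ∀ l : Fin (m + 3), l ≠ j.castSucc → l ≠ j.succ → RLie.lin (L.δ l) y ∈ J.mod (m + 1))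
    (h1 : ∀ i, RLie.lin (L.δ i) (RLie.lin (L.δ j.castSucc) y) ∈ J.mod m)
    (h2 : ∀ i, RLie.lin (L.δ i) (RLie.lin (L.δ j.succ) y) ∈ J.mod m) :
    ∃ y' ∈ K.mod (m + 2), y' ∈ L.normalized (m + 2) ∧
      RLie.lin (L.δ 0) y' - (RLie.lin (L.δ j.castSucc) y - RLie.lin (L.δ j.succ) y) ∈
        J.mod (m + 1) := by
  -- It suffices to treat a simplex with a single face `d_r y` outside `J`. Replacing `y` by
  -- `s_{r-1} d_r y - y` moves this face from the position `r` to `r - 1`, until it is `d_0`.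
  have key : ∀ (r : ℕ) (hr : r < m + 3) (y : L _⦋m + 2⦌), y ∈ K.mod (m + 2) →
      (∀ l : Fin (m + 3), l ≠ ⟨r, hr⟩ → RLie.lin (L.δ l) y ∈ J.mod (m + 1)) →
      (∀ i, RLie.lin (L.δ i) (RLie.lin (L.δ ⟨r, hr⟩) y) ∈ J.mod m) →
      ∃ y' ∈ K.mod (m + 2), y' ∈ L.normalized (m + 2) ∧
        RLie.lin (L.δ 0) y' - RLie.lin (L.δ ⟨r, hr⟩) y ∈ J.mod (m + 1) := by
    intro r
    induction r with
    | zero =>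
      intro hr y hy hl hi
      obtain ⟨a, ha, hya⟩ := exists_sub_mem_normalized J (m + 1) y fun l =>
        hl _ (Fin.succ_ne_zero l)
      refine ⟨_, sub_mem hy (hJK _ ha), hya, ?_⟩
      change RLie.lin (L.δ 0) (y - a) - RLie.lin (L.δ 0) y ∈ _
      rw [map_sub, sub_sub_cancel_left]
      exact neg_mem (J.δ_mem _ ha)
    | succ r ih =>
      intro hr y hy hl hi
      let r' : Fin (m + 2) := ⟨r, by omega⟩
      set w := RLie.lin (L.δ ⟨r + 1, hr⟩) y with hw
      have hwK : w ∈ K.mod (m + 1) := K.δ_mem _ hy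
      have e0 : RLie.lin (L.δ r'.castSucc) (RLie.lin (L.σ r') w) = w := δ_σ_self _ _ _
      have e1 : RLie.lin (L.δ r'.succ) (RLie.lin (L.σ r') w) = w := δ_σ_succ _ _ _
      have e2 : RLie.lin (L.δ r'.castSucc) (RLie.lin (L.σ r') w - y) - w ∈ J.mod (m + 1) := by
        rw [map_sub, e0, sub_sub_cancel_left]
        exact neg_mem (hl _ (by simp [r', Fin.ext_iff]))
      obtain ⟨y', hy', hN, h⟩ := ih (by omega) (RLie.lin (L.σ r') w - y)
        (sub_mem (K.σ_mem _ hwK) hy) (fun l hlr => by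
          rw [map_sub]
          by_cases h : l = r'.succ
          · rw [h, e1]
            change w - RLie.lin (L.δ ⟨r + 1, hr⟩) y ∈ _
            rw [← hw, sub_self]
            exact zero_mem _
          · exact sub_mem (δ_σ_mem J r' l w hlr h hi) (hl _ h)) (fun i => by
          have := J.δ_mem i e2
          rw [map_sub] at this
          exact (Submodule.sub_mem_iff_left _ (hi i)).1 this)
      refine ⟨y', hy', hN, ?_⟩
      have := add_mem h e2
      rwa [show (⟨r, by omega⟩ : Fin (m + 3)) = r'.castSucc from rfl, sub_add_sub_cancel] at this
  -- Subtracting `s_j d_{j+1} y` kills the face `j + 1` and turns the face `j` into the difference.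
  have e0 := δ_σ_self (L := L) _ j (RLie.lin (L.δ j.succ) y)
  have e1 := δ_σ_succ (L := L) _ j (RLie.lin (L.δ j.succ) y)
  obtain ⟨y', hy', hN, h⟩ := key j.val (by omega) (y - RLie.lin (L.σ j) (RLie.lin (L.δ j.succ) y))
    (sub_mem hy (K.σ_mem _ (K.δ_mem _ hy))) (fun l hlj => by
      rw [map_sub]
      by_cases h : l = j.succ
      · rw [h, e1, sub_self]
        exact zero_mem _
      · exact sub_mem (hl l hlj h) (δ_σ_mem J j l _ hlj h h2)) (fun i => by
      change RLie.lin (L.δ i) (RLie.lin (L.δ j.castSucc) _) ∈ _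
      rw [map_sub, e0, map_sub]
      exact sub_mem (h1 i) (h2 i))
  refine ⟨y', hy', hN, ?_⟩
  change _ - RLie.lin (L.δ j.castSucc) _ ∈ _ at h
  rwa [map_sub, e0] at h

/-- A morphism which is bijective in degrees `≤ n + 1` induces an isomorphism on `π_n`. -/
theorem homotopyGroupMap_bijective_of_bijective (f : L' ⟶ L) (n : ℕ)
    (hf : ∀ m ≤ n + 1, Function.Bijective (RLie.lin (f.app (op ⦋m⦌)))) :
    Function.Bijective (homotopyGroupMap f n) := by
  have hN : ∀ m ≤ n + 1, ∀ x, RLie.lin (f.app (op ⦋m⦌)) x ∈ L.normalized m →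
      x ∈ L'.normalized m := by
    intro m hm x hx
    cases m with
    | zero => trivial
    | succ m =>
      refine mem_normalized_succ.2 fun j => (hf m (by omega)).1 ?_
      rw [lin_δ_naturality, mem_normalized_succ.1 hx, map_zero]
  constructor
  · rw [homotopyGroupMap_injective_iff]
    rintro x hx ⟨y, hy, hyx⟩
    obtain ⟨y, rfl⟩ := (hf (n + 1) le_rfl).2 y
    exact ⟨y, hN _ le_rfl _ hy, (hf n (by omega)).1 ((lin_δ_naturality f 0 y).trans hyx)⟩
  · rw [homotopyGroupMap_surjective_iff]
    intro y hy
    obtain ⟨x, rfl⟩ := (hf n (by omega)).2 y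
    refine ⟨x, ?_, by rw [sub_self]; exact zero_mem _⟩
    cases n with
    | zero => trivial
    | succ n =>
      refine mem_cycles_succ.2 fun j => (hf n (by omega)).1 ?_
      rw [lin_δ_naturality, mem_cycles_succ.1 hy, map_zero]

end

end SRLie

namespace RLie

variable {p : ℕ} {k : Type u} [Field k]

/-! ### Products of restricted Lie algebras -/

instance piLieRing {I : Type} (X : I → Type u) [∀ i, LieRing (X i)] : LieRing (∀ i, X i) where
  bracket x y i := ⁅x i, y i⁆
  add_lie _ _ _ := funext fun _ => add_lie _ _ _
  lie_add _ _ _ := funext fun _ => lie_add _ _ _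
  lie_self _ := funext fun _ => lie_self _
  leibniz_lie _ _ _ := funext fun _ => leibniz_lie _ _ _

instance piLieAlgebra {I : Type} (X : I → Type u) [∀ i, LieRing (X i)] [∀ i, LieAlgebra k (X i)] :
    LieAlgebra k (∀ i, X i) where
  lie_smul _ _ _ := funext fun _ => lie_smul _ _ _

theorem pi_lie_apply {I : Type} {X : I → Type u} [∀ i, LieRing (X i)] (x y : ∀ i, X i) (i : I) :
    ⁅x, y⁆ i = ⁅x i, y i⁆ := rfl

theorem adCoeff_apply {I : Type} {X : I → Type u} [∀ i, LieRing (X i)] (x y : ∀ i, X i) (m j : ℕ)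
    (i : I) : adCoeff x y m j i = adCoeff (x i) (y i) m j := by
  induction m generalizing j with
  | zero => cases j <;> rfl
  | succ m ih => cases j <;> simp [adCoeff, ih, pi_lie_apply]

instance piRestricted {I : Type} (X : I → RLie p k) : RestrictedLieAlgebra p k (∀ i, X i) where
  xi x i := xi (x i)
  xi_smul a x := funext fun i => RestrictedLieAlgebra.xi_smul a (x i)
  lie_xi x y := by
    have h : ∀ (m : ℕ) (y : ∀ i, X i) (i : I), ((fun z => ⁅z, x⁆)^[m] y) i =
        (fun z => ⁅z, x i⁆)^[m] (y i) := by
      intro m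
      induction m with
      | zero => intro y i; rfl
      | succ m ih => intro y i; rw [Function.iterate_succ_apply, ih]; rfl
    funext i
    rw [h]
    exact RestrictedLieAlgebra.lie_xi (x i) (y i)
  xi_add x y := by
    funext i
    simp [xi, RestrictedLieAlgebra.xi_add, adCoeff_apply]

/-- The product of a family of restricted Lie algebras. -/
abbrev pi {I : Type} (X : I → RLie p k) : RLie p k where
  carrier := ∀ i, X i

end RLie

namespace SRLie

open Simplicial

variable {p : ℕ} {k : Type u} [Field k]

/-! ### The mapping path object -/

/-- The index set of the families making up the `Δ`-simplices of a path object: the simplices of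
`Δ × Δ¹`. -/
structure PrismIndex (Δ : SimplexCategoryᵒᵖ) where
  dom : SimplexCategory
  base : dom ⟶ Δ.unop
  time : dom ⟶ ⦋1⦌

/-- The constant map to the end `0` of the interval. -/
def start (b : SimplexCategory) : b ⟶ ⦋1⦌ := SimplexCategory.const _ _ 0

/-- The constant map to the end `1` of the interval. -/
def finish (b : SimplexCategory) : b ⟶ ⦋1⦌ := SimplexCategory.const _ _ 1

theorem comp_start {a b : SimplexCategory} (φ : a ⟶ b) : φ ≫ start b = start a := by
  ext i
  rfl

theorem comp_finish {a b : SimplexCategory} (φ : a ⟶ b) : φ ≫ finish b = finish a := by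
  ext i
  rfl

/-- The degree `Δ` part of the mapping path object of `w : Y ⟶ Z`: pairs of a simplex `y` of `Y` and
a map `h : Δ × Δ¹ ⟶ Z`, given on simplices, whose restriction to the end `1` is `w y`. -/
def pathSub {Y Z : SRLie p k} (w : Y ⟶ Z) (Δ : SimplexCategoryᵒᵖ) :
    RLie.Sub (RLie.prod (Y.obj Δ) (RLie.pi fun i : PrismIndex Δ => Z.obj (op i.dom))) where
  carrier := {e | (∀ (b b' : SimplexCategory) (φ : b' ⟶ b) (θ : b ⟶ Δ.unop) (ε : b ⟶ ⦋1⦌),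
      RLie.lin (Z.map φ.op) (e.2 ⟨b, θ, ε⟩) = e.2 ⟨b', φ ≫ θ, φ ≫ ε⟩) ∧
    ∀ (b : SimplexCategory) (θ : b ⟶ Δ.unop), e.2 ⟨b, θ, finish b⟩ =
      RLie.lin (w.app (op b)) (RLie.lin (Y.map θ.op) e.1)}
  add_mem' {e e'} he he' := by
    refine ⟨fun b b' φ θ ε => ?_, fun b θ => ?_⟩
    · change RLie.lin (Z.map φ.op) (e.2 ⟨b, θ, ε⟩ + e'.2 ⟨b, θ, ε⟩) =
        e.2 ⟨b', φ ≫ θ, φ ≫ ε⟩ + e'.2 ⟨b', φ ≫ θ, φ ≫ ε⟩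
      rw [map_add, he.1, he'.1]
    · change e.2 ⟨b, θ, finish b⟩ + e'.2 ⟨b, θ, finish b⟩ =
        RLie.lin (w.app (op b)) (RLie.lin (Y.map θ.op) (e.1 + e'.1))
      rw [map_add, map_add, he.2, he'.2]
  zero_mem' := by
    refine ⟨fun b b' φ θ ε => ?_, fun b θ => ?_⟩
    · exact map_zero _
    · change (0 : Z.obj (op b)) = RLie.lin (w.app (op b)) (RLie.lin (Y.map θ.op) 0)
      rw [map_zero, map_zero]
  smul_mem' c e he := by
    refine ⟨fun b b' φ θ ε => ?_, fun b θ => ?_⟩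
    · change RLie.lin (Z.map φ.op) (c • e.2 ⟨b, θ, ε⟩) = c • e.2 ⟨b', φ ≫ θ, φ ≫ ε⟩
      rw [map_smul, he.1]
    · change c • e.2 ⟨b, θ, finish b⟩ = RLie.lin (w.app (op b)) (RLie.lin (Y.map θ.op) (c • e.1))
      rw [map_smul, map_smul, he.2]
  lie_mem' {e e'} he he' := by
    refine ⟨fun b b' φ θ ε => ?_, fun b θ => ?_⟩
    · change RLie.lin (Z.map φ.op) ⁅e.2 ⟨b, θ, ε⟩, e'.2 ⟨b, θ, ε⟩⁆ =
        ⁅e.2 ⟨b', φ ≫ θ, φ ≫ ε⟩, e'.2 ⟨b', φ ≫ θ, φ ≫ ε⟩⁆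
      rw [RLie.lin_lie, he.1, he'.1]
    · change ⁅e.2 ⟨b, θ, finish b⟩, e'.2 ⟨b, θ, finish b⟩⁆ =
        RLie.lin (w.app (op b)) (RLie.lin (Y.map θ.op) ⁅e.1, e'.1⁆)
      rw [RLie.lin_lie, RLie.lin_lie, he.2, he'.2]
  xi_mem e he := by
    refine ⟨fun b b' φ θ ε => ?_, fun b θ => ?_⟩
    · change RLie.lin (Z.map φ.op) (RLie.xi (e.2 ⟨b, θ, ε⟩)) = RLie.xi (e.2 ⟨b', φ ≫ θ, φ ≫ ε⟩)
      rw [RLie.lin_xi, he.1]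
    · change RLie.xi (e.2 ⟨b, θ, finish b⟩) =
        RLie.lin (w.app (op b)) (RLie.lin (Y.map θ.op) (RLie.xi e.1))
      rw [RLie.lin_xi, RLie.lin_xi, he.2]

section

variable {Y Z : SRLie p k} {w : Y ⟶ Z}

/-- An element of `pathSub` from its components. -/
def pathMk {Δ : SimplexCategoryᵒᵖ} (y : Y.obj Δ)
    (h : ∀ (b : SimplexCategory) (_ : b ⟶ Δ.unop) (_ : b ⟶ ⦋1⦌), Z.obj (op b))
    (h1 : ∀ (b b' : SimplexCategory) (φ : b' ⟶ b) (θ : b ⟶ Δ.unop) (ε : b ⟶ ⦋1⦌),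
      RLie.lin (Z.map φ.op) (h b θ ε) = h b' (φ ≫ θ) (φ ≫ ε))
    (h2 : ∀ (b : SimplexCategory) (θ : b ⟶ Δ.unop), h b θ (finish b) =
      RLie.lin (w.app (op b)) (RLie.lin (Y.map θ.op) y)) : (pathSub w Δ).toRLie :=
  ⟨(y, fun i => h i.dom i.base i.time), h1, h2⟩

/-- The value of the map `Δ × Δ¹ ⟶ Z` on a simplex. -/
def pathVal {Δ : SimplexCategoryᵒᵖ} (e : (pathSub w Δ).toRLie) (b : SimplexCategory)
    (θ : b ⟶ Δ.unop) (ε : b ⟶ ⦋1⦌) : Z.obj (op b) := e.1.2 ⟨b, θ, ε⟩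

theorem path_ext {Δ : SimplexCategoryᵒᵖ} {e e' : (pathSub w Δ).toRLie} (h1 : e.1.1 = e'.1.1)
    (h2 : ∀ b θ ε, pathVal e b θ ε = pathVal e' b θ ε) : e = e' :=
  Subtype.ext (Prod.ext h1 (funext fun i => h2 i.dom i.base i.time))

end

/-- The mapping path object `Y ×_Z Z^{Δ¹}` of `w : Y ⟶ Z`. -/
def mappingPath {Y Z : SRLie p k} (w : Y ⟶ Z) : SRLie p k where
  obj Δ := (pathSub w Δ).toRLie
  map {Δ Δ'} θ := RLie.mkHom (A := (pathSub w Δ).toRLie) (B := (pathSub w Δ').toRLie)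
    { toFun := fun e => pathMk (RLie.lin (Y.map θ) e.1.1)
        (fun b η ε => pathVal e b (η ≫ θ.unop) ε)
        (fun b b' φ η ε => (e.2.1 b b' φ (η ≫ θ.unop) ε).trans (by rw [← Category.assoc]; rfl))
        (fun b η => (e.2.2 b (η ≫ θ.unop)).trans
          (congrArg _ (lin_map_comp (L := Y) η θ.unop e.1.1).symm))
      map_add' := fun e e' => path_ext (map_add _ _ _) fun _ _ _ => rfl
      map_smul' := fun c e => path_ext (map_smul _ _ _) fun _ _ _ => rfl }
    (fun e e' => path_ext (RLie.lin_lie _ _ _) fun _ _ _ => rfl)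
    (fun e => path_ext (RLie.lin_xi _ _) fun _ _ _ => rfl)
  map_id Δ := RLie.hom_ext fun e => path_ext
    (by
      change RLie.lin (Y.map (𝟙 Δ)) e.1.1 = e.1.1
      rw [Y.map_id, RLie.lin_id])
    (fun b η ε => by
      change pathVal e b (η ≫ 𝟙 _) ε = pathVal e b η ε
      rw [Category.comp_id])
  map_comp {Δ Δ' Δ''} θ θ' := RLie.hom_ext fun e => path_ext
    (by
      change RLie.lin (Y.map (θ ≫ θ')) e.1.1 = RLie.lin (Y.map θ') (RLie.lin (Y.map θ) e.1.1)
      rw [Y.map_comp, RLie.lin_comp])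
    (fun b η ε => by
      change pathVal e b (η ≫ θ'.unop ≫ θ.unop) ε = pathVal e b ((η ≫ θ'.unop) ≫ θ.unop) ε
      rw [Category.assoc])

section

variable {Y Z : SRLie p k} (w : Y ⟶ Z)

/-- The projection `Y ×_Z Z^{Δ¹} ⟶ Y`. -/
def pathFst : mappingPath w ⟶ Y where
  app Δ := RLie.mkHom (A := (pathSub w Δ).toRLie)
    { toFun := fun e => e.1.1
      map_add' := fun _ _ => rfl
      map_smul' := fun _ _ => rfl } (fun _ _ => rfl) (fun _ => rfl)
  naturality _ _ _ := rfl

/-- The evaluation `Y ×_Z Z^{Δ¹} ⟶ Z` at the end `0`. -/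
def pathStart : mappingPath w ⟶ Z where
  app Δ := RLie.mkHom (A := (pathSub w Δ).toRLie)
    { toFun := fun e => pathVal e Δ.unop (𝟙 _) (start _)
      map_add' := fun _ _ => rfl
      map_smul' := fun _ _ => rfl } (fun _ _ => rfl) (fun _ => rfl)
  naturality Δ Δ' θ := RLie.hom_ext fun e => by
    change pathVal e Δ'.unop (𝟙 _ ≫ θ.unop) (start _) =
      RLie.lin (Z.map θ) (pathVal e Δ.unop (𝟙 _) (start _))
    refine Eq.trans ?_ (e.2.1 Δ.unop Δ'.unop θ.unop (𝟙 _) (start _)).symm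
    rw [comp_start, Category.id_comp, Category.comp_id]
    rfl

variable {w}

/-- Functoriality of the mapping path object. -/
def mappingPathMap {Y' Z' : SRLie p k} {w' : Y' ⟶ Z'} (a : Y ⟶ Y') (b : Z ⟶ Z')
    (h : w ≫ b = a ≫ w') : mappingPath w ⟶ mappingPath w' where
  app Δ := RLie.mkHom (A := (pathSub w Δ).toRLie) (B := (pathSub w' Δ).toRLie)
    { toFun := fun e => pathMk (RLie.lin (a.app Δ) e.1.1)
        (fun c η ε => RLie.lin (b.app (op c)) (pathVal e c η ε))
        (fun c c' φ η ε => (lin_naturality b φ.op _).symm.trans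
          (congrArg _ (e.2.1 c c' φ η ε)))
        (fun c η => (congrArg _ (e.2.2 c η)).trans
          ((congrArg (fun g : Y ⟶ Z' => RLie.lin (g.app (op c)) (RLie.lin (Y.map η.op) e.1.1))
            h).trans (congrArg _ (lin_naturality a η.op e.1.1))))
      map_add' := fun _ _ => path_ext (map_add _ _ _) fun _ _ _ => map_add _ _ _
      map_smul' := fun _ _ => path_ext (map_smul _ _ _) fun _ _ _ => map_smul _ _ _ }
    (fun _ _ => path_ext (RLie.lin_lie _ _ _) fun _ _ _ => RLie.lin_lie _ _ _)
    (fun _ => path_ext (RLie.lin_xi _ _) fun _ _ _ => RLie.lin_xi _ _)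
  naturality _ _ θ := RLie.hom_ext fun e => path_ext (lin_naturality a θ e.1.1) fun _ _ _ => rfl

theorem mappingPathMap_fst {Y' Z' : SRLie p k} {w' : Y' ⟶ Z'} (a : Y ⟶ Y') (b : Z ⟶ Z')
    (h : w ≫ b = a ≫ w') : mappingPathMap a b h ≫ pathFst w' = pathFst w ≫ a := rfl

theorem mappingPathMap_start {Y' Z' : SRLie p k} {w' : Y' ⟶ Z'} (a : Y ⟶ Y') (b : Z ⟶ Z')
    (h : w ≫ b = a ≫ w') : mappingPathMap a b h ≫ pathStart w' = pathStart w ≫ b := rfl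

/-- The map `[n] ⟶ [1]` sending `i` to `0` exactly if `i < t`. -/
def cut (n t : ℕ) : ⦋n⦌ ⟶ ⦋1⦌ := SimplexCategory.Hom.mk
  ⟨fun i => if i.val < t then 0 else 1, fun i j hij => by
    have := Fin.le_def.1 hij
    dsimp only
    split_ifs <;> first | omega | simp⟩

theorem cut_zero (n : ℕ) : cut n 0 = finish _ := by
  ext i
  rfl

theorem cut_last (n : ℕ) : cut n (n + 1) = start _ := by
  ext i
  exact congrArg Fin.val (if_pos (show i.val < n + 1 from i.2))

theorem δ_cut {n t : ℕ} (l : Fin (n + 2)) (t' : ℕ)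
    (h : l.val ≤ t' ∧ t = t' + 1 ∨ t' ≤ l.val ∧ t = t') :
    SimplexCategory.δ l ≫ cut (n + 1) t = cut n t' := by
  ext i
  have : (l.succAbove i).val < t ↔ i.val < t' := by
    rcases lt_or_ge i.castSucc l with hi | hi
    · rw [Fin.succAbove_of_castSucc_lt _ _ hi]
      have : i.val < l.val := hi
      change i.val < t ↔ _
      omega
    · rw [Fin.succAbove_of_le_castSucc _ _ hi]
      have : l.val ≤ i.val := hi
      change i.val + 1 < t ↔ _
      omega
  exact congrArg Fin.val (if_congr this rfl rfl)

theorem pathVal_δ_eq_zero {n : ℕ} {e : (mappingPath w) _⦋n + 1⦌} {l : Fin (n + 2)}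
    (he : RLie.lin ((mappingPath w).δ l) e = 0) (b : SimplexCategory) (θ : b ⟶ ⦋n⦌) (ε : b ⟶ ⦋1⦌) :
    pathVal e b (θ ≫ SimplexCategory.δ l) ε = 0 :=
  congrArg (fun e => pathVal e b θ ε) he

theorem map_pathVal {Δ : SimplexCategoryᵒᵖ} (e : (mappingPath w).obj Δ) {b b' : SimplexCategory}
    (φ : b' ⟶ b) (θ : b ⟶ Δ.unop) (ε : b ⟶ ⦋1⦌) :
    RLie.lin (Z.map φ.op) (pathVal e b θ ε) = pathVal e b' (φ ≫ θ) (φ ≫ ε) :=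
  e.2.1 b b' φ θ ε

/-- The two ends of a path are homologous, by telescoping over the simplices of the prism. -/
theorem pathStart_sub_mem_boundaries {n : ℕ} {e : (mappingPath w) _⦋n⦌}
    (he : e ∈ (mappingPath w).cycles n) :
    RLie.lin ((pathStart w).app (op ⦋n⦌)) e -
      RLie.lin (w.app (op ⦋n⦌)) (RLie.lin ((pathFst w).app (op ⦋n⦌)) e) ∈ Z.boundaries n := by
  -- `c t` is the value of the path on the section of the prism whose first `t` vertices are at time
  -- `0`. Consecutive values are two faces of the simplex `H` of the prism.
  let c : ℕ → Z _⦋n⦌ := fun t => pathVal e ⦋n⦌ (𝟙 _) (cut n t)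
  have hc0 : c 0 = RLie.lin (w.app (op ⦋n⦌)) (RLie.lin ((pathFst w).app (op ⦋n⦌)) e) := by
    have := e.2.2 ⦋n⦌ (𝟙 _)
    rw [op_id, Y.map_id, RLie.lin_id, ← cut_zero] at this
    exact this
  have hcn : c (n + 1) = RLie.lin ((pathStart w).app (op ⦋n⦌)) e :=
    congrArg (pathVal e ⦋n⦌ (𝟙 _)) (cut_last n)
  have step : ∀ j : Fin (n + 1), c j.val - c (j.val + 1) ∈ Z.boundaries n := by
    intro j
    let H : Z _⦋n + 1⦌ := pathVal e ⦋n + 1⦌ (SimplexCategory.σ j) (cut (n + 1) (j.val + 1))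
    have hH : ∀ l : Fin (n + 2), RLie.lin (Z.δ l) H = pathVal e ⦋n⦌
        (SimplexCategory.δ l ≫ SimplexCategory.σ j)
        (SimplexCategory.δ l ≫ cut (n + 1) (j.val + 1)) :=
      fun l => map_pathVal e (SimplexCategory.δ l) _ _
    have hj : RLie.lin (Z.δ j.castSucc) H = c j.val := by
      rw [hH, SimplexCategory.δ_comp_σ_self, δ_cut _ j.val (by simp)]
    have hj' : RLie.lin (Z.δ j.succ) H = c (j.val + 1) := by
      rw [hH, SimplexCategory.δ_comp_σ_succ, δ_cut _ (j.val + 1) (by simp)]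
    rw [← hj, ← hj']
    cases n with
    | zero =>
      obtain rfl : j = 0 := Subsingleton.elim (α := Fin 1) _ _
      refine ⟨H - RLie.lin (Z.σ 0) (RLie.lin (Z.δ 1) H), ?_, ?_⟩
      · refine mem_normalized_succ.2 fun i => ?_
        obtain rfl : i = 0 := Subsingleton.elim (α := Fin 1) _ _
        have := δ_σ_succ (L := Z) 0 0 (RLie.lin (Z.δ 1) H)
        rw [map_sub, this]
        exact sub_self _
      · have := δ_σ_self (L := Z) 0 0 (RLie.lin (Z.δ 1) H)
        rw [Fin.castSucc_zero] at this
        rw [map_sub, this]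
        rfl
    | succ n =>
      have hz := mem_cycles_succ.1 he
      have hcδ : ∀ (t : ℕ) (i : Fin (n + 2)), RLie.lin (Z.δ i) (c t) = 0 := by
        intro t i
        refine (map_pathVal e (SimplexCategory.δ i) _ _).trans ?_
        rw [Category.comp_id, ← Category.id_comp (SimplexCategory.δ i)]
        exact pathVal_δ_eq_zero (hz i) _ _ _
      obtain ⟨y, -, hy, h⟩ := exists_normalized_δ_sub_mem (Subspace.bot Z) (Subspace.top Z)
        (fun _ => bot_le) j (y := H) trivial (fun l h1 h2 => by
          rw [hH]
          rcases lt_or_gt_of_ne h1 with h | h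
          · obtain ⟨l, rfl⟩ := Fin.exists_castSucc_eq.2 (show l ≠ Fin.last _ from
              ne_of_lt (h.trans_le (Fin.le_last _)))
            obtain ⟨r, rfl⟩ := Fin.exists_succ_eq.2 (show j ≠ 0 by
              rintro rfl
              exact absurd h (by simp))
            rw [SimplexCategory.δ_comp_σ_of_le (Fin.le_def.2 (by
              have := Fin.lt_def.1 h
              simp at this ⊢
              omega))]
            exact pathVal_δ_eq_zero (hz _) _ _ _
          · have h3 : j.succ < l := lt_of_le_of_ne (Fin.le_def.2 (by
              have := Fin.lt_def.1 h
              simp at this ⊢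
              omega)) h2.symm
            rw [SimplexCategory.δ_comp_σ_of_gt' h3]
            exact pathVal_δ_eq_zero (hz _) _ _ _) (fun i => by
        rw [hj, hcδ]; exact zero_mem _) (fun i => by rw [hj', hcδ]; exact zero_mem _)
      exact ⟨y, hy, sub_eq_zero.1 h⟩
  have tel : ∀ t ≤ n + 1, c 0 - c t ∈ Z.boundaries n := by
    intro t
    induction t with
    | zero => intro _; rw [sub_self]; exact zero_mem _
    | succ t ih =>
      intro ht
      have := add_mem (ih (by omega)) (step ⟨t, ht⟩)
      rwa [sub_add_sub_cancel] at this
  rw [← hc0, ← hcn, ← neg_sub]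
  exact neg_mem (tel (n + 1) le_rfl)

theorem homotopyGroupMap_comp {A B C : SRLie p k} (f : A ⟶ B) (g : B ⟶ C) (n : ℕ) :
    homotopyGroupMap (f ≫ g) n = homotopyGroupMap g n ∘ₗ homotopyGroupMap f n := by
  have := (homotopyGroupFunctor p k n).map_comp f g
  exact congrArg ModuleCat.Hom.hom this

theorem homotopyGroupMap_id (A : SRLie p k) (n : ℕ) :
    homotopyGroupMap (𝟙 A) n = LinearMap.id := by
  have := (homotopyGroupFunctor p k n).map_id A
  exact congrArg ModuleCat.Hom.hom this

theorem homotopyGroupMap_pathStart (w : Y ⟶ Z) (n : ℕ) :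
    homotopyGroupMap (pathStart w) n = homotopyGroupMap (pathFst w ≫ w) n := by
  ext x
  exact (Submodule.Quotient.eq ((Z.boundaries n).submoduleOf (Z.cycles n))).2
    (pathStart_sub_mem_boundaries x.2)

/-- The pointwise maximum of two maps to `[1]`. -/
def joinTime {b : SimplexCategory} (ε ε' : b ⟶ ⦋1⦌) : b ⟶ ⦋1⦌ := SimplexCategory.Hom.mk
  ⟨fun i => max (ε.toOrderHom i) (ε'.toOrderHom i), fun _ _ hij =>
    max_le_max (ε.toOrderHom.monotone hij) (ε'.toOrderHom.monotone hij)⟩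

theorem comp_joinTime {a b : SimplexCategory} (φ : a ⟶ b) (ε ε' : b ⟶ ⦋1⦌) :
    φ ≫ joinTime ε ε' = joinTime (φ ≫ ε) (φ ≫ ε') := by
  ext i
  rfl

theorem joinTime_finish {b : SimplexCategory} (ε : b ⟶ ⦋1⦌) : joinTime ε (finish b) = finish b := by
  ext i
  exact congrArg Fin.val (max_eq_right (Fin.le_last _))

theorem finish_joinTime {b : SimplexCategory} (ε : b ⟶ ⦋1⦌) : joinTime (finish b) ε = finish b := by
  ext i
  exact congrArg Fin.val (max_eq_left (Fin.le_last _))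

theorem joinTime_start {b : SimplexCategory} (ε : b ⟶ ⦋1⦌) : joinTime ε (start b) = ε := by
  ext i
  exact congrArg Fin.val (max_eq_left (Fin.zero_le _))

/-- The constant path at `w y`. -/
def constPath (w : Y ⟶ Z) {Δ : SimplexCategoryᵒᵖ} (y : Y.obj Δ) : (mappingPath w).obj Δ :=
  pathMk (w := w) y (fun b θ _ => RLie.lin (w.app (op b)) (RLie.lin (Y.map θ.op) y))
    (fun b b' φ θ ε => by
      rw [← lin_naturality]
      exact congrArg _ (lin_map_comp φ θ y)) (fun _ _ => rfl)

theorem constPath_map (w : Y ⟶ Z) {Δ Δ' : SimplexCategoryᵒᵖ} (θ : Δ ⟶ Δ') (y : Y.obj Δ) :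
    RLie.lin ((mappingPath w).map θ) (constPath w y) = constPath w (RLie.lin (Y.map θ) y) :=
  path_ext rfl fun _ η _ => congrArg _ (lin_map_comp η θ.unop y).symm

theorem constPath_zero (w : Y ⟶ Z) {Δ : SimplexCategoryᵒᵖ} :
    constPath w (0 : Y.obj Δ) = 0 := path_ext rfl fun b θ _ => by
  change RLie.lin (w.app (op b)) (RLie.lin (Y.map θ.op) 0) = 0
  rw [map_zero, map_zero]

theorem constPath_mem_normalized (w : Y ⟶ Z) {n : ℕ} {y : Y _⦋n⦌} (hy : y ∈ Y.normalized n) :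
    constPath w y ∈ (mappingPath w).normalized n := by
  cases n with
  | zero => trivial
  | succ n =>
    refine mem_normalized_succ.2 fun j => (constPath_map w _ y).trans ?_
    have : RLie.lin (Y.map (SimplexCategory.δ j.succ).op) y = 0 := mem_normalized_succ.1 hy j
    rw [this, constPath_zero]

theorem constPath_mem_cycles (w : Y ⟶ Z) {n : ℕ} {y : Y _⦋n⦌} (hy : y ∈ Y.cycles n) :
    constPath w y ∈ (mappingPath w).cycles n := by
  cases n with
  | zero => trivial
  | succ n =>
    refine mem_cycles_succ.2 fun j => (constPath_map w _ y).trans ?_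
    have : RLie.lin (Y.map (SimplexCategory.δ j).op) y = 0 := mem_cycles_succ.1 hy j
    rw [this, constPath_zero]

theorem constPath_mem_boundaries (w : Y ⟶ Z) {n : ℕ} {y : Y _⦋n⦌} (hy : y ∈ Y.boundaries n) :
    constPath w y ∈ (mappingPath w).boundaries n := by
  obtain ⟨x, hx, rfl⟩ := hy
  exact ⟨_, constPath_mem_normalized w hx, constPath_map w _ x⟩

/-- The part of a path `e` from a given time on. -/
def pathTail {Δ : SimplexCategoryᵒᵖ} (e : (mappingPath w).obj Δ) (b : SimplexCategory)
    (θ : b ⟶ Δ.unop) (ε : b ⟶ ⦋1⦌) : (mappingPath w).obj (op b) :=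
  pathMk (w := w) (RLie.lin (Y.map θ.op) e.1.1)
    (fun c η ζ => pathVal e c (η ≫ θ) (joinTime ζ (η ≫ ε)))
    (fun c c' φ η ζ => by
      rw [map_pathVal, comp_joinTime, Category.assoc, Category.assoc]) (fun c η => by
      rw [finish_joinTime]
      exact (e.2.2 c (η ≫ θ)).trans (congrArg _ (lin_map_comp η θ e.1.1).symm))

/-- The contraction of a path to its end `1`. -/
def pathContraction {Δ : SimplexCategoryᵒᵖ} (e : (mappingPath w).obj Δ) :
    (mappingPath (𝟙 (mappingPath w))).obj Δ :=
  pathMk (w := 𝟙 (mappingPath w)) (constPath w e.1.1) (pathTail e)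
    (fun b b' φ θ ε => path_ext (lin_map_comp φ θ e.1.1) fun c η ζ => by
      change pathVal e c ((η ≫ φ) ≫ θ) (joinTime ζ ((η ≫ φ) ≫ ε)) =
        pathVal e c (η ≫ φ ≫ θ) (joinTime ζ (η ≫ φ ≫ ε))
      rw [Category.assoc, Category.assoc])
    (fun b θ => by
      change _ = RLie.lin ((mappingPath w).map θ.op) (constPath w e.1.1)
      rw [constPath_map]
      refine path_ext rfl fun c η ζ => ?_
      change pathVal e c (η ≫ θ) (joinTime ζ (η ≫ finish b)) = _
      rw [comp_finish, joinTime_finish]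
      exact (e.2.2 c (η ≫ θ)).trans (congrArg _ (lin_map_comp η θ e.1.1).symm))

theorem pathContraction_map {Δ Δ' : SimplexCategoryᵒᵖ} (θ : Δ ⟶ Δ') (e : (mappingPath w).obj Δ) :
    RLie.lin ((mappingPath (𝟙 (mappingPath w))).map θ) (pathContraction e) =
      pathContraction (RLie.lin ((mappingPath w).map θ) e) :=
  path_ext (constPath_map w θ e.1.1) fun b η ε => path_ext
    ((lin_map_comp η θ.unop e.1.1).symm) fun c φ ζ => by
      change pathVal e c (φ ≫ η ≫ θ.unop) _ = pathVal e c ((φ ≫ η) ≫ θ.unop) _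
      rw [Category.assoc]

theorem pathContraction_zero {Δ : SimplexCategoryᵒᵖ} :
    pathContraction (0 : (mappingPath w).obj Δ) = 0 :=
  path_ext (constPath_zero w) fun _ θ _ => path_ext (map_zero (RLie.lin (Y.map θ.op)))
    fun _ _ _ => rfl

/-- Constant paths are homotopy inverse to the projection: the contraction of paths to their end `1`
is a homotopy from the identity to the constant path, and `pathStart_sub_mem_boundaries` applies. -/
theorem weakEquivalences_pathFst (w : Y ⟶ Z) : weakEquivalences p k (pathFst w) := by
  intro n
  constructor
  · rw [homotopyGroupMap_injective_iff]
    intro e he hb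
    have hc : pathContraction e ∈ (mappingPath (𝟙 (mappingPath w))).cycles n := by
      cases n with
      | zero => trivial
      | succ n =>
        refine mem_cycles_succ.2 fun j => (pathContraction_map _ e).trans ?_
        have : RLie.lin ((mappingPath w).map (SimplexCategory.δ j).op) e = 0 :=
          mem_cycles_succ.1 he j
        rw [this, pathContraction_zero]
    have h := pathStart_sub_mem_boundaries hc
    have e1 : RLie.lin ((pathStart (𝟙 (mappingPath w))).app (op ⦋n⦌)) (pathContraction e) = e := by
      refine path_ext ?_ fun c η ζ => ?_
      · change RLie.lin (Y.map (𝟙 (op ⦋n⦌))) e.1.1 = e.1.1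
        rw [Y.map_id, RLie.lin_id]
      · change pathVal e c (η ≫ 𝟙 _) (joinTime ζ (η ≫ start _)) = pathVal e c η ζ
        rw [comp_start, joinTime_start, Category.comp_id]
    rw [e1] at h
    have := add_mem h (constPath_mem_boundaries w hb)
    change e - constPath w e.1.1 + constPath w e.1.1 ∈ _ at this
    rwa [sub_add_cancel] at this
  · rw [homotopyGroupMap_surjective_iff]
    intro y hy
    refine ⟨constPath w y, constPath_mem_cycles w hy, ?_⟩
    change y - y ∈ _
    rw [sub_self]
    exact zero_mem _

/-- The map which agrees with `θ` where the time `ε` is `1`, and with the truncation of `θ` to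
`[m] ⊆ [m + 1]` where `ε` is `0`. -/
def truncate {b : SimplexCategory} {m : ℕ} (θ : b ⟶ ⦋m + 1⦌) (ε : b ⟶ ⦋1⦌) : b ⟶ ⦋m + 1⦌ :=
  SimplexCategory.Hom.mk
    ⟨fun i => if ε.toOrderHom i = 0 then min (θ.toOrderHom i) (Fin.last m).castSucc
      else θ.toOrderHom i, fun i j hij => by
      have h1 := θ.toOrderHom.monotone hij
      have h2 := ε.toOrderHom.monotone hij
      dsimp only
      split_ifs with h3 h4 h4
      · exact min_le_min_right _ h1
      · exact (min_le_left _ _).trans h1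
      · rw [h4] at h2
        exact absurd (le_antisymm h2 (Fin.zero_le _)) h3
      · exact h1⟩

theorem comp_truncate {a b : SimplexCategory} {m : ℕ} (φ : a ⟶ b) (θ : b ⟶ ⦋m + 1⦌)
    (ε : b ⟶ ⦋1⦌) : φ ≫ truncate θ ε = truncate (φ ≫ θ) (φ ≫ ε) := by
  ext i
  rfl

theorem truncate_finish {b : SimplexCategory} {m : ℕ} (θ : b ⟶ ⦋m + 1⦌) :
    truncate θ (finish b) = θ := by
  ext i
  rfl

theorem map_eq_zero_of_normalized {n : ℕ} {x : Z _⦋n + 1⦌} (hx : x ∈ Z.normalized (n + 1))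
    {b : SimplexCategory} (θ : b ⟶ ⦋n + 1⦌) (j : Fin (n + 1)) (h : ∀ i, θ.toOrderHom i ≠ j.succ) :
    RLie.lin (Z.map θ.op) x = 0 := by
  obtain ⟨τ, rfl⟩ := SimplexCategory.eq_comp_δ_of_not_surjective' θ j.succ h
  have : RLie.lin (Z.map (SimplexCategory.δ j.succ).op) x = 0 := mem_normalized_succ.1 hx j
  rw [← lin_map_comp, this, map_zero]

/-- For a weak equivalence `w`, the evaluation at the end `0` is an acyclic fibration. -/
theorem acyclicFibrations_pathStart (hw : weakEquivalences p k w) :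
    acyclicFibrations p k (pathStart w) := by
  refine ⟨fun n => ?_, fun m => ?_⟩
  · rw [homotopyGroupMap_pathStart, homotopyGroupMap_comp]
    exact (hw n).comp (weakEquivalences_pathFst w n)
  · refine LinearMap.range_eq_top.1 ((Subspace.range (pathStart w)).eq_top_of_normalized_le ?_ m)
    rintro (_ | m) z hz
    · obtain ⟨y, -, u, hu, hd⟩ := (homotopyGroupMap_surjective_iff w 0).1 (hw 0).2 z trivial
      have hd1 : RLie.lin (Z.map (SimplexCategory.δ 1).op) u = 0 := mem_normalized_succ.1 hu 0
      have hd0 : RLie.lin (Z.map (SimplexCategory.δ 0).op) u = z - RLie.lin (w.app _) y := hd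
      -- If `u` is a path from `0` to `z - w y`, then `z - u` is a path from `z` to `w y`.
      refine ⟨pathMk (w := w) y (fun b θ ε => RLie.lin (Z.map θ.op) z - RLie.lin (Z.map ε.op) u)
        (fun b b' φ θ ε => ?_) (fun b θ => ?_), ?_⟩
      · rw [map_sub]
        exact congrArg₂ _ (lin_map_comp φ θ z) (lin_map_comp φ ε u)
      · have : finish b = θ ≫ SimplexCategory.δ 0 := by
          ext i
          have : θ.toOrderHom i = 0 := Subsingleton.elim (α := Fin 1) _ _
          exact (congrArg (fun j => Fin.val ((SimplexCategory.δ (n := 0) 0).toOrderHom j))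
            this).symm
        rw [this, ← lin_map_comp, hd0, lin_naturality, map_sub, sub_sub_cancel]
      · change RLie.lin (Z.map (𝟙 (op ⦋0⦌))) z - RLie.lin (Z.map (start ⦋0⦌).op) u = z
        have : start ⦋0⦌ = SimplexCategory.δ 1 := by
          ext i
          fin_cases i
          rfl
        rw [this, hd1, sub_zero, Z.map_id, RLie.lin_id]
    -- In positive degrees, subtract from `z` its restriction along the homotopy from the truncation
      -- to the identity. The truncation omits a vertex, so that it sends `z` to `0`.
    · refine ⟨pathMk (w := w) 0
        (fun b θ ε => RLie.lin (Z.map θ.op) z - RLie.lin (Z.map (truncate θ ε).op) z)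
        (fun b b' φ θ ε => ?_) (fun b θ => ?_), ?_⟩
      · rw [map_sub, ← comp_truncate]
        exact congrArg₂ _ (lin_map_comp φ θ z) (lin_map_comp φ _ z)
      · rw [truncate_finish, sub_self, map_zero, map_zero]
      · change RLie.lin (Z.map (𝟙 (op ⦋m + 1⦌))) z -
          RLie.lin (Z.map (truncate (𝟙 ⦋m + 1⦌) (start ⦋m + 1⦌)).op) z = z
        rw [map_eq_zero_of_normalized hz (truncate (𝟙 ⦋m + 1⦌) (start ⦋m + 1⦌)) (Fin.last m)
          fun i => ne_of_lt ?_, sub_zero, Z.map_id, RLie.lin_id]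
        exact (min_le_right _ _).trans_lt (Fin.castSucc_lt_succ (i := Fin.last m))

end

/-! ### Homotopy invariance of cofibers -/

section

theorem fromZero_unique {L : SRLie p k} (f g : zero p k ⟶ L) : f = g := by
  ext Δ : 2
  exact RLie.hom_ext fun _ =>
    (map_zero (RLie.lin (f.app Δ))).trans (map_zero (RLie.lin (g.app Δ))).symm

theorem toZero_unique {L : SRLie p k} (f g : L ⟶ zero p k) : f = g := by
  ext Δ : 2
  exact RLie.hom_ext fun _ => rfl

/-- Functoriality of the path object. -/
abbrev pathMap {X Y : SRLie p k} (f : X ⟶ Y) : mappingPath (𝟙 X) ⟶ mappingPath (𝟙 Y) :=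
  mappingPathMap f f ((Category.id_comp f).trans (Category.comp_id f).symm)

/-- A map from a cofibration between cofibrant objects to an arbitrary morphism lifts, up to
homotopy, through any weak equivalence of arrows: lift strictly through the mapping path objects. -/
theorem exists_homotopy_lift {A₀ B₀ A B X Y : SRLie p k} {j₀ : A₀ ⟶ B₀} {j : A ⟶ B} {f : X ⟶ Y}
    (hA₀ : cofibrations p k (fromZero A₀)) (hj₀ : cofibrations p k j₀) (a : A ⟶ X) (b : B ⟶ Y)
    (h : a ≫ f = j ≫ b) (ha : weakEquivalences p k a) (hb : weakEquivalences p k b)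
    (a₀ : A₀ ⟶ X) (b₀ : B₀ ⟶ Y) (h₀ : a₀ ≫ f = j₀ ≫ b₀) :
    ∃ (s : A₀ ⟶ A) (t : B₀ ⟶ B) (H : A₀ ⟶ mappingPath (𝟙 X)) (K : B₀ ⟶ mappingPath (𝟙 Y)),
      s ≫ j = j₀ ≫ t ∧ H ≫ pathMap f = j₀ ≫ K ∧ H ≫ pathStart _ = a₀ ∧
        H ≫ pathFst _ = s ≫ a ∧ K ≫ pathStart _ = b₀ ∧ K ≫ pathFst _ = t ≫ b := by
  have := hA₀ _ (acyclicFibrations_pathStart ha)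
  have := hj₀ _ (acyclicFibrations_pathStart hb)
  have sq : CommSq (fromZero _) (fromZero A₀) (pathStart a) a₀ := ⟨fromZero_unique _ _⟩
  let m := mappingPathMap (w := a) (w' := b) j f h
  have sq' : CommSq (sq.lift ≫ m) j₀ (pathStart b) b₀ := ⟨by
    rw [Category.assoc, mappingPathMap_start, ← Category.assoc, sq.fac_right, h₀]⟩
  refine ⟨sq.lift ≫ pathFst a, sq'.lift ≫ pathFst b,
    sq.lift ≫ mappingPathMap a (𝟙 X) (by simp), sq'.lift ≫ mappingPathMap b (𝟙 Y) (by simp),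
    ?_, ?_, ?_, ?_, ?_, ?_⟩
  · rw [← Category.assoc, sq'.fac_left, Category.assoc, Category.assoc, mappingPathMap_fst]
  · rw [← Category.assoc, sq'.fac_left, Category.assoc, Category.assoc]
    congr 1
    ext Δ : 2
    refine RLie.hom_ext fun e => path_ext ?_ fun _ _ _ => rfl
    exact congrArg (fun g : A ⟶ Y => RLie.lin (g.app Δ) e.1.1) h
  · rw [Category.assoc, mappingPathMap_start, ← Category.assoc, sq.fac_right, Category.comp_id]
  · rw [Category.assoc, mappingPathMap_fst, Category.assoc]
  · rw [Category.assoc, mappingPathMap_start, ← Category.assoc, sq'.fac_right, Category.comp_id]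
  · rw [Category.assoc, mappingPathMap_fst, Category.assoc]

/-- Homotopic maps agree on homotopy groups. -/
theorem homotopyGroupMap_eq_of_homotopy {A X : SRLie p k} {f g : A ⟶ X}
    (H : A ⟶ mappingPath (𝟙 X)) (h₀ : H ≫ pathStart _ = f) (h₁ : H ≫ pathFst _ = g) (n : ℕ) :
    homotopyGroupMap f n = homotopyGroupMap g n := by
  rw [← h₀, ← h₁, homotopyGroupMap_comp, homotopyGroupMap_comp, homotopyGroupMap_pathStart,
    Category.comp_id]

/-- If `s ≫ a` is homotopic to a weak equivalence and `a` is a weak equivalence, so is `s`. -/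
theorem weakEquivalences_of_homotopy {A B X : SRLie p k} {s : A ⟶ B} {a : B ⟶ X} {a₀ : A ⟶ X}
    (ha : weakEquivalences p k a) (ha₀ : weakEquivalences p k a₀)
    (H : A ⟶ mappingPath (𝟙 X)) (h₀ : H ≫ pathStart _ = a₀) (h₁ : H ≫ pathFst _ = s ≫ a) :
    weakEquivalences p k s := fun n => by
  have := ha₀ n
  rw [homotopyGroupMap_eq_of_homotopy H h₀ h₁, homotopyGroupMap_comp, LinearMap.coe_comp] at this
  exact (Function.Bijective.of_comp_iff' (ha n) _).1 this

/-- The map `c` of cofibers induced by a weak equivalence `(s, t)` between cofibrations has a right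
inverse on homotopy groups, which is again induced by a weak equivalence of arrows. The lift
`(s', t')` of the identity along `(s, t)` induces it, and the homotopy from the identity to the
composition descends to the cofiber. -/
theorem exists_cofiber_section {A₀ B₀ C₀ A B C : SRLie p k} {j₀ : A₀ ⟶ B₀} {j : A ⟶ B}
    {q₀ : B₀ ⟶ C₀} {q : B ⟶ C} (h₀ : IsPushout j₀ (toZero A₀) q₀ (fromZero C₀))
    (h : IsPushout j (toZero A) q (fromZero C))
    (hA : cofibrations p k (fromZero A)) (hj : cofibrations p k j) (s : A₀ ⟶ A) (t : B₀ ⟶ B)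
    (hst : s ≫ j = j₀ ≫ t) (hs : weakEquivalences p k s) (ht : weakEquivalences p k t) (c : C₀ ⟶ C)
    (hc : q₀ ≫ c = t ≫ q) :
    ∃ (s' : A ⟶ A₀) (t' : B ⟶ B₀) (c' : C ⟶ C₀), s' ≫ j₀ = j ≫ t' ∧ weakEquivalences p k s' ∧
      weakEquivalences p k t' ∧ q ≫ c' = t' ≫ q₀ ∧
        ∀ n, homotopyGroupMap c n ∘ₗ homotopyGroupMap c' n = LinearMap.id := by
  obtain ⟨s', t', H, K, e1, e2, e3, e4, e5, e6⟩ :=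
    exists_homotopy_lift hA hj s t hst hs ht (𝟙 A) (𝟙 B) (by simp)
  have hid : ∀ X : SRLie p k, weakEquivalences p k (𝟙 X) := fun X n => by
    rw [homotopyGroupMap_id]; exact Function.bijective_id
  have w' : j ≫ t' ≫ q₀ = toZero A ≫ fromZero C₀ := by
    rw [← Category.assoc, ← e1, Category.assoc, h₀.w, ← Category.assoc]
    exact congrArg (· ≫ _) (toZero_unique _ _)
  let c' : C ⟶ C₀ := h.desc (t' ≫ q₀) (fromZero C₀) w'
  have hc' : q ≫ c' = t' ≫ q₀ := h.inl_desc _ _ _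
  -- The homotopy `K` of self-maps of `B` vanishes on `A` after projection to the cofiber.
  have wK : j ≫ K ≫ pathMap q = toZero A ≫ fromZero _ := by
    rw [← Category.assoc, ← e2, Category.assoc]
    ext Δ : 2
    have hz : ∀ (Δ) (x : A.obj Δ), RLie.lin (q.app Δ) (RLie.lin (j.app Δ) x) = 0 := fun Δ x =>
      (congrArg (fun g : A ⟶ C => RLie.lin (g.app Δ) x) h.w).trans
        (map_zero (RLie.lin ((fromZero C).app Δ)))
    exact RLie.hom_ext fun x => path_ext (hz _ _) fun _ _ _ => hz _ _
  let G : C ⟶ mappingPath (𝟙 C) := h.desc (K ≫ pathMap q) (fromZero _) wK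
  have hG : q ≫ G = K ≫ pathMap q := h.inl_desc _ _ _
  refine ⟨s', t', c', e1, weakEquivalences_of_homotopy hs (hid A) H e3 e4,
    weakEquivalences_of_homotopy ht (hid B) K e5 e6, hc', fun n => ?_⟩
  rw [← homotopyGroupMap_comp, ← homotopyGroupMap_id]
  refine (homotopyGroupMap_eq_of_homotopy G (h.hom_ext ?_ (fromZero_unique _ _))
    (h.hom_ext ?_ (fromZero_unique _ _)) n).symm
  · rw [← Category.assoc, hG, Category.assoc, mappingPathMap_start, ← Category.assoc, e5,
      Category.id_comp, Category.comp_id]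
  · rw [← Category.assoc, hG, Category.assoc, mappingPathMap_fst, ← Category.assoc, e6,
      ← Category.assoc, hc', Category.assoc, Category.assoc, hc]

/-- Cofibers of cofibrations with cofibrant source are invariant under weak equivalences: the map of
cofibers has a right inverse on homotopy groups, which itself has a right inverse by the same
argument. -/
theorem weakEquivalences_cofiber {A₀ B₀ C₀ A B C : SRLie p k} {j₀ : A₀ ⟶ B₀} {j : A ⟶ B}
    {q₀ : B₀ ⟶ C₀} {q : B ⟶ C} (h₀ : IsPushout j₀ (toZero A₀) q₀ (fromZero C₀))
    (h : IsPushout j (toZero A) q (fromZero C))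
    (hA₀ : cofibrations p k (fromZero A₀)) (hj₀ : cofibrations p k j₀)
    (hA : cofibrations p k (fromZero A)) (hj : cofibrations p k j) (s : A₀ ⟶ A) (t : B₀ ⟶ B)
    (hst : s ≫ j = j₀ ≫ t) (hs : weakEquivalences p k s) (ht : weakEquivalences p k t) (c : C₀ ⟶ C)
    (hc : q₀ ≫ c = t ≫ q) : weakEquivalences p k c := fun n => by
  obtain ⟨s', t', c', e, hs', ht', hc', h1⟩ :=
    exists_cofiber_section h₀ h hA hj s t hst hs ht c hc
  obtain ⟨_, _, c'', _, _, _, _, h2⟩ :=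
    exists_cofiber_section h h₀ hA₀ hj₀ s' t' e hs' ht' c' hc'
  have i1 : Function.RightInverse (homotopyGroupMap c' n) (homotopyGroupMap c n) :=
    fun x => LinearMap.congr_fun (h1 n) x
  have i2 : Function.RightInverse (homotopyGroupMap c'' n) (homotopyGroupMap c' n) :=
    fun x => LinearMap.congr_fun (h2 n) x
  exact (Function.Bijective.of_comp_iff _ ⟨i1.injective, i2.surjective⟩).1
    (by rw [i1.comp_eq_id]; exact Function.bijective_id)

end

end SRLie

namespace RLie

variable {p : ℕ} {k : Type u} [Field k]

/-! ### Adjoining generators to a restricted Lie algebra -/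

variable (k) in
/-- Formal expressions in the operations of a restricted Lie algebra. -/
inductive Expr (S : Type u) : Type u
  | of (s : S) : Expr S
  | zero : Expr S
  | add (a b : Expr S) : Expr S
  | neg (a : Expr S) : Expr S
  | smul (c : k) (a : Expr S) : Expr S
  | lie (a b : Expr S) : Expr S
  | xi (a : Expr S) : Expr S

/-- The value of a formal expression. -/
def Expr.eval {S : Type u} (M : RLie p k) (s : S → M) : Expr k S → M
  | of i => s i
  | zero => 0
  | add a b => a.eval M s + b.eval M s
  | neg a => -a.eval M s
  | smul c a => c • a.eval M s
  | lie a b => ⁅a.eval M s, b.eval M s⁆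
  | xi a => RLie.xi (a.eval M s)

/-- A restricted Lie algebra under `X` with elements indexed by `ι`, such that the `i`-th element is
the image of `x` whenever `r i x`. -/
structure AdjoinModel (X : RLie p k) (ι : Type u) (r : ι → X → Prop) where
  target : RLie p k
  map : X ⟶ target
  elem : ι → target
  rel : ∀ i x, r i x → elem i = lin map x

section

variable {X : RLie p k} {ι : Type u} {r : ι → X → Prop}

/-- The value of a formal expression in elements of `X` and `ι` in a model. -/
def AdjoinModel.eval (A : AdjoinModel X ι r) : Expr k (X ⊕ ι) → A.target :=
  Expr.eval A.target (Sum.elim (lin A.map) A.elem)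

variable (X ι r) in
/-- Two expressions are identified if they have the same value in all models. As the relation is a
proposition, it may refer to all models although these form a larger universe. All identities
holding in the models then hold in the quotient, and its universal property is evaluation. -/
def adjoinSetoid : Setoid (Expr k (X ⊕ ι)) where
  r a b := ∀ A : AdjoinModel X ι r, A.eval a = A.eval b
  iseqv := ⟨fun _ _ => rfl, fun h A => (h A).symm, fun h h' A => (h A).trans (h' A)⟩

variable (X ι r) in
/-- The underlying type of the universal model. -/
def AdjoinCarrier : Type u := Quotient (adjoinSetoid X ι r)

namespace AdjoinCarrier

/-- The value of an element of the universal model in another model. -/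
def ev (A : AdjoinModel X ι r) : AdjoinCarrier X ι r → A.target :=
  Quotient.lift A.eval fun _ _ h => h A

theorem ev_ext {x y : AdjoinCarrier X ι r} (h : ∀ A, ev A x = ev A y) : x = y := by
  obtain ⟨a, rfl⟩ := Quotient.exists_rep x
  obtain ⟨b, rfl⟩ := Quotient.exists_rep y
  exact Quotient.sound h

instance : Zero (AdjoinCarrier X ι r) := ⟨Quotient.mk _ Expr.zero⟩

instance : Add (AdjoinCarrier X ι r) := ⟨Quotient.map₂ Expr.add fun _ _ h _ _ h' A =>
  congrArg₂ (· + ·) (h A) (h' A)⟩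

instance : Neg (AdjoinCarrier X ι r) := ⟨Quotient.map Expr.neg fun _ _ h A =>
  congrArg (- ·) (h A)⟩

instance : SMul k (AdjoinCarrier X ι r) := ⟨fun c => Quotient.map (Expr.smul c) fun _ _ h A =>
  congrArg (c • ·) (h A)⟩

instance : Bracket (AdjoinCarrier X ι r) (AdjoinCarrier X ι r) :=
  ⟨Quotient.map₂ Expr.lie fun _ _ h _ _ h' A => congrArg₂ (⁅·, ·⁆) (h A) (h' A)⟩

theorem ev_zero (A : AdjoinModel X ι r) : ev A 0 = 0 := rfl

theorem ev_add (A : AdjoinModel X ι r) (x y : AdjoinCarrier X ι r) :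
    ev A (x + y) = ev A x + ev A y := by
  obtain ⟨a, rfl⟩ := Quotient.exists_rep x
  obtain ⟨b, rfl⟩ := Quotient.exists_rep y
  rfl

theorem ev_neg (A : AdjoinModel X ι r) (x : AdjoinCarrier X ι r) : ev A (-x) = -ev A x := by
  obtain ⟨a, rfl⟩ := Quotient.exists_rep x
  rfl

theorem ev_smul (A : AdjoinModel X ι r) (c : k) (x : AdjoinCarrier X ι r) :
    ev A (c • x) = c • ev A x := by
  obtain ⟨a, rfl⟩ := Quotient.exists_rep x
  rfl

theorem ev_lie (A : AdjoinModel X ι r) (x y : AdjoinCarrier X ι r) :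
    ev A ⁅x, y⁆ = ⁅ev A x, ev A y⁆ := by
  obtain ⟨a, rfl⟩ := Quotient.exists_rep x
  obtain ⟨b, rfl⟩ := Quotient.exists_rep y
  rfl

instance : AddCommGroup (AdjoinCarrier X ι r) where
  add_assoc x y z := ev_ext fun A => by simp only [ev_add, add_assoc]
  zero_add x := ev_ext fun A => by rw [ev_add, ev_zero, zero_add]
  add_zero x := ev_ext fun A => by rw [ev_add, ev_zero, add_zero]
  add_comm x y := ev_ext fun A => by rw [ev_add, ev_add, add_comm]
  neg_add_cancel x := ev_ext fun A => by rw [ev_add, ev_neg, ev_zero, neg_add_cancel]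
  nsmul := nsmulRec
  zsmul := zsmulRec

instance : Module k (AdjoinCarrier X ι r) where
  one_smul x := ev_ext fun A => by rw [ev_smul, one_smul]
  mul_smul c d x := ev_ext fun A => by simp only [ev_smul, mul_smul]
  smul_zero c := ev_ext fun A => by rw [ev_smul, ev_zero, smul_zero]
  smul_add c x y := ev_ext fun A => by simp only [ev_smul, ev_add, smul_add]
  add_smul c d x := ev_ext fun A => by simp only [ev_smul, ev_add, add_smul]
  zero_smul x := ev_ext fun A => by rw [ev_smul, ev_zero, zero_smul]

instance : LieRing (AdjoinCarrier X ι r) where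
  add_lie x y z := ev_ext fun A => by simp only [ev_lie, ev_add, add_lie]
  lie_add x y z := ev_ext fun A => by simp only [ev_lie, ev_add, lie_add]
  lie_self x := ev_ext fun A => by rw [ev_lie, ev_zero, lie_self]
  leibniz_lie x y z := ev_ext fun A => by
    simp only [ev_lie, ev_add]
    exact leibniz_lie _ _ _

instance : LieAlgebra k (AdjoinCarrier X ι r) where
  lie_smul c x y := ev_ext fun A => by simp only [ev_lie, ev_smul, lie_smul]

/-- Evaluation in a model as a homomorphism of Lie algebras. -/
def evHom (A : AdjoinModel X ι r) : AdjoinCarrier X ι r →ₗ⁅k⁆ A.target where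
  toFun := ev A
  map_add' := ev_add A
  map_smul' := ev_smul A
  map_lie' := ev_lie A _ _

theorem ev_adCoeff (A : AdjoinModel X ι r) (x y : AdjoinCarrier X ι r) (m j : ℕ) :
    ev A (adCoeff x y m j) = adCoeff (ev A x) (ev A y) m j := by
  induction m generalizing j with
  | zero => cases j <;> rfl
  | succ m ih => cases j <;> simp only [adCoeff, ev_lie, ev_add, ih]

/-- The `p`-operation of the universal model. -/
def xiFun : AdjoinCarrier X ι r → AdjoinCarrier X ι r :=
  Quotient.map Expr.xi fun _ _ h A => congrArg RLie.xi (h A)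

theorem ev_xiFun (A : AdjoinModel X ι r) (x : AdjoinCarrier X ι r) :
    ev A (xiFun x) = RLie.xi (ev A x) := by
  obtain ⟨a, rfl⟩ := Quotient.exists_rep x
  rfl

instance : RestrictedLieAlgebra p k (AdjoinCarrier X ι r) where
  xi := xiFun
  xi_smul c x := ev_ext fun A => by
    rw [ev_smul, ev_xiFun, ev_xiFun, ev_smul]
    exact RestrictedLieAlgebra.xi_smul c _
  lie_xi x y := ev_ext fun A => by
    have h : Function.Semiconj (ev A) (fun z => ⁅z, x⁆) (fun z => ⁅z, ev A x⁆) :=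
      fun z => ev_lie A z x
    rw [ev_lie, (h.iterate_right p).eq, ← RestrictedLieAlgebra.lie_xi (p := p) (k := k), ev_xiFun]
    rfl
  xi_add x y := ev_ext fun A => by
    have h : ev A (∑ i ∈ Finset.Icc 1 (p - 1), (i : k)⁻¹ • adCoeff x y (p - 1) (i - 1)) =
        ∑ i ∈ Finset.Icc 1 (p - 1), (i : k)⁻¹ • adCoeff (ev A x) (ev A y) (p - 1) (i - 1) := by
      refine (map_sum (evHom A) _ _).trans (Finset.sum_congr rfl fun i _ => ?_)
      exact (ev_smul A _ _).trans (congrArg _ (ev_adCoeff A x y _ _))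
    rw [ev_add, ev_add, h, ev_xiFun, ev_xiFun, ev_xiFun, ev_add]
    exact RestrictedLieAlgebra.xi_add _ _

end AdjoinCarrier

variable (X ι r) in
/-- The restricted Lie algebra obtained from `X` by adjoining generators indexed by `ι`, the
generator `i` being identified with `x` whenever `r i x`. -/
def adjoin : RLie p k where
  carrier := AdjoinCarrier X ι r

variable (X ι r) in
/-- The structure map `X ⟶ adjoin X ι r`. -/
def adjoinInl : X ⟶ adjoin X ι r :=
  mkHom (B := adjoin X ι r)
    { toFun := fun x => Quotient.mk (adjoinSetoid X ι r) (Expr.of (Sum.inl x))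
      map_add' := fun x y => Quotient.sound fun A => map_add (lin A.map) x y
      map_smul' := fun c x => Quotient.sound fun A => map_smul (lin A.map) c x }
    (fun x y => Quotient.sound fun A => lin_lie A.map x y)
    (fun x => Quotient.sound fun A => lin_xi A.map x)

/-- The generators of `adjoin X ι r`. -/
def adjoinGen (i : ι) : adjoin X ι r := Quotient.mk (adjoinSetoid X ι r) (Expr.of (Sum.inr i))

theorem adjoinGen_eq {i : ι} {x : X} (h : r i x) :
    (adjoinGen i : adjoin X ι r) = lin (adjoinInl X ι r) x :=
  Quotient.sound fun A => A.rel i x h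

/-- The universal property of `adjoin X ι r`. -/
def adjoinDesc {M : RLie p k} (g : X ⟶ M) (s : ι → M) (h : ∀ i x, r i x → s i = lin g x) :
    adjoin X ι r ⟶ M :=
  mkHom (A := adjoin X ι r)
    (AdjoinCarrier.evHom ⟨M, g, s, h⟩ : AdjoinCarrier X ι r →ₗ[k] M)
    (fun x y => AdjoinCarrier.ev_lie ⟨M, g, s, h⟩ x y)
    (fun x => by
      obtain ⟨a, rfl⟩ := Quotient.exists_rep (s := adjoinSetoid X ι r) x
      rfl)

theorem adjoinInl_desc {M : RLie p k} (g : X ⟶ M) (s : ι → M)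
    (h : ∀ i x, r i x → s i = lin g x) : adjoinInl X ι r ≫ adjoinDesc g s h = g := rfl

theorem adjoinDesc_gen {M : RLie p k} (g : X ⟶ M) (s : ι → M)
    (h : ∀ i x, r i x → s i = lin g x) (i : ι) : lin (adjoinDesc g s h) (adjoinGen i) = s i := rfl

/-- `adjoin X ι r` is generated by the image of `X` and the generators. -/
theorem adjoin_mem_of_generators (S : Sub (adjoin X ι r))
    (h1 : ∀ x, lin (adjoinInl X ι r) x ∈ S.carrier) (h2 : ∀ i, adjoinGen i ∈ S.carrier)
    (x : adjoin X ι r) : x ∈ S.carrier := by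
  obtain ⟨a, rfl⟩ := Quotient.exists_rep (s := adjoinSetoid X ι r) x
  induction a with
  | of s =>
    cases s with
    | inl x => exact h1 x
    | inr i => exact h2 i
  | zero => exact S.zero_mem'
  | add a b ha hb => exact S.add_mem' ha hb
  | neg a ha =>
    have := S.toLieSubalgebra.toSubmodule.neg_mem ha
    exact this
  | smul c a ha => exact S.smul_mem' c ha
  | lie a b ha hb => exact S.lie_mem' ha hb
  | xi a ha => exact S.xi_mem _ ha

/-- The image of a morphism. -/
def rangeSub {A B : RLie p k} (f : A ⟶ B) : Sub B where
  toSubmodule := LinearMap.range (lin f)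
  lie_mem' := by
    rintro _ _ ⟨x, rfl⟩ ⟨y, rfl⟩
    exact ⟨⁅x, y⁆, lin_lie f x y⟩
  xi_mem := by
    rintro _ ⟨x, rfl⟩
    exact ⟨xi x, lin_xi f x⟩

/-- The preimage of a subalgebra under a morphism. -/
def comapSub {A B : RLie p k} (f : A ⟶ B) (S : Sub B) : Sub A where
  toSubmodule := S.toSubmodule.comap (lin f)
  lie_mem' := fun {x y} hx hy => by
    change lin f ⁅x, y⁆ ∈ S.carrier
    rw [lin_lie]
    exact S.lie_mem' hx hy
  xi_mem x hx := by
    change lin f (xi x) ∈ S.carrier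
    rw [lin_xi]
    exact S.xi_mem _ hx

/-- The equalizer of two morphisms. -/
def eqSub {A B : RLie p k} (f g : A ⟶ B) : Sub A where
  toSubmodule := LinearMap.eqLocus (lin f) (lin g)
  lie_mem' := fun {x y} hx hy => by
    have hx : lin f x = lin g x := hx
    have hy : lin f y = lin g y := hy
    change lin f ⁅x, y⁆ = lin g ⁅x, y⁆
    rw [lin_lie, lin_lie, hx, hy]
  xi_mem x hx := by
    have hx : lin f x = lin g x := hx
    change lin f (xi x) = lin g (xi x)
    rw [lin_xi, lin_xi, hx]

theorem adjoin_hom_ext {M : RLie p k} {f g : adjoin X ι r ⟶ M}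
    (h1 : adjoinInl X ι r ≫ f = adjoinInl X ι r ≫ g)
    (h2 : ∀ i, lin f (adjoinGen i) = lin g (adjoinGen i)) : f = g :=
  hom_ext fun x => adjoin_mem_of_generators (eqSub f g)
    (fun x => congrArg (fun φ => lin φ x) h1) h2 x

theorem isIso_of_bijective {A B : RLie p k} (f : A ⟶ B) (hf : Function.Bijective (lin f)) :
    IsIso f := by
  let e := LinearEquiv.ofBijective (lin f) hf
  have he : ∀ y, lin f (e.symm y) = y := e.apply_symm_apply
  refine ⟨mkHom (e.symm : B →ₗ[k] A) (fun x y => hf.1 ?_) (fun x => hf.1 ?_), hom_ext fun x => ?_,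
    hom_ext fun x => he x⟩
  · change lin f (e.symm _) = lin f ⁅e.symm x, e.symm y⁆
    rw [he, lin_lie, he, he]
  · change lin f (e.symm _) = lin f (xi (e.symm x))
    rw [he, lin_xi, he]
  · exact e.symm_apply_apply x

theorem bijective_of_isIso {A B : RLie p k} (f : A ⟶ B) [IsIso f] : Function.Bijective (lin f) := by
  refine Function.bijective_iff_has_inverse.2 ⟨lin (inv f), fun x => ?_, fun x => ?_⟩
  · rw [← lin_comp, IsIso.hom_inv_id, lin_id]
  · rw [← lin_comp, IsIso.inv_hom_id, lin_id]

end

/-! ### Free extensions -/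

/-- `B` is obtained from `A` by adjoining the elements `v i` freely. -/
structure IsFreeExtension {A B : RLie p k} (f : A ⟶ B) {V : Type u} (v : V → B) : Prop where
  exists_hom : ∀ {M : RLie p k} (g : A ⟶ M) (s : V → M),
    ∃ h : B ⟶ M, f ≫ h = g ∧ ∀ i, lin h (v i) = s i
  mem_of_generators : ∀ S : Sub B, (∀ x, lin f x ∈ S.carrier) → (∀ i, v i ∈ S.carrier) →
    ∀ x, x ∈ S.carrier

namespace IsFreeExtension

variable {A B B' : RLie p k} {f : A ⟶ B} {V : Type u} {v : V → B}

theorem hom_ext (h : IsFreeExtension f v) {M : RLie p k} {g g' : B ⟶ M} (h1 : f ≫ g = f ≫ g')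
    (h2 : ∀ i, lin g (v i) = lin g' (v i)) : g = g' :=
  RLie.hom_ext fun x => h.mem_of_generators (eqSub g g')
    (fun x => congrArg (fun φ => lin φ x) h1) h2 x

theorem comp_bijective (h : IsFreeExtension f v) (e : B ⟶ B') (he : Function.Bijective (lin e)) :
    IsFreeExtension (f ≫ e) (fun i => lin e (v i)) where
  exists_hom {M} g s := by
    have := isIso_of_bijective e he
    obtain ⟨φ, h1, h2⟩ := h.exists_hom g s
    refine ⟨inv e ≫ φ, by simpa using h1, fun i => ?_⟩
    rw [← lin_comp, IsIso.hom_inv_id_assoc, h2]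
  mem_of_generators S h1 h2 x := by
    obtain ⟨y, rfl⟩ := he.2 x
    exact h.mem_of_generators (comapSub e S) h1 h2 y

end IsFreeExtension

end RLie

namespace SRLie

open Simplicial

variable {p : ℕ} {k : Type u} [Field k]

/-! ### Attaching cells -/

section

variable {X : SRLie p k} {d : ℕ} {V : Type u} (x : V → X _⦋d⦌)

/-- The boundary conditions on the simplices of the attached cells: the zeroth face of the cell `v`
is `x v`, its other faces vanish. -/
def cellRel (Δ : SimplexCategoryᵒᵖ) (i : V × (Δ.unop ⟶ ⦋d + 1⦌)) (z : X.obj Δ) : Prop :=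
  (∃ τ : Δ.unop ⟶ ⦋d⦌, i.2 = τ ≫ SimplexCategory.δ 0 ∧ z = RLie.lin (X.map τ.op) (x i.1)) ∨
    ∃ (l : Fin (d + 1)) (τ : Δ.unop ⟶ ⦋d⦌), i.2 = τ ≫ SimplexCategory.δ l.succ ∧ z = 0

theorem cellRel_map {Δ Δ' : SimplexCategoryᵒᵖ} (θ : Δ ⟶ Δ') {i : V × (Δ.unop ⟶ ⦋d + 1⦌)}
    {z : X.obj Δ} (h : cellRel x Δ i z) :
    cellRel x Δ' (i.1, θ.unop ≫ i.2) (RLie.lin (X.map θ) z) := by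
  rcases h with ⟨τ, h1, rfl⟩ | ⟨l, τ, h1, rfl⟩
  · exact Or.inl ⟨θ.unop ≫ τ, by rw [h1, Category.assoc], lin_map_comp θ.unop τ _⟩
  · exact Or.inr ⟨l, θ.unop ≫ τ, by rw [h1, Category.assoc], map_zero _⟩

/-- The structure maps of `attach`. -/
def attachMap {Δ Δ' : SimplexCategoryᵒᵖ} (θ : Δ ⟶ Δ') :
    RLie.adjoin (X.obj Δ) (V × (Δ.unop ⟶ ⦋d + 1⦌)) (cellRel x Δ) ⟶
      RLie.adjoin (X.obj Δ') (V × (Δ'.unop ⟶ ⦋d + 1⦌)) (cellRel x Δ') :=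
  RLie.adjoinDesc (X.map θ ≫ RLie.adjoinInl _ _ _)
    (fun i => RLie.adjoinGen (i.1, θ.unop ≫ i.2))
    (fun _ z h => by
      rw [RLie.lin_comp]
      exact RLie.adjoinGen_eq (cellRel_map x θ h))

theorem adjoinInl_attachMap {Δ Δ' : SimplexCategoryᵒᵖ} (θ : Δ ⟶ Δ') :
    RLie.adjoinInl _ _ _ ≫ attachMap x θ = X.map θ ≫ RLie.adjoinInl _ _ _ := rfl

theorem attachMap_gen {Δ Δ' : SimplexCategoryᵒᵖ} (θ : Δ ⟶ Δ') (v : V) (σ : Δ.unop ⟶ ⦋d + 1⦌) :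
    RLie.lin (attachMap x θ) (RLie.adjoinGen (v, σ)) = RLie.adjoinGen (v, θ.unop ≫ σ) := rfl

/-- The simplicial restricted Lie algebra obtained from `X` by freely attaching a `d + 1`-cell for
each `v : V`, whose boundary is the cycle `x v`. -/
def attach : SRLie p k where
  obj Δ := RLie.adjoin (X.obj Δ) (V × (Δ.unop ⟶ ⦋d + 1⦌)) (cellRel x Δ)
  map θ := attachMap x θ
  map_id _ := RLie.adjoin_hom_ext
    (by rw [adjoinInl_attachMap, X.map_id, Category.id_comp, Category.comp_id])
    (fun i => by rw [attachMap_gen, unop_id, Category.id_comp, RLie.lin_id])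
  map_comp θ θ' := RLie.adjoin_hom_ext
    (by rw [adjoinInl_attachMap, ← Category.assoc, adjoinInl_attachMap, Category.assoc,
      adjoinInl_attachMap, X.map_comp, Category.assoc])
    (fun i => by rw [attachMap_gen, RLie.lin_comp, attachMap_gen, attachMap_gen,
      unop_comp, Category.assoc])

/-- The inclusion of `X` into the result of attaching cells to `X`. -/
def attachInl : X ⟶ attach x where
  app _ := RLie.adjoinInl _ _ _
  naturality _ _ _ := (RLie.adjoinInl_desc _ _ _).symm

/-- The attached cells. -/
def attachCell (v : V) : (attach x) _⦋d + 1⦌ :=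
  RLie.adjoinGen (X := X _⦋d + 1⦌) (r := cellRel x (op ⦋d + 1⦌)) (v, 𝟙 _)

theorem map_attachCell {Δ : SimplexCategory} (σ : Δ ⟶ ⦋d + 1⦌) (v : V) :
    RLie.lin ((attach x).map σ.op) (attachCell x v) =
      RLie.adjoinGen (X := X.obj (op Δ)) (r := cellRel x (op Δ)) (v, σ) := by
  refine (RLie.adjoinDesc_gen _ _ _ _).trans ?_
  change RLie.adjoinGen (v, σ ≫ 𝟙 _) = _
  rw [Category.comp_id]

theorem δ_zero_attachCell (v : V) : RLie.lin ((attach x).δ 0) (attachCell x v) =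
    RLie.lin ((attachInl x).app (op ⦋d⦌)) (x v) :=
  (map_attachCell x (SimplexCategory.δ 0) v).trans <| RLie.adjoinGen_eq <| Or.inl
    ⟨𝟙 _, (Category.id_comp _).symm, by
      change x v = RLie.lin (X.map (𝟙 (op ⦋d⦌))) (x v)
      rw [X.map_id, RLie.lin_id]⟩

theorem attachCell_mem_normalized (v : V) :
    attachCell x v ∈ (attach x).normalized (d + 1) :=
  mem_normalized_succ.2 fun l => (map_attachCell x (SimplexCategory.δ l.succ) v).trans <|
    (RLie.adjoinGen_eq (Or.inr ⟨l, 𝟙 _, (Category.id_comp _).symm, rfl⟩)).trans (map_zero _)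

/-- The universal property of attaching cells. -/
def attachDesc {M : SRLie p k} (g : X ⟶ M) (e : V → M _⦋d + 1⦌)
    (h1 : ∀ v, e v ∈ M.normalized (d + 1))
    (h2 : ∀ v, RLie.lin (M.δ 0) (e v) = RLie.lin (g.app (op ⦋d⦌)) (x v)) : attach x ⟶ M where
  app Δ := RLie.adjoinDesc (g.app Δ) (fun i => RLie.lin (M.map i.2.op) (e i.1)) (by
    rintro ⟨v, _⟩ _ (⟨τ, rfl, rfl⟩ | ⟨l, τ, rfl, rfl⟩)
    · refine (lin_map_comp τ (SimplexCategory.δ 0) (e v)).symm.trans ?_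
      rw [lin_naturality]
      exact congrArg _ (h2 v)
    · refine (lin_map_comp τ (SimplexCategory.δ l.succ) (e v)).symm.trans ?_
      rw [map_zero]
      exact (congrArg _ (mem_normalized_succ.1 (h1 v) l)).trans (map_zero _))
  naturality _ _ θ := RLie.adjoin_hom_ext
    (by
      change (X.map θ ≫ RLie.adjoinInl _ _ _) ≫ RLie.adjoinDesc _ _ _ =
        RLie.adjoinInl _ _ _ ≫ RLie.adjoinDesc _ _ _ ≫ M.map θ
      rw [Category.assoc, RLie.adjoinInl_desc, ← Category.assoc, RLie.adjoinInl_desc, g.naturality])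
    (fun i => (lin_map_comp θ.unop i.2 (e i.1)).symm)

theorem attachInl_desc {M : SRLie p k} (g : X ⟶ M) (e : V → M _⦋d + 1⦌)
    (h1 : ∀ v, e v ∈ M.normalized (d + 1))
    (h2 : ∀ v, RLie.lin (M.δ 0) (e v) = RLie.lin (g.app (op ⦋d⦌)) (x v)) :
    attachInl x ≫ attachDesc x g e h1 h2 = g := rfl

theorem attachDesc_cell {M : SRLie p k} (g : X ⟶ M) (e : V → M _⦋d + 1⦌)
    (h1 : ∀ v, e v ∈ M.normalized (d + 1))
    (h2 : ∀ v, RLie.lin (M.δ 0) (e v) = RLie.lin (g.app (op ⦋d⦌)) (x v)) (v : V) :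
    RLie.lin ((attachDesc x g e h1 h2).app (op ⦋d + 1⦌)) (attachCell x v) = e v := by
  change RLie.lin (M.map (𝟙 (op ⦋d + 1⦌))) (e v) = e v
  rw [M.map_id, RLie.lin_id]

theorem attach_hom_ext {M : SRLie p k} {f g : attach x ⟶ M}
    (h1 : attachInl x ≫ f = attachInl x ≫ g)
    (h2 : ∀ v, RLie.lin (f.app (op ⦋d + 1⦌)) (attachCell x v) =
      RLie.lin (g.app (op ⦋d + 1⦌)) (attachCell x v)) : f = g := by
  ext Δ : 2
  refine RLie.adjoin_hom_ext (congrArg (fun φ => φ.app Δ) h1) fun i => ?_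
  have := map_attachCell x i.2 i.1
  change RLie.lin (f.app (op Δ.unop)) _ = RLie.lin (g.app (op Δ.unop)) _
  rw [← this, lin_naturality, h2, ← lin_naturality]

open Classical in
/-- The element of `X` prescribed by the boundary conditions for a simplex of a cell, or `0` for the
simplices not subject to any condition. -/
noncomputable def cellVal (Δ : SimplexCategoryᵒᵖ) (i : V × (Δ.unop ⟶ ⦋d + 1⦌)) : X.obj Δ :=
  if h : ∃ τ : Δ.unop ⟶ ⦋d⦌, i.2 = τ ≫ SimplexCategory.δ 0 then
    RLie.lin (X.map h.choose.op) (x i.1) else 0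

variable {x}

theorem map_eq_zero_of_mem_cycles {z : X _⦋d⦌} (hz : z ∈ X.cycles d) {Δ : SimplexCategory}
    (τ : Δ ⟶ ⦋d⦌) (l : Fin (d + 1)) (h : ∀ i, τ.toOrderHom i ≠ l) :
    RLie.lin (X.map τ.op) z = 0 := by
  cases d with
  | zero => exact absurd (Subsingleton.elim (α := Fin 1) _ _) (h 0)
  | succ d =>
    obtain ⟨τ, rfl⟩ := SimplexCategory.eq_comp_δ_of_not_surjective' τ l h
    have : RLie.lin (X.map (SimplexCategory.δ l).op) z = 0 := mem_cycles_succ.1 hz l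
    rw [← lin_map_comp, this, map_zero]

/-- The value prescribed by the boundary conditions is unique when the `x v` are cycles. -/
theorem cellVal_eq (hx : ∀ v, x v ∈ X.cycles d) {Δ : SimplexCategoryᵒᵖ}
    {i : V × (Δ.unop ⟶ ⦋d + 1⦌)} {z : X.obj Δ} (h : cellRel x Δ i z) : cellVal x Δ i = z := by
  rcases h with ⟨τ, h1, rfl⟩ | ⟨l, τ, h1, rfl⟩
  · have h : ∃ τ : Δ.unop ⟶ ⦋d⦌, i.2 = τ ≫ SimplexCategory.δ 0 := ⟨τ, h1⟩
    rw [cellVal, dif_pos h]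
    have : h.choose = τ := (cancel_mono (SimplexCategory.δ (0 : Fin (d + 2)))).1
      (h.choose_spec.symm.trans h1)
    rw [this]
  · rw [cellVal]
    split_ifs with h
    · refine map_eq_zero_of_mem_cycles (hx _) _ l fun t ht => ?_
      have h2 := congrArg (fun φ : Δ.unop ⟶ ⦋d + 1⦌ => φ.toOrderHom t)
        (h.choose_spec.symm.trans h1)
      have h3 : (h.choose.toOrderHom t).succ = l.succ.succAbove (τ.toOrderHom t) := h2
      rw [ht] at h3
      exact Fin.succAbove_ne _ _ h3.symm
    · rfl

/-- The boundary conditions are compatible with each other when the `x v` are cycles, so that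
sending the simplices of the cells to the prescribed elements of `X` is a degreewise retraction. -/
theorem attachInl_injective (hx : ∀ v, x v ∈ X.cycles d) (Δ : SimplexCategoryᵒᵖ) :
    Function.Injective (RLie.lin ((attachInl x).app Δ)) := by
  have h : (attachInl x).app Δ ≫ RLie.adjoinDesc (𝟙 _) (cellVal x Δ)
      (fun i z h => cellVal_eq hx h) = 𝟙 _ := RLie.adjoinInl_desc _ _ _
  exact Function.LeftInverse.injective (g := RLie.lin (RLie.adjoinDesc (𝟙 _) (cellVal x Δ)
    (fun i z h => cellVal_eq hx h))) fun z => congrArg (fun φ => RLie.lin φ z) h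

theorem adjoinGen_mem_range {Δ : SimplexCategoryᵒᵖ} {v : V} {σ : Δ.unop ⟶ ⦋d + 1⦌}
    (hσ : ¬Function.Surjective σ.toOrderHom) :
    (RLie.adjoinGen (v, σ) : (attach x).obj Δ) ∈
      LinearMap.range (RLie.lin ((attachInl x).app Δ)) := by
  obtain ⟨i, τ, rfl⟩ := SimplexCategory.eq_comp_δ_of_not_surjective σ hσ
  induction i using Fin.cases with
  | zero => exact ⟨_, (RLie.adjoinGen_eq (Or.inl ⟨τ, rfl, rfl⟩)).symm⟩
  | succ l => exact ⟨0, (RLie.adjoinGen_eq (Or.inr ⟨l, τ, rfl, rfl⟩)).symm⟩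

theorem attachInl_bijective (hx : ∀ v, x v ∈ X.cycles d) {m : ℕ} (hm : m ≤ d) :
    Function.Bijective (RLie.lin ((attachInl x).app (op ⦋m⦌))) := by
  refine ⟨attachInl_injective hx _, fun y => ?_⟩
  refine RLie.adjoin_mem_of_generators (RLie.rangeSub ((attachInl x).app (op ⦋m⦌)))
    (fun z => ⟨z, rfl⟩) (fun i => adjoinGen_mem_range fun hs => ?_) y
  have := Fintype.card_le_of_surjective (α := Fin (m + 1)) (β := Fin (d + 2)) _ hs
  simp at this
  omega

/-- In degree `d + 1`, the cells themselves are free generators: their other simplices either come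
from `X` or vanish. -/
theorem isFreeExtension_attach (hx : ∀ v, x v ∈ X.cycles d) :
    RLie.IsFreeExtension ((attachInl x).app (op ⦋d + 1⦌)) (attachCell x) where
  exists_hom {M} g s := by
    classical
    refine ⟨RLie.adjoinDesc g
      (fun i => if i.2 = 𝟙 _ then s i.1 else RLie.lin g (cellVal x _ i)) (fun i z h => ?_),
      RLie.adjoinInl_desc _ _ _, fun v => (RLie.adjoinDesc_gen _ _ _ _).trans (if_pos rfl)⟩
    have hi : i.2 ≠ 𝟙 _ := by
      have key : ∀ (l : Fin (d + 2)) (τ : ⦋d + 1⦌ ⟶ ⦋d⦌), τ ≫ SimplexCategory.δ l ≠ 𝟙 _ := by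
        intro l τ h
        have := congrArg (fun φ : ⦋d + 1⦌ ⟶ ⦋d + 1⦌ => φ.toOrderHom l) h
        exact Fin.succAbove_ne l (τ.toOrderHom l) this
      rcases h with ⟨τ, h1, -⟩ | ⟨l, τ, h1, -⟩ <;> rw [h1] <;> exact key _ _
    rw [if_neg hi, cellVal_eq hx h]
  mem_of_generators S h1 h2 := RLie.adjoin_mem_of_generators S h1 fun i => by
    obtain ⟨v, σ⟩ := i
    by_cases hσ : Function.Surjective σ.toOrderHom
    · have : Epi σ := SimplexCategory.epi_iff_surjective.2 hσ
      have : σ = 𝟙 _ := SimplexCategory.eq_id_of_epi σ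
      rw [this]
      exact h2 v
    · obtain ⟨z, hz⟩ := adjoinGen_mem_range (x := x) (v := v) hσ
      rw [← hz]
      exact h1 z

theorem δ_zero_mem_cycles {L : SRLie p k} {n : ℕ} {y : L _⦋n + 1⦌} (hy : y ∈ L.normalized (n + 1)) :
    RLie.lin (L.δ 0) y ∈ L.cycles n := by
  cases n with
  | zero => trivial
  | succ n =>
    refine mem_cycles_succ.2 fun j => ?_
    rw [← RLie.lin_comp, ← Fin.castSucc_zero, ← L.δ_comp_δ (Fin.zero_le j), RLie.lin_comp,
      mem_normalized_succ.1 hy, map_zero]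

/-- Acyclic fibrations have the lifting property for cells. -/
theorem exists_cell_lift {E Z : SRLie p k} {q : E ⟶ Z} (hq : acyclicFibrations p k q) {e : E _⦋d⦌}
    (he : e ∈ E.cycles d) {z : Z _⦋d + 1⦌} (hz : z ∈ Z.normalized (d + 1))
    (hd : RLie.lin (Z.δ 0) z = RLie.lin (q.app (op ⦋d⦌)) e) :
    ∃ y ∈ E.normalized (d + 1), RLie.lin (E.δ 0) y = e ∧ RLie.lin (q.app (op ⦋d + 1⦌)) y = z := by
  obtain ⟨y₁, hy₁, hd₁⟩ := (homotopyGroupMap_injective_iff q d).1 (hq.1 d).1 e he ⟨z, hz, hd⟩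
  obtain ⟨y₂, hy₂, z', hz', hd'⟩ := (homotopyGroupMap_surjective_iff q (d + 1)).1 (hq.1 (d + 1)).2
    (z - RLie.lin (q.app (op ⦋d + 1⦌)) y₁) (mem_cycles_iff.2 ⟨sub_mem hz (normalized_map q hy₁), by
      rw [map_sub, hd, ← lin_δ_naturality, hd₁, sub_self]⟩)
  obtain ⟨y₃, hy₃, rfl⟩ := exists_normalized_lift q hq.2 hz'
  have hb := δ_zero_mem_cycles hy₃
  rw [mem_cycles_iff] at hy₂ hb
  refine ⟨y₁ + y₂ + RLie.lin (E.δ 0) y₃, add_mem (add_mem hy₁ hy₂.1) hb.1, ?_, ?_⟩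
  · rw [map_add, map_add, hd₁, hy₂.2, hb.2, add_zero, add_zero]
  · have hd' : RLie.lin (Z.δ 0) _ = _ := hd'
    rw [map_add, map_add, lin_δ_naturality, hd']
    abel

theorem cofibrations_attachInl (hx : ∀ v, x v ∈ X.cycles d) :
    cofibrations p k (attachInl x) := fun E Z q hq => ⟨fun {u w} sq => by
  have key : ∀ v, ∃ y ∈ E.normalized (d + 1),
      RLie.lin (E.δ 0) y = RLie.lin (u.app (op ⦋d⦌)) (x v) ∧
        RLie.lin (q.app (op ⦋d + 1⦌)) y = RLie.lin (w.app (op ⦋d + 1⦌)) (attachCell x v) := by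
    intro v
    refine exists_cell_lift hq (cycles_map u (hx v))
      (normalized_map w (attachCell_mem_normalized x v)) ?_
    rw [← lin_δ_naturality, δ_zero_attachCell]
    exact (congrArg (fun φ : X ⟶ Z => RLie.lin (φ.app (op ⦋d⦌)) (x v)) sq.w).symm
  choose y h1 h2 h3 using key
  exact ⟨⟨{
    l := attachDesc x u y h1 h2
    fac_left := attachInl_desc x u y h1 h2
    fac_right := attach_hom_ext x
      (by rw [← Category.assoc, attachInl_desc, sq.w])
      (fun v => by rw [NatTrans.comp_app, RLie.lin_comp, attachDesc_cell, h3]) }⟩⟩⟩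

theorem mem_cycles_of_injective {L' L : SRLie p k} {f : L' ⟶ L}
    (hf : ∀ m, Function.Injective (RLie.lin (f.app (op ⦋m⦌)))) {n : ℕ} {z : L' _⦋n⦌}
    (hz : RLie.lin (f.app (op ⦋n⦌)) z ∈ L.cycles n) : z ∈ L'.cycles n := by
  cases n with
  | zero => trivial
  | succ n =>
    refine mem_cycles_succ.2 fun j => hf n ?_
    rw [lin_δ_naturality, mem_cycles_succ.1 hz, map_zero]

end

section

variable {X Y : SRLie p k} (g : X ⟶ Y) (d : ℕ)

/-- The cells of dimension `d + 1` which can be attached to `X` over `Y`: cycles `x` of `X` with a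
null homotopy of their image in `Y`. -/
def CellOver : Type u :=
  {c : X _⦋d⦌ × Y _⦋d + 1⦌ // c.1 ∈ X.cycles d ∧ c.2 ∈ Y.normalized (d + 1) ∧
    RLie.lin (Y.δ 0) c.2 = RLie.lin (g.app (op ⦋d⦌)) c.1}

/-- The result of attaching all cells of dimension `d + 1` to `X` over `Y`. -/
def attachAll : SRLie p k := attach fun c : CellOver g d => c.1.1

/-- The inclusion of `X`. -/
def attachAllInl : X ⟶ attachAll g d := attachInl _

/-- The projection to `Y`. -/
def attachAllDesc : attachAll g d ⟶ Y :=
  attachDesc _ g (fun c => c.1.2) (fun c => c.2.2.1) (fun c => c.2.2.2)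

theorem attachAllInl_desc : attachAllInl g d ≫ attachAllDesc g d = g := attachInl_desc _ _ _ _ _

variable {g d}

theorem attachAllInl_bijective {m : ℕ} (hm : m ≤ d) :
    Function.Bijective (RLie.lin ((attachAllInl g d).app (op ⦋m⦌))) :=
  attachInl_bijective (fun c => c.2.1) hm

/-- Attaching all cells of dimension `d + 1` improves the connectivity from `d` to `d + 1`. -/
theorem isNConnected_attachAllDesc (hg : IsNConnected d g) :
    IsNConnected (d + 1) (attachAllDesc g d) := by
  have hx : ∀ c : CellOver g d, c.1.1 ∈ X.cycles d := fun c => c.2.1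
  have hc : ∀ i, homotopyGroupMap (attachAllDesc g d) i ∘ homotopyGroupMap (attachAllInl g d) i =
      homotopyGroupMap g i := fun i => by
    rw [← LinearMap.coe_comp, ← homotopyGroupMap_comp, attachAllInl_desc]
  refine ⟨fun i hi => ?_, ?_⟩
  · rcases Nat.lt_succ_iff_lt_or_eq.1 hi with hi | rfl
    · refine (Function.Bijective.of_comp_iff _ (homotopyGroupMap_bijective_of_bijective _ i
        fun m hm => attachAllInl_bijective (by omega))).1 ?_
      exact (hc i).symm ▸ hg.1 i hi
    · refine ⟨?_, Function.Surjective.of_comp (g := homotopyGroupMap (attachAllInl g i) i)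
        ((hc i).symm ▸ hg.2)⟩
      rw [homotopyGroupMap_injective_iff]
      rintro z hz ⟨y, hy, hyz⟩
      obtain ⟨x, rfl⟩ := (attachAllInl_bijective le_rfl).2 z
      let c : CellOver g i := ⟨(x, y), mem_cycles_of_injective
        (fun m => attachInl_injective hx _) hz, hy, hyz⟩
      exact ⟨attachCell _ c, attachCell_mem_normalized _ c, δ_zero_attachCell _ c⟩
  · rw [homotopyGroupMap_surjective_iff]
    intro y hy
    rw [mem_cycles_iff] at hy
    let c : CellOver g d := ⟨(0, y), zero_mem _, hy.1, by rw [hy.2, map_zero]⟩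
    refine ⟨attachCell _ c, mem_cycles_iff.2 ⟨attachCell_mem_normalized _ c,
      (δ_zero_attachCell _ c).trans (map_zero _)⟩, ?_⟩
    have : RLie.lin ((attachAllDesc g d).app (op ⦋d + 1⦌)) (attachCell _ c) = y :=
      attachDesc_cell _ _ _ _ _ _
    rw [this, sub_self]
    exact zero_mem _

end

/-! ### Factorization into a cofibration and a weak equivalence -/

/-- An object with a `d`-connected morphism to `Y`. -/
structure ConnectedOver (Y : SRLie p k) (d : ℕ) where
  obj : SRLie p k
  hom : obj ⟶ Y
  connected : IsNConnected d hom

namespace ConnectedOver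

variable {Y : SRLie p k} {n : ℕ}

/-- The result of attaching all cells of dimension `n + 1` over `Y`. -/
def next (S : ConnectedOver Y n) : ConnectedOver Y (n + 1) :=
  ⟨_, _, isNConnected_attachAllDesc S.connected⟩

/-- The sequence of objects obtained by attaching cells of dimension `n + 1`, `n + 2`, … -/
def seq (S : ConnectedOver Y n) (i : ℕ) : ConnectedOver Y (n + i) :=
  Nat.rec (motive := fun i => ConnectedOver Y (n + i)) S (fun _ T => T.next) i

/-- The sequence of attachments, as a functor. -/
def tower (S : ConnectedOver Y n) : ℕ ⥤ SRLie p k :=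
  Functor.ofSequence (X := fun i => (S.seq i).obj) fun i => attachAllInl (S.seq i).hom (n + i)

variable (S : ConnectedOver Y n)

theorem tower_map_succ (i : ℕ) : S.tower.map (homOfLE (Nat.le_add_right i 1)) =
    attachAllInl (S.seq i).hom (n + i) := Functor.ofSequence_map_homOfLE_succ _ i

theorem tower_map_bijective {i j : ℕ} (h : i ≤ j) {m : ℕ} (hm : m ≤ n + i) :
    Function.Bijective (RLie.lin ((S.tower.map (homOfLE h)).app (op ⦋m⦌))) := by
  induction j, h using Nat.le_induction with
  | base =>
    rw [show homOfLE (le_refl i) = 𝟙 i from rfl, S.tower.map_id]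
    exact Function.bijective_id
  | succ j h ih =>
    rw [show homOfLE (h.trans (Nat.le_succ j)) = homOfLE h ≫ homOfLE (Nat.le_add_right j 1)
      from rfl, S.tower.map_comp, tower_map_succ]
    change Function.Bijective (RLie.lin ((attachAllInl (S.seq j).hom (n + j)).app (op ⦋m⦌)) ∘
      RLie.lin ((S.tower.map (homOfLE h)).app (op ⦋m⦌)))
    exact (attachAllInl_bijective (by omega)).comp ih

theorem isEventuallyConstantFrom (Δ : SimplexCategoryᵒᵖ) :
    (S.tower.flip.obj Δ).IsEventuallyConstantFrom Δ.unop.len := fun _ φ =>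
  RLie.isIso_of_bijective _
    (S.tower_map_bijective (leOfHom φ) (m := Δ.unop.len) (Nat.le_add_left _ _))

instance (Δ : SimplexCategoryᵒᵖ) : Limits.HasColimit (S.tower.flip.obj Δ) :=
  (S.isEventuallyConstantFrom Δ).hasColimit

theorem ι_bijective {i m : ℕ} (hm : m ≤ n + i) :
    Function.Bijective (RLie.lin ((Limits.colimit.ι S.tower i).app (op ⦋m⦌))) := by
  have h : (S.tower ⋙ (evaluation _ _).obj (op ⦋m⦌)).IsEventuallyConstantFrom i := fun _ φ =>
    RLie.isIso_of_bijective _ (S.tower_map_bijective (leOfHom φ) hm)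
  have : IsIso ((Limits.colimit.ι S.tower i).app (op ⦋m⦌)) := h.isIso_ι_of_isColimit
    (Limits.isColimitOfPreserves ((evaluation _ _).obj (op ⦋m⦌)) (Limits.colimit.isColimit S.tower))
  exact RLie.bijective_of_isIso ((Limits.colimit.ι S.tower i).app (op ⦋m⦌))

/-- The compatible morphisms from the tower to `Y`. -/
def toBase : S.tower ⟶ (Functor.const ℕ).obj Y :=
  NatTrans.ofSequence (fun i => (S.seq i).hom) fun i => by
    rw [tower_map_succ]
    exact (attachAllInl_desc _ _).trans (Category.comp_id _).symm

end ConnectedOver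

/-- An `n`-connected morphism is the composition of a cofibration, which is bijective in degrees
`≤ n` and a free extension in degree `n + 1`, and a weak equivalence. -/
theorem exists_factorization {X Y : SRLie p k} (g : X ⟶ Y) (n : ℕ) (hg : IsNConnected n g) :
    ∃ (X' : SRLie p k) (i : X ⟶ X') (g' : X' ⟶ Y), i ≫ g' = g ∧ cofibrations p k i ∧
      weakEquivalences p k g' ∧ (∀ m ≤ n, Function.Bijective (RLie.lin (i.app (op ⦋m⦌)))) ∧
      ∃ (V : Type u) (v : V → X' _⦋n + 1⦌), RLie.IsFreeExtension (i.app (op ⦋n + 1⦌)) v := by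
  let S : ConnectedOver Y n := ⟨X, g, hg⟩
  have hι : ∀ i, Limits.colimit.ι S.tower i ≫
      Limits.colimit.desc S.tower ⟨Y, S.toBase⟩ = (S.seq i).hom :=
    fun i => Limits.colimit.ι_desc _ _
  -- Each degree is constant from some stage of the tower on, so all properties of the colimit can
  -- be read off at a finite stage.
  refine ⟨Limits.colimit S.tower, Limits.colimit.ι S.tower 0,
    Limits.colimit.desc S.tower ⟨Y, S.toBase⟩, hι 0, fun E Z q hq => ?_, fun m => ?_,
    fun m hm => S.ι_bijective hm, ?_⟩
  · refine HasLiftingProperty.transfiniteComposition.hasLiftingProperty_ι_app_bot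
      (hc := Limits.colimit.isColimit S.tower) (fun j _ => ?_)
    change HasLiftingProperty (S.tower.map (homOfLE (Nat.le_add_right j 1))) q
    rw [S.tower_map_succ]
    exact cofibrations_attachInl (fun c => c.2.1) _ hq
  · have h1 := (S.seq (m + 1)).connected.1 m (by omega)
    let J : (S.seq (m + 1)).obj ⟶ Limits.colimit S.tower := Limits.colimit.ι S.tower (m + 1)
    let D : Limits.colimit S.tower ⟶ Y := Limits.colimit.desc S.tower ⟨Y, S.toBase⟩
    rw [← show J ≫ D = _ from hι (m + 1), homotopyGroupMap_comp, LinearMap.coe_comp] at h1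
    exact (Function.Bijective.of_comp_iff _ (homotopyGroupMap_bijective_of_bijective _ m
      fun m' hm' => S.ι_bijective (by omega))).1 h1
  · have h1 := isFreeExtension_attach (X := X) (V := CellOver g n) (x := fun c => c.1.1)
      (fun c => c.2.1)
    have h2 := h1.comp_bijective ((Limits.colimit.ι S.tower 1).app (op ⦋n + 1⦌))
      (S.ι_bijective le_rfl)
    have h3 : (attachInl fun c : CellOver g n => c.1.1).app (op ⦋n + 1⦌) ≫
        (Limits.colimit.ι S.tower 1).app (op ⦋n + 1⦌) =
        (Limits.colimit.ι S.tower 0).app (op ⦋n + 1⦌) := by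
      have h4 := Limits.colimit.w S.tower (homOfLE (Nat.le_add_right 0 1))
      rw [S.tower_map_succ] at h4
      exact congrArg (fun φ => φ.app (op ⦋n + 1⦌)) h4
    rw [h3] at h2
    exact ⟨_, _, h2⟩

/-! ### Cofibers -/

section

variable {A B : SRLie p k} (j : A ⟶ B)

/-- The relations `a = j a` and `a = 0` defining the cofiber of `j`. -/
def cofiberRel (Δ : SimplexCategoryᵒᵖ) (a : A.obj Δ) (x : B.obj Δ) : Prop :=
  x = RLie.lin (j.app Δ) a ∨ x = 0

theorem cofiberRel_map {Δ Δ' : SimplexCategoryᵒᵖ} (θ : Δ ⟶ Δ') {a : A.obj Δ} {x : B.obj Δ}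
    (h : cofiberRel j Δ a x) :
    cofiberRel j Δ' (RLie.lin (A.map θ) a) (RLie.lin (B.map θ) x) := by
  rcases h with rfl | rfl
  · exact Or.inl (lin_naturality j θ a).symm
  · exact Or.inr (map_zero _)

/-- The structure maps of the cofiber. -/
def cofiberMap {Δ Δ' : SimplexCategoryᵒᵖ} (θ : Δ ⟶ Δ') :
    RLie.adjoin (B.obj Δ) (A.obj Δ) (cofiberRel j Δ) ⟶
      RLie.adjoin (B.obj Δ') (A.obj Δ') (cofiberRel j Δ') :=
  RLie.adjoinDesc (B.map θ ≫ RLie.adjoinInl _ _ _)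
    (fun a => RLie.adjoinGen (RLie.lin (A.map θ) a))
    (fun _ z h => by
      rw [RLie.lin_comp]
      exact RLie.adjoinGen_eq (cofiberRel_map j θ h))

theorem adjoinInl_cofiberMap {Δ Δ' : SimplexCategoryᵒᵖ} (θ : Δ ⟶ Δ') :
    RLie.adjoinInl _ _ _ ≫ cofiberMap j θ = B.map θ ≫ RLie.adjoinInl _ _ _ := rfl

theorem cofiberMap_gen {Δ Δ' : SimplexCategoryᵒᵖ} (θ : Δ ⟶ Δ') (a : A.obj Δ) :
    RLie.lin (cofiberMap j θ) (RLie.adjoinGen a) = RLie.adjoinGen (RLie.lin (A.map θ) a) := rfl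

/-- The pushout of `j : A ⟶ B` along `A ⟶ 0`. -/
def cofiber : SRLie p k where
  obj Δ := RLie.adjoin (B.obj Δ) (A.obj Δ) (cofiberRel j Δ)
  map θ := cofiberMap j θ
  map_id _ := RLie.adjoin_hom_ext
    (by rw [adjoinInl_cofiberMap, B.map_id, Category.id_comp, Category.comp_id])
    (fun a => by rw [cofiberMap_gen, A.map_id, RLie.lin_id, RLie.lin_id])
  map_comp θ θ' := RLie.adjoin_hom_ext
    (by rw [adjoinInl_cofiberMap, ← Category.assoc, adjoinInl_cofiberMap, Category.assoc,
      adjoinInl_cofiberMap, B.map_comp, Category.assoc])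
    (fun a => by rw [cofiberMap_gen, RLie.lin_comp, cofiberMap_gen, cofiberMap_gen, A.map_comp,
      RLie.lin_comp])

/-- The projection to the cofiber. -/
def cofiberProj : B ⟶ cofiber j where
  app _ := RLie.adjoinInl _ _ _
  naturality _ _ _ := (adjoinInl_cofiberMap _ _).symm

theorem adjoinGen_cofiber {Δ : SimplexCategoryᵒᵖ} (a : A.obj Δ) :
    (RLie.adjoinGen a : RLie.adjoin (B.obj Δ) (A.obj Δ) (cofiberRel j Δ)) = 0 :=
  (RLie.adjoinGen_eq (Or.inr rfl)).trans (map_zero _)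

theorem cofiberProj_map {Δ : SimplexCategoryᵒᵖ} (a : A.obj Δ) :
    RLie.lin ((cofiberProj j).app Δ) (RLie.lin (j.app Δ) a) = 0 :=
  (RLie.adjoinGen_eq (Or.inl rfl)).symm.trans (adjoinGen_cofiber j a)

theorem cofiberProj_surjective (Δ : SimplexCategoryᵒᵖ) :
    Function.Surjective (RLie.lin ((cofiberProj j).app Δ)) := fun y =>
  RLie.adjoin_mem_of_generators (RLie.rangeSub ((cofiberProj j).app Δ)) (fun x => ⟨x, rfl⟩)
    (fun a => ⟨0, (map_zero _).trans (adjoinGen_cofiber j a).symm⟩) y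

/-- A homomorphism killing `A` kills the kernel of the projection to the cofiber. -/
theorem eq_zero_of_cofiberProj_eq_zero {Δ : SimplexCategoryᵒᵖ} {M : RLie p k} (φ : B.obj Δ ⟶ M)
    (hφ : ∀ a, RLie.lin φ (RLie.lin (j.app Δ) a) = 0) {x : B.obj Δ}
    (hx : RLie.lin ((cofiberProj j).app Δ) x = 0) : RLie.lin φ x = 0 := by
  let ψ : RLie.adjoin (B.obj Δ) (A.obj Δ) (cofiberRel j Δ) ⟶ M :=
    RLie.adjoinDesc φ (fun _ => 0) (by
      rintro a _ (rfl | rfl)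
      · exact (hφ a).symm
      · exact (map_zero _).symm)
  exact (congrArg (RLie.lin ψ) hx).trans (map_zero _)

/-- In each degree, the cofiber is the pushout: its generators vanish by one relation and are
identified with the elements of `A` by the other. -/
theorem isPushout_cofiber : IsPushout j (toZero A) (cofiberProj j) (fromZero (cofiber j)) := by
  have w : j ≫ cofiberProj j = toZero A ≫ fromZero (cofiber j) := by
    ext Δ : 2
    exact RLie.hom_ext fun a => cofiberProj_map j a
  refine ⟨⟨w⟩, ⟨Limits.PushoutCocone.IsColimit.mk w (fun s =>
    { app := fun Δ => RLie.adjoinDesc (s.inl.app Δ) (fun _ => 0) ?_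
      naturality := fun Δ Δ' θ => RLie.adjoin_hom_ext ?_ fun a => ?_ })
    (fun s => rfl) (fun s => fromZero_unique _ _) (fun s m h1 _ => ?_)⟩⟩
  · have hs : ∀ a, RLie.lin (s.inl.app Δ) (RLie.lin (j.app Δ) a) = 0 := fun a =>
      (congrArg (fun g : A ⟶ s.pt => RLie.lin (g.app Δ) a) s.condition).trans
        (map_zero (RLie.lin (s.inr.app Δ)))
    rintro a _ (rfl | rfl)
    · exact (hs a).symm
    · exact (map_zero _).symm
  · exact s.inl.naturality θ
  · exact (map_zero (RLie.lin (s.pt.map θ))).symm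
  · ext Δ : 2
    refine RLie.adjoin_hom_ext (congrArg (fun g => g.app Δ) h1) fun a => ?_
    exact (congrArg (RLie.lin (m.app Δ)) (adjoinGen_cofiber j a)).trans (map_zero _)

end

/-! ### Excision for minimal cofibrations -/

/-- The map `[m] ⟶ [m]` sending `i ≤ t` to `0` and fixing all `i > t`. -/
def collapse (m t : ℕ) : ⦋m⦌ ⟶ ⦋m⦌ := SimplexCategory.Hom.mk
  ⟨fun i => if i.val ≤ t then 0 else i, fun i j hij => by
    have := Fin.le_def.1 hij
    dsimp only
    split_ifs <;> first | omega | (exact Fin.zero_le _)⟩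

theorem collapse_zero (m : ℕ) : collapse m 0 = 𝟙 _ := by
  ext i
  change (if i.val ≤ 0 then (0 : Fin (m + 1)) else i).val = i.val
  split_ifs with h
  · exact (Nat.le_zero.1 h).symm
  · rfl

theorem collapse_self (m : ℕ) : collapse m m =
    SimplexCategory.const _ ⦋0⦌ 0 ≫ SimplexCategory.const ⦋0⦌ ⦋m⦌ 0 := by
  ext i
  exact congrArg Fin.val (if_pos (Nat.le_of_lt_succ i.2))

/-- The map `[m + 1] ⟶ [m]` sending `i ≤ t` to `0` and `i > t` to `i - 1`. -/
def shift (m t : ℕ) : ⦋m + 1⦌ ⟶ ⦋m⦌ := SimplexCategory.Hom.mk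
  ⟨fun i => if h : i.val ≤ t then 0 else i.pred (by rintro rfl; simp at h), fun i j hij => by
    have := Fin.le_def.1 hij
    dsimp only
    split_ifs <;> first | omega | (exact Fin.zero_le _) | (exact Fin.pred_le_pred_iff.2 hij)⟩

/-- The faces `t + 1` and `t` of `shift m t` are `collapse m t` and `collapse m (t - 1)`. -/
theorem δ_shift (m : ℕ) (l : Fin (m + 2)) {t t' : ℕ} (h : l.val = t + 1 ∧ t' = t ∨
    l.val = t ∧ t = t' + 1) : SimplexCategory.δ l ≫ shift m t = collapse m t' := by
  ext i
  have hv : ∀ a : Fin (m + 2), ((shift m t).toOrderHom a).val =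
      if a.val ≤ t then 0 else a.val - 1 := by
    intro a
    change (dite _ _ _ : Fin (m + 1)).val = _
    split_ifs <;> rfl
  change ((shift m t).toOrderHom (l.succAbove i)).val =
    (if i.val ≤ t' then (0 : Fin (m + 1)) else i).val
  have hi : i.val < m + 1 := i.2
  rw [hv]
  rcases lt_or_ge i.castSucc l with hil | hil
  · rw [Fin.succAbove_of_castSucc_lt _ _ hil]
    have : i.val < l.val := hil
    rw [Fin.val_castSucc]
    split_ifs <;> first | rfl | omega
  · rw [Fin.succAbove_of_le_castSucc _ _ hil]
    have : l.val ≤ i.val := hil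
    rw [Fin.val_succ]
    split_ifs <;> first | rfl | omega

section

variable {A B : SRLie p k} {j : A ⟶ B} {n : ℕ} {V : Type u} {v : V → B _⦋n + 1⦌}

/-- The excision homotopy. Suppose that `A₀ = 0`, that `j : A ⟶ B` is bijective in degrees `≤ n` and
that `B_{n+1}` is freely generated by `A_{n+1}` and elements `v`. Then every element of the kernel
of the projection to the cofiber in `N_{n+1}` comes from `N_{n+1} A` up to a boundary.

The endomorphisms `φ_t` of `B_{n+1}` which are the operator `collapse t` on `A` and the identity on
the generators `v` interpolate between the identity and a map killing the kernel. The successive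
differences are differences of two faces of `Φ_t x`, where `Φ_t` is `shift t` on `A` and a
degeneracy on the generators. -/
theorem exists_eq_add_δ_zero_of_cofiberProj_eq_zero (hA : Subsingleton (A _⦋0⦌))
    (hj : Function.Bijective (RLie.lin (j.app (op ⦋n⦌))))
    (hv : RLie.IsFreeExtension (j.app (op ⦋n + 1⦌)) v) {x : B _⦋n + 1⦌}
    (hx : x ∈ B.normalized (n + 1)) (hqx : RLie.lin ((cofiberProj j).app (op ⦋n + 1⦌)) x = 0) :
    ∃ u ∈ A.normalized (n + 1), ∃ y ∈ B.normalized (n + 2),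
      RLie.lin ((cofiberProj j).app (op ⦋n + 2⦌)) y = 0 ∧
        x = RLie.lin (j.app (op ⦋n + 1⦌)) u + RLie.lin (B.δ 0) y := by
  choose φ hφA hφV using fun t : ℕ =>
    hv.exists_hom (A.map (collapse (n + 1) t).op ≫ j.app (op ⦋n + 1⦌)) v
  have hφ0 : φ 0 = 𝟙 _ := hv.hom_ext
    (by rw [hφA, collapse_zero, op_id, A.map_id, Category.id_comp, Category.comp_id])
    (fun i => by rw [hφV, RLie.lin_id])
  have hφn : RLie.lin (φ (n + 1)) x = 0 := by
    refine eq_zero_of_cofiberProj_eq_zero j (φ (n + 1)) (fun a => ?_) hqx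
    rw [← RLie.lin_comp, hφA, RLie.lin_comp, collapse_self, ← lin_map_comp,
      Subsingleton.elim (RLie.lin (A.map (SimplexCategory.const ⦋0⦌ ⦋n + 1⦌ 0).op) a) 0, map_zero,
      map_zero]
  -- Homologies are first taken modulo the image of `A`.
  have hJK : ∀ m, (Subspace.range j).mod m ≤ (Subspace.ker (cofiberProj j)).mod m := by
    rintro m _ ⟨a, rfl⟩
    exact cofiberProj_map j a
  have step : ∀ s : Fin (n + 1), ∃ y ∈ (Subspace.ker (cofiberProj j)).mod (n + 2),
      y ∈ B.normalized (n + 2) ∧ RLie.lin (B.δ 0) y -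
        (RLie.lin (φ s.val) x - RLie.lin (φ (s.val + 1)) x) ∈ (Subspace.range j).mod (n + 1) := by
    intro s
    obtain ⟨Φ, hΦA, hΦV⟩ := hv.exists_hom
      (A.map (shift (n + 1) (s.val + 1)).op ≫ j.app (op ⦋n + 2⦌))
      (fun i => RLie.lin (B.σ s.succ) (v i))
    have hδA : ∀ l, j.app (op ⦋n + 1⦌) ≫ Φ ≫ B.δ l =
        A.map (SimplexCategory.δ l ≫ shift (n + 1) (s.val + 1)).op ≫ j.app (op ⦋n + 1⦌) := by
      intro l
      rw [← Category.assoc, hΦA, Category.assoc, ← SimplicialObject.δ_naturality, op_comp,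
        A.map_comp, Category.assoc]
      rfl
    have h0 : Φ ≫ B.δ s.succ.castSucc = φ s.val := hv.hom_ext
      (by rw [hδA, hφA, δ_shift (t := s.val + 1) (t' := s.val) _ _ (Or.inr ⟨rfl, rfl⟩)])
      (fun i => by rw [RLie.lin_comp, hΦV, hφV, δ_σ_self])
    have h1 : Φ ≫ B.δ s.succ.succ = φ (s.val + 1) := hv.hom_ext
      (by rw [hδA, hφA, δ_shift (t := s.val + 1) (t' := s.val + 1) _ _ (Or.inl ⟨rfl, rfl⟩)])
      (fun i => by rw [RLie.lin_comp, hΦV, hφV, δ_σ_succ])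
    have hJ : ∀ z : B _⦋n⦌, z ∈ (Subspace.range j).mod n := fun z => hj.2 z
    obtain ⟨y, hyK, hyN, hy⟩ := exists_normalized_δ_sub_mem (Subspace.range j)
      (Subspace.ker (cofiberProj j)) hJK s.succ (y := RLie.lin Φ x)
      (eq_zero_of_cofiberProj_eq_zero j (Φ ≫ (cofiberProj j).app (op ⦋n + 2⦌)) (fun a => by
        rw [← RLie.lin_comp, ← Category.assoc, hΦA, Category.assoc, RLie.lin_comp, RLie.lin_comp,
          cofiberProj_map]) hqx)
      (fun l hl1 hl2 => by
        have := hv.mem_of_generators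
          (RLie.comapSub (Φ ≫ B.δ l) (RLie.rangeSub (j.app (op ⦋n + 1⦌))))
          (fun a => ?_) (fun i => ?_) x
        · exact this
        · exact ⟨_, (congrArg (fun ψ => RLie.lin ψ a) (hδA l)).symm⟩
        · have := δ_σ_mem (Subspace.range j) s.succ l (v i) hl1 hl2 fun _ => hJ _
          rw [← hΦV] at this
          exact this)
      (fun _ => hJ _) (fun _ => hJ _)
    refine ⟨y, hyK, hyN, ?_⟩
    rwa [← RLie.lin_comp, ← RLie.lin_comp, h0, h1] at hy
  -- Summing up these homologies from `φ 0 = 𝟙` to `φ (n + 1)`, which kills `x`.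
  have tel : ∀ t ≤ n + 1, ∃ y ∈ (Subspace.ker (cofiberProj j)).mod (n + 2),
      y ∈ B.normalized (n + 2) ∧ RLie.lin (B.δ 0) y - (x - RLie.lin (φ t) x) ∈
        (Subspace.range j).mod (n + 1) := by
    intro t
    induction t with
    | zero =>
      refine fun _ => ⟨0, zero_mem _, zero_mem _, ?_⟩
      rw [hφ0, RLie.lin_id, map_zero, sub_self, sub_zero]
      exact zero_mem _
    | succ t ih =>
      intro ht
      obtain ⟨y, hyK, hyN, hy⟩ := ih (by omega)
      obtain ⟨y', hyK', hyN', hy'⟩ := step ⟨t, ht⟩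
      refine ⟨y + y', add_mem hyK hyK', add_mem hyN hyN', ?_⟩
      have := add_mem hy hy'
      convert this using 1
      rw [map_add]
      dsimp only
      abel
  obtain ⟨y, hyK, hyN, u, hu⟩ := tel (n + 1) le_rfl
  rw [hφn, sub_zero] at hu
  refine ⟨-u, neg_mem (mem_normalized_succ.2 fun l => hj.1 ?_), y, hyN, hyK, ?_⟩
  · rw [lin_δ_naturality, hu, map_sub, mem_normalized_succ.1 hx,
      mem_cycles_succ.1 (δ_zero_mem_cycles hyN) l.succ, map_zero, sub_zero]
  · rw [map_neg, hu]
    abel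

/-- Excision for a cofibration as in `exists_eq_add_δ_zero_of_cofiberProj_eq_zero`. -/
theorem isNConnected_fibMap_cofiberProj (hA : Subsingleton (A _⦋0⦌))
    (hj : ∀ m ≤ n, Function.Bijective (RLie.lin (j.app (op ⦋m⦌))))
    (hv : RLie.IsFreeExtension (j.app (op ⦋n + 1⦌)) v) :
    IsNConnected (n + 1) (fibMap (j := j) (f := fromZero (cofiber j)) (toZero A) (cofiberProj j)
      (isPushout_cofiber j).w.symm) := by
  have hqs : ∀ m, Function.Surjective (RLie.lin ((cofiberProj j).app (op ⦋m⦌))) :=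
    fun m => cofiberProj_surjective j _
  -- The kernel of the projection to the cofiber, modulo the image of `A`, is acyclic in degrees
  -- `≤ n + 1`.
  -- In degree `n + 1` this is the excision homotopy, below it holds since `j` is bijective.
  have hE : ∀ m ≤ n, ∀ x ∈ B.normalized (m + 1),
      RLie.lin ((cofiberProj j).app (op ⦋m + 1⦌)) x = 0 →
      ∃ u ∈ A.normalized (m + 1), ∃ y ∈ B.normalized (m + 2),
        RLie.lin ((cofiberProj j).app (op ⦋m + 2⦌)) y = 0 ∧
          x = RLie.lin (j.app (op ⦋m + 1⦌)) u + RLie.lin (B.δ 0) y := by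
    intro m hm x hx hqx
    rcases Nat.lt_or_eq_of_le hm with hm' | rfl
    · obtain ⟨u, rfl⟩ := (hj (m + 1) hm').2 x
      refine ⟨u, mem_normalized_succ.2 fun l => (hj m hm).1 ?_, 0, zero_mem _, map_zero _, ?_⟩
      · rw [lin_δ_naturality, mem_normalized_succ.1 hx, map_zero]
      · rw [map_zero, add_zero]
    · exact exists_eq_add_δ_zero_of_cofiberProj_eq_zero hA (hj m le_rfl) hv hx hqx
  -- The same for cycles, including degree `0`.
  have hS : ∀ m ≤ n + 1, ∀ x ∈ B.cycles m, RLie.lin ((cofiberProj j).app (op ⦋m⦌)) x = 0 →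
      ∃ u ∈ A.cycles m, ∃ y ∈ B.normalized (m + 1),
        RLie.lin ((cofiberProj j).app (op ⦋m + 1⦌)) y = 0 ∧
          x = RLie.lin (j.app (op ⦋m⦌)) u + RLie.lin (B.δ 0) y := by
    rintro (_ | m) hm x hx hqx
    · obtain ⟨u, rfl⟩ := (hj 0 (Nat.zero_le _)).2 x
      exact ⟨u, trivial, 0, zero_mem _, map_zero _, by rw [map_zero, add_zero]⟩
    · obtain ⟨u, hu, y, hy, hqy, rfl⟩ := hE m (by omega) x (mem_cycles_iff.1 hx).1 hqx
      refine ⟨u, mem_cycles_iff.2 ⟨hu, (hj m (by omega)).1 ?_⟩, y, hy, hqy, rfl⟩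
      have := (mem_cycles_iff.1 hx).2
      rwa [map_add, (mem_cycles_iff.1 (δ_zero_mem_cycles hy)).2, add_zero, ← lin_δ_naturality,
        ← map_zero (RLie.lin (j.app (op ⦋m⦌)))] at this
  -- A cycle of the loop object is a normalized simplex of the cofiber with zero base.
  have hS' : ∀ m ≤ n + 1, Function.Surjective (homotopyGroupMap (fibMap (j := j)
      (f := fromZero (cofiber j)) (toZero A) (cofiberProj j) (isPushout_cofiber j).w.symm) m) := by
    intro m hm
    rw [homotopyGroupMap_surjective_iff]
    intro z hz
    have hzN := ((mem_cycles_fib z).1 hz).2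
    obtain ⟨y, hy, hyz⟩ := exists_normalized_lift (cofiberProj j) hqs hzN
    have hd : RLie.lin ((cofiber j).δ 0) (fibSnd z) = 0 :=
      (fib_base z).trans (map_zero (RLie.lin ((fromZero (cofiber j)).app (op ⦋m⦌))))
    obtain ⟨u, hu, y', hy', hqy', h⟩ := hS m hm _ (δ_zero_mem_cycles hy) (by
      rw [lin_δ_naturality, hyz, hd])
    have hb : RLie.lin (B.δ 0) (y - y') = RLie.lin (j.app (op ⦋m⦌)) u := by
      rw [map_sub, h, add_sub_cancel_right]
    have hN : y - y' ∈ B.normalized (m + 1) := sub_mem hy hy'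
    refine ⟨fibMk (f := j) u (y - y') hb (apex_eq_zero hN), (mem_cycles_fib _).2 ⟨hu, hN⟩, ?_⟩
    have : z - RLie.lin ((fibMap (j := j) (f := fromZero (cofiber j)) (toZero A) (cofiberProj j)
        (isPushout_cofiber j).w.symm).app (op ⦋m⦌)) (fibMk (f := j) u (y - y') hb
          (apex_eq_zero hN)) = 0 := fib_ext rfl (by
      change fibSnd z - RLie.lin ((cofiberProj j).app (op ⦋m + 1⦌)) (y - y') = 0
      rw [map_sub, hyz, hqy', sub_zero, sub_self])
    rw [this]
    exact zero_mem _
  refine ⟨fun m hm => ⟨?_, hS' m hm.le⟩, hS' (n + 1) le_rfl⟩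
  rw [homotopyGroupMap_injective_iff]
  intro z hz hb
  obtain ⟨hx, hy⟩ := (mem_cycles_fib z).1 hz
  obtain ⟨u₀, -, -, c, hc, hcd⟩ := (mem_boundaries_fib _ (cycles_map _ hz)).1 hb
  have hcd : RLie.lin ((cofiber j).δ 0) c =
      RLie.lin ((cofiberProj j).app (op ⦋m + 1⦌)) (fibSnd z) :=
    hcd.trans ((congrArg (RLie.lin ((cofiberProj j).app (op ⦋m + 1⦌)) (fibSnd z) - ·)
      (map_zero (RLie.lin ((fromZero (cofiber j)).app (op ⦋m + 1⦌))))).trans (sub_zero _))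
  obtain ⟨y, hyN, rfl⟩ := exists_normalized_lift (cofiberProj j) hqs hc
  have hdy := mem_cycles_iff.1 (δ_zero_mem_cycles hyN)
  obtain ⟨u, hu, y', hy', -, h⟩ := hE m (by omega) (fibSnd z - RLie.lin (B.δ 0) y)
    (sub_mem hy hdy.1) (by rw [map_sub, lin_δ_naturality, hcd, sub_self])
  refine (mem_boundaries_fib z hz).2 ⟨u, hu, (hj m (by omega)).1 ?_, y + y', add_mem hyN hy', ?_⟩
  · have := congrArg (RLie.lin (B.δ 0)) h
    rw [map_sub, hdy.2, sub_zero, map_add, (mem_cycles_iff.1 (δ_zero_mem_cycles hy')).2, add_zero,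
      fib_base] at this
    rw [lin_δ_naturality, this]
  · rw [map_add, sub_eq_iff_eq_add] at *
    rw [h]
    abel

end

/-! ### Minimal homotopy cofibers and the comparison with arbitrary ones -/

section

variable {L' L : SRLie p k} {f : L' ⟶ L} {n : ℕ}

theorem isNConnected_fromZero {L : SRLie p k} (hL : IsConnected L) : IsNConnected 0 (fromZero L) :=
  have : Subsingleton (L.homotopyGroup 0) := hL
  ⟨fun _ h => absurd h (Nat.not_lt_zero _), fun _ => ⟨0, Subsingleton.elim _ _⟩⟩

theorem IsNConnected.weakEquivalence_comp {X Y Z : SRLie p k} {g : X ⟶ Y} {h : Y ⟶ Z}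
    (hg : weakEquivalences p k g) (hh : IsNConnected n h) : IsNConnected n (g ≫ h) :=
  ⟨fun i hi => by
    rw [homotopyGroupMap_comp, LinearMap.coe_comp]
    exact (hh.1 i hi).comp (hg i), by
    rw [homotopyGroupMap_comp, LinearMap.coe_comp]
    exact hh.2.comp (hg n).2⟩

/-- In a commutative square whose vertical maps are weak equivalences, the bottom map is
`n`-connected if the top map is. -/
theorem IsNConnected.of_square {X Y X' Y' : SRLie p k} {g : X ⟶ Y} {g' : X' ⟶ Y'} {s : X ⟶ X'}
    {c : Y ⟶ Y'} (hg : IsNConnected n g) (w : s ≫ g' = g ≫ c) (hs : weakEquivalences p k s)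
    (hc : weakEquivalences p k c) : IsNConnected n g' := by
  have e : ∀ i, homotopyGroupMap g' i ∘ homotopyGroupMap s i =
      homotopyGroupMap c i ∘ homotopyGroupMap g i := fun i => by
    rw [← LinearMap.coe_comp, ← LinearMap.coe_comp, ← homotopyGroupMap_comp,
      ← homotopyGroupMap_comp, w]
  refine ⟨fun i hi => (Function.Bijective.of_comp_iff _ (hs i)).1 ?_,
    Function.Surjective.of_comp (g := homotopyGroupMap s n) ?_⟩
  · rw [e]
    exact (hc i).comp (hg.1 i hi)
  · rw [e]
    exact (hc n).2.comp hg.2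

/-- An `n`-connected morphism with connected source has a homotopy cofiber to which excision for
minimal cofibrations applies. -/
theorem exists_homotopyCofiber (hL' : IsConnected L') (hf : IsNConnected n f) :
    ∃ D : HomotopyCofiber f, IsNConnected (n + 1) D.fibToLoop := by
  obtain ⟨A, i, a, -, hi, ha, hA, -⟩ := exists_factorization _ 0 (isNConnected_fromZero hL')
  obtain ⟨B, j, b, hjb, hj, hb, hjn, V, v, hv⟩ :=
    exists_factorization (a ≫ f) n (hf.weakEquivalence_comp ha)
  have hA₀ : Subsingleton (A _⦋0⦌) :=
    ⟨fun x y => by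
      obtain ⟨x, rfl⟩ := (hA 0 le_rfl).2 x
      obtain ⟨y, rfl⟩ := (hA 0 le_rfl).2 y
      rfl⟩
  exact ⟨{ source := A
           target := B
           j := j
           a := a
           b := b
           comm := hjb.symm
           cofibrant_source := fromZero_unique i (fromZero A) ▸ hi
           cofibration_j := hj
           weakEquivalence_a := ha
           weakEquivalence_b := hb
           cofib := cofiber j
           proj := cofiberProj j
           isPushout := isPushout_cofiber j }, isNConnected_fibMap_cofiberProj hA₀ hjn hv⟩

/-- Connectivity of the comparison from the fiber of `j` to the loops of its cofiber does not depend
on the homotopy cofiber. -/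
theorem isNConnected_fibToLoop (D₀ D : HomotopyCofiber f) (h : IsNConnected n D₀.fibToLoop) :
    IsNConnected n D.fibToLoop := by
  obtain ⟨s, t, H, K, hst, -, hH₀, hH₁, hK₀, hK₁⟩ := exists_homotopy_lift D₀.cofibrant_source
    D₀.cofibration_j D.a D.b D.comm D.weakEquivalence_a D.weakEquivalence_b D₀.a D₀.b D₀.comm
  have hs := weakEquivalences_of_homotopy D.weakEquivalence_a D₀.weakEquivalence_a H hH₀ hH₁
  have ht := weakEquivalences_of_homotopy D.weakEquivalence_b D₀.weakEquivalence_b K hK₀ hK₁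
  have w : D₀.j ≫ t ≫ D.proj = toZero D₀.source ≫ fromZero D.cofib := by
    rw [← Category.assoc, ← hst, Category.assoc, D.isPushout.w, ← Category.assoc]
    exact congrArg (· ≫ _) (toZero_unique _ _)
  let c : D₀.cofib ⟶ D.cofib := D₀.isPushout.desc (t ≫ D.proj) (fromZero _) w
  have hc : D₀.proj ≫ c = t ≫ D.proj := D₀.isPushout.inl_desc _ _ _
  have hcw := weakEquivalences_cofiber D₀.isPushout D.isPushout D₀.cofibrant_source
    D₀.cofibration_j D.cofibrant_source D.cofibration_j s t hst hs ht c hc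
  refine h.of_square (s := fibMap s t hst)
    (c := fibMap (𝟙 _) c (fromZero_unique _ _)) ?_ (weakEquivalences_fibMap s t hst hs ht)
    (weakEquivalences_fibMap (𝟙 _) c _ (fun m => ?_) hcw)
  · ext Δ : 2
    refine RLie.hom_ext fun z => Subtype.ext (Prod.ext rfl ?_)
    exact (congrArg (fun g : D₀.target ⟶ D.cofib => RLie.lin (g.app (op (cone.obj Δ.unop))) z.1.2)
      hc).symm
  · rw [homotopyGroupMap_id]
    exact Function.bijective_id

/-- Precomposition with an isomorphism does not affect connectivity in the homotopy category. -/
theorem HoIsNConnected.isIso_comp {X Y Z : Ho p k} (e : X ⟶ Y) [IsIso e] {φ : Y ⟶ Z}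
    (hφ : HoIsNConnected n φ) : HoIsNConnected n (e ≫ φ) := by
  have he : ∀ i, Function.Bijective ((hoHomotopyGroup p k i).map e) := fun i =>
    (ConcreteCategory.isIso_iff_bijective _).1 inferInstance
  refine ⟨fun i hi => ?_, ?_⟩
  · rw [Functor.map_comp]
    exact (hφ.1 i hi).comp (he i)
  · rw [Functor.map_comp]
    exact hφ.2.comp (he n).2

end

end SRLie

theorem mainTheorem7 (p : ℕ) [Fact p.Prime] (k : Type u) [Field k] [CharP k p] [PerfectField k]
    {L' L : SRLie p k} (f : L' ⟶ L) (n : ℕ)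
    (hL' : SRLie.IsConnected L') (hf : SRLie.IsNConnected n f) :
    Nonempty (SRLie.HomotopyCofiber f) ∧
      ∀ D : SRLie.HomotopyCofiber f, SRLie.HoIsNConnected (n + 1) D.naturalMap := by
  obtain ⟨D₀, h⟩ := SRLie.exists_homotopyCofiber hL' hf
  exact ⟨⟨D₀⟩, fun D => SRLie.HoIsNConnected.isIso_comp _
    ((SRLie.hoIsNConnected_toHo_map_iff _ _).2 (SRLie.isNConnected_fibToLoop D₀ D h))⟩
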